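/- Let $p\ge 2$ be an integer, $\mathfrak q=e^{i\pi/p}$, $[n]=\frac{\mathfrak q^n-\mathfrak q^{-n}}{\mathfrak q-\mathfrak q^{-1}}$, $[n]!=[1][2]\cdots[n]$. Let $\mathcal L\mathcal U_{\mathfrak q}$ be the full quantum group of $s\ell(2)$ at $\mathfrak q$: the associative unital $\mathbb C$-algebra generated by $E,F,K^{\pm1},e,f,h$ with relations $$KEK^{-1}=\mathfrak q^2E,\quad KFK^{-1}=\mathfrak q^{-2}F,\quad [E,F]=\tfrac{K-K^{-1}}{\mathfrak q-\mathfrak q^{-1}},\quad E^p=F^p=0,\quad K^{2p}=1,$$ $$[h,e]=e,\quad [h,f]=-f,\quad [e,f]=2h,\quad [h,K]=[E,e]=[K,e]=[F,f]=[K,f]=0,$$ $$[F,e]=\tfrac1{[p-1]!}K^p\tfrac{\mathfrak qK-\mathfrak q^{-1}K^{-1}}{\mathfrak q-\mathfrak q^{-1}}E^{p-1},\qquad [E,f]=\tfrac{(-1)^{p+1}}{[p-1]!}F^{p-1}\tfrac{\mathfrak qK-\mathfrak q^{-1}K^{-1}}{\mathfrak q-\mathfrak q^{-1}},$$ $$[h,E]=\tfrac12EA,\qquad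 [h,F]=-\tfrac12AF,$$ where $$A=\sum_{s=1}^{p-1}\frac{(u_s(\mathfrak q^{-s-1})-u_s(\mathfrak q^{s-1}))K+\mathfrak q^{s-1}u_s(\mathfrak q^{s-1})-\mathfrak q^{-s-1}u_s(\mathfrak q^{-s-1})}{(\mathfrak q^{s-1}-\mathfrak q^{-s-1})\,u_s(\mathfrak q^{-s-1})\,u_s(\mathfrak q^{s-1})}\,u_s(K)\,\mathbf e_s,\qquad u_s(x)=\prod_{\substack{1\le n\le p-1\\ n\ne s}}(x-\mathfrak q^{s-1-2n}),$$ and, with $C=(\mathfrak q-\mathfrak q^{-1})^2EF+\mathfrak q^{-1}K+\mathfrak qK^{-1}$, $\beta_j=\mathfrak q^j+\mathfrak q^{-j}$ and $\psi_s(x)=(x-\beta_0)(x-\beta_p)\prod_{1\le j\le p-1,\,j\ne s}(x-\beta_j)^2$, $$\mathbf e_s=\frac1{\psi_s(\beta_s)}\Bigl(\psi_s(C)-\frac{\psi_s'(\beta_s)}{\psi_s(\beta_s)}(C-\beta_s)\psi_s(C)\Bigr),\qquad 1\le s\le p-1 .$$ For $\alpha\in\{+1,-1\}$, $1\le s\le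 p$, $r\ge1$ let $\mathcal X^{\alpha}_{s,r}$ be the $sr$-dimensional irreducible $\mathcal L\mathcal U_{\mathfrak q}$-module with basis $v_{n,m}$, $0\le n\le s-1$, $0\le m\le r-1$, and action $$Kv_{n,m}=\alpha\mathfrak q^{s-1-2n}v_{n,m},\quad Ev_{n,m}=\alpha[n][s-n]v_{n-1,m},\quad Fv_{n,m}=v_{n+1,m},$$ $$hv_{n,m}=\tfrac12(r-1-2m)v_{n,m},\quad ev_{n,m}=m(r-m)v_{n,m-1},\quad fv_{n,m}=v_{n,m+1},$$ where $v_{-1,m}=v_{n,-1}=v_{s,m}=v_{n,r}=0$. Let $\mathrm{Ext}^n$ denote the $n$-extension groups in the abelian category of finite-dimensional $\mathcal L\mathcal U_{\mathfrak q}$-modules; they are complex vector spaces. **Theorem.** Let $1\le s\le p-1$, $r\ge1$, $\alpha=\pm1$, and let $1\le s'\le p$, $r'\ge1$, $\alpha'=\pm1$ be arbitrary. Let $n\ge1$. (a) If $r=1$, then $$\mathrm{Ext}^n(\mathcal X^{\alpha}_{s,1},\mathcal X^{\alpha'}_{s',r'})\cong\begin{cases}\mathbb C\,\delta_{\alpha',\alpha}\delta_{s',s}\delta_{r',n+1},&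 n\text{ even},\\ \mathbb C\,\delta_{\alpha',-\alpha}\delta_{s',p-s}\delta_{r',n+1},& n\text{ odd}.\end{cases}$$ (b) If $r>1$, then $$\mathrm{Ext}^n(\mathcal X^{\alpha}_{s,r},\mathcal X^{\alpha'}_{s',r'})\cong\begin{cases}\mathbb C\,\delta_{\alpha',\alpha}\delta_{s',s},& n<r\text{ even},\ r'=r+2k,\ -\frac n2\le k\le\frac n2,\\ \mathbb C\,\delta_{\alpha',\alpha}\delta_{s',s},& n\ge r\text{ even},\ r'=2k,\ \frac{n-r+2}2\le k\le\frac{n+r}2,\\ \mathbb C\,\delta_{\alpha',-\alpha}\delta_{s',p-s},& n<r\text{ odd},\ r'=r+2k+1,\ -\frac{n+1}2\le k\le\frac{n-1}2,\\ \mathbb C\,\delta_{\alpha',-\alpha}\delta_{s',p-s},& n\ge r\text{ odd},\ r'=2k+1,\ \frac{n-r+1}2\le k\le\frac{n+r-1}2,\\ 0,&\text{otherwise},\end{cases}$$ where in each case $k$ runs from the lower bound to the upper bound in steps of $1$ (so $k$ takes half-integer values if the lower bound is a half-integer). In particular, for all $r\ge1$, $\mathrm{Ext}^1(\mathcal X^{\alpha}_{s,r},\mathcal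 X^{\alpha'}_{s',r'})\cong\mathbb C$ if $\alpha'=-\alpha$, $s'=p-s$ and $r'=r\pm1$, and it is $0$ otherwise. -/

import Mathlib

namespace LUq

noncomputable section

open Polynomial CategoryTheory

/-! ### The parameter, `q`-numbers and the auxiliary polynomials -/

/-- The root of unity `q = e^{iπ/p}`. -/
def q (p : ℕ) : ℂ := Complex.exp (Real.pi * Complex.I / p)

/-- The `q`-number `[n] = (q^n - q^{-n}) / (q - q^{-1})`. -/
def qNum (p : ℕ) (n : ℤ) : ℂ := (q p ^ n - q p ^ (-n)) / (q p - (q p)⁻¹)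

/-- The `q`-factorial `[n]! = [1][2]⋯[n]`. -/
def qFact (p n : ℕ) : ℂ := ∏ j ∈ Finset.Icc 1 n, qNum p j

/-- `β_j = q^j + q^{-j}`. -/
def beta (p j : ℕ) : ℂ := q p ^ (j : ℤ) + q p ^ (-(j : ℤ))

/-- `ψ_s(x) = (x - β_0)(x - β_p) ∏_{1 ≤ j ≤ p-1, j ≠ s} (x - β_j)²`, used for `1 ≤ s ≤ p-1`. -/
def psi (p s : ℕ) : ℂ[X] :=
  (X - C (beta p 0)) * (X - C (beta p p)) *
    ∏ j ∈ (Finset.Icc 1 (p - 1)).erase s, (X - C (beta p j)) ^ 2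

/-- The polynomial whose value at the Casimir element is the central idempotent `𝐞_s`,
for `1 ≤ s ≤ p-1`. -/
def idemPoly (p s : ℕ) : ℂ[X] :=
  C (1 / (psi p s).eval (beta p s)) *
    (psi p s - C ((derivative (psi p s)).eval (beta p s) / (psi p s).eval (beta p s)) *
      (X - C (beta p s)) * psi p s)

/-- `u_s(x) = ∏_{1 ≤ n ≤ p-1, n ≠ s} (x - q^{s-1-2n})`. -/
def uPoly (p s : ℕ) : ℂ[X] :=
  ∏ n ∈ (Finset.Icc 1 (p - 1)).erase s, (X - C (q p ^ ((s : ℤ) - 1 - 2 * n)))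

/-! ### The algebra -/

/-- The generators `E, F, K, K⁻¹, e, f, h`. -/
inductive Gen : Type
  | E | F | K | Kinv | e | f | h

section Words

variable {R : Type} [Ring R] [Algebra ℂ R] (p : ℕ) (g : Gen → R)

/-- The Casimir element `(q - q⁻¹)² E F + q⁻¹ K + q K⁻¹`. -/
def casimir : R :=
  ((q p - (q p)⁻¹) ^ 2) • (g .E * g .F) + (q p)⁻¹ • g .K + q p • g .Kinv

/-- The central idempotent `𝐞_s`, `1 ≤ s ≤ p-1`, as a polynomial in the Casimir element. -/
def idem (s : ℕ) : R := aeval (casimir p g) (idemPoly p s)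

/-- The `s`-th summand of the element `A`. -/
def elemATerm (s : ℕ) : R :=
  (1 / ((q p ^ ((s : ℤ) - 1) - q p ^ (-(s : ℤ) - 1)) *
      (uPoly p s).eval (q p ^ (-(s : ℤ) - 1)) * (uPoly p s).eval (q p ^ ((s : ℤ) - 1)))) •
    ((((uPoly p s).eval (q p ^ (-(s : ℤ) - 1)) - (uPoly p s).eval (q p ^ ((s : ℤ) - 1))) • g .K +
      algebraMap ℂ R (q p ^ ((s : ℤ) - 1) * (uPoly p s).eval (q p ^ ((s : ℤ) - 1)) -
        q p ^ (-(s : ℤ) - 1) * (uPoly p s).eval (q p ^ (-(s : ℤ) - 1)))) *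
      aeval (g .K) (uPoly p s) * idem p g s)

/-- The element `A` in the relations between `h` and `E, F`. -/
def elemA : R := ∑ s ∈ Finset.Icc 1 (p - 1), elemATerm p g s

/-- The element `(q K - q⁻¹ K⁻¹) / (q - q⁻¹)`. -/
def elemT : R := (1 / (q p - (q p)⁻¹)) • (q p • g .K - (q p)⁻¹ • g .Kinv)

/-- The defining relations of the full quantum `sl(2)` at `q = e^{iπ/p}`. -/
inductive Rel : R → R → Prop
  | K_mul_Kinv : Rel (g .K * g .Kinv) 1
  | Kinv_mul_K : Rel (g .Kinv * g .K) 1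
  | KE : Rel (g .K * g .E * g .Kinv) ((q p ^ 2) • g .E)
  | KF : Rel (g .K * g .F * g .Kinv) (((q p)⁻¹ ^ 2) • g .F)
  | EF : Rel (g .E * g .F - g .F * g .E) ((1 / (q p - (q p)⁻¹)) • (g .K - g .Kinv))
  | E_pow : Rel (g .E ^ p) 0
  | F_pow : Rel (g .F ^ p) 0
  | K_pow : Rel (g .K ^ (2 * p)) 1
  | he : Rel (g .h * g .e - g .e * g .h) (g .e)
  | hf : Rel (g .h * g .f - g .f * g .h) (-g .f)
  | ef : Rel (g .e * g .f - g .f * g .e) ((2 : ℂ) • g .h)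
  | hK : Rel (g .h * g .K - g .K * g .h) 0
  | Ee : Rel (g .E * g .e - g .e * g .E) 0
  | Ke : Rel (g .K * g .e - g .e * g .K) 0
  | Ff : Rel (g .F * g .f - g .f * g .F) 0
  | Kf : Rel (g .K * g .f - g .f * g .K) 0
  | Fe : Rel (g .F * g .e - g .e * g .F)
      ((1 / qFact p (p - 1)) • (g .K ^ p * elemT p g * g .E ^ (p - 1)))
  | Ef : Rel (g .E * g .f - g .f * g .E)
      (((-1) ^ (p + 1) / qFact p (p - 1)) • (g .F ^ (p - 1) * elemT p g))
  | hE : Rel (g .h * g .E - g .E * g .h) ((1 / 2 : ℂ) • (g .E * elemA p g))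
  | hF : Rel (g .h * g .F - g .F * g .h) (-((1 / 2 : ℂ) • (elemA p g * g .F)))

end Words

/-- The full (Lusztig) quantum group `LU_q sl(2)` at `q = e^{iπ/p}`, as an associative
unital `ℂ`-algebra given by generators and relations. -/
abbrev LU (p : ℕ) : Type := RingQuot (Rel p (FreeAlgebra.ι ℂ : Gen → FreeAlgebra ℂ Gen))

/-! ### The modules `X^α_{s,r}` -/

section Simple

variable (p : ℕ) (α : ℤˣ) (s r : ℕ)

/-- The basis vector `v_{n,m}`, `0 ≤ n ≤ s-1`, `0 ≤ m ≤ r-1`; it is `0` for other indices. -/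
def vec (n m : ℕ) : Fin s × Fin r → ℂ :=
  if h : n < s ∧ m < r then Pi.single (⟨n, h.1⟩, ⟨m, h.2⟩) 1 else 0

/-- The linear operator with prescribed values on the basis vectors. -/
def opOn (w : ℕ → ℕ → Fin s × Fin r → ℂ) : Module.End ℂ (Fin s × Fin r → ℂ) :=
  (Pi.basisFun ℂ (Fin s × Fin r)).constr ℂ fun i => w i.1 i.2

/-- The sign `α = ±1` as a complex number. -/
def sgn : ℂ := ((α : ℤ) : ℂ)

/-- The operators by which the generators act on `X^α_{s,r}`.  In the formulas for `E` and `e` the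
coefficient vanishes whenever the truncated index `n - 1` or `m - 1` is not the true one. -/
def act : Gen → Module.End ℂ (Fin s × Fin r → ℂ)
  | .K => opOn s r fun n m => (sgn α * q p ^ ((s : ℤ) - 1 - 2 * n)) • vec s r n m
  | .Kinv => opOn s r fun n m => (sgn α * q p ^ (-((s : ℤ) - 1 - 2 * n))) • vec s r n m
  | .E => opOn s r fun n m => (sgn α * qNum p n * qNum p ((s : ℤ) - n)) • vec s r (n - 1) m
  | .F => opOn s r fun n m => vec s r (n + 1) m
  | .h => opOn s r fun n m => ((1 / 2 : ℂ) * ((r : ℂ) - 1 - 2 * m)) • vec s r n m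
  | .e => opOn s r fun n m => ((m : ℂ) * ((r : ℂ) - m)) • vec s r n (m - 1)
  | .f => opOn s r fun n m => vec s r n (m + 1)

variable {p α s r}

lemma q_ne_zero : q p ≠ 0 := Complex.exp_ne_zero _

lemma q_pow_p (hp : 2 ≤ p) : q p ^ p = -1 := by
  have : (p : ℂ) ≠ 0 := by exact_mod_cast (by omega : p ≠ 0)
  rw [q, ← Complex.exp_nat_mul, mul_div_cancel₀ _ this, Complex.exp_pi_mul_I]

lemma q_sub_ne_zero (hp : 2 ≤ p) : q p - (q p)⁻¹ ≠ 0 := by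
  intro h
  have h0 : (p : ℂ) ≠ 0 := by exact_mod_cast (by omega : p ≠ 0)
  have h1 : q p * q p = 1 := by
    have := sub_eq_zero.1 h
    nth_rewrite 2 [this]
    exact mul_inv_cancel₀ q_ne_zero
  have h2 := Complex.isPrimitiveRoot_exp p (by omega)
  have h3 : Complex.exp (2 * Real.pi * Complex.I / p) = 1 := by
    rw [← h1, q, ← Complex.exp_add]
    congr 1
    ring
  rw [h3] at h2
  have := h2.unique IsPrimitiveRoot.one
  omega

lemma sgn_mul_self : sgn α * sgn α = 1 := by
  rcases Int.units_eq_one_or α with rfl | rfl <;> simp [sgn]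

lemma vec_of_not {n m : ℕ} (h : ¬ (n < s ∧ m < r)) : vec s r n m = 0 := dif_neg h

lemma opOn_vec {w : ℕ → ℕ → Fin s × Fin r → ℂ} {n m : ℕ} (hn : n < s) (hm : m < r) :
    opOn s r w (vec s r n m) = w n m := by
  have : vec s r n m = Pi.basisFun ℂ (Fin s × Fin r) (⟨n, hn⟩, ⟨m, hm⟩) := by
    simp [vec, hn, hm]
  rw [opOn, this, Module.Basis.constr_basis]

lemma ext_vec {f g : Module.End ℂ (Fin s × Fin r → ℂ)}
    (h : ∀ n m, n < s → m < r → f (vec s r n m) = g (vec s r n m)) : f = g := by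
  refine (Pi.basisFun ℂ (Fin s × Fin r)).ext fun i => ?_
  have := h i.1 i.2 i.1.2 i.2.2
  simpa [vec] using this

lemma act_K (n m : ℕ) : act p α s r .K (vec s r n m) =
    (sgn α * q p ^ ((s : ℤ) - 1 - 2 * n)) • vec s r n m := by
  by_cases h : n < s ∧ m < r
  · rw [act, opOn_vec h.1 h.2]
  · simp [vec_of_not h]

lemma act_Kinv (n m : ℕ) : act p α s r .Kinv (vec s r n m) =
    (sgn α * q p ^ (-((s : ℤ) - 1 - 2 * n))) • vec s r n m := by
  by_cases h : n < s ∧ m < r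
  · rw [act, opOn_vec h.1 h.2]
  · simp [vec_of_not h]

lemma act_h (n m : ℕ) : act p α s r .h (vec s r n m) =
    ((1 / 2 : ℂ) * ((r : ℂ) - 1 - 2 * m)) • vec s r n m := by
  by_cases h : n < s ∧ m < r
  · rw [act, opOn_vec h.1 h.2]
  · simp [vec_of_not h]

lemma act_F (n m : ℕ) : act p α s r .F (vec s r n m) = vec s r (n + 1) m := by
  by_cases h : n < s ∧ m < r
  · rw [act, opOn_vec h.1 h.2]
  · rw [vec_of_not h, vec_of_not (by omega), map_zero]

lemma act_f (n m : ℕ) : act p α s r .f (vec s r n m) = vec s r n (m + 1) := by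
  by_cases h : n < s ∧ m < r
  · rw [act, opOn_vec h.1 h.2]
  · rw [vec_of_not h, vec_of_not (by omega), map_zero]

lemma qNum_zero : qNum p 0 = 0 := by simp [qNum]

lemma act_E (n m : ℕ) : act p α s r .E (vec s r n m) =
    (sgn α * qNum p n * qNum p ((s : ℤ) - n)) • vec s r (n - 1) m := by
  by_cases h : n < s ∧ m < r
  · rw [act, opOn_vec h.1 h.2]
  · rw [vec_of_not h, map_zero]
    by_cases hns : n = s
    · subst hns; simp [qNum_zero]
    · rw [vec_of_not (by omega), smul_zero]

lemma act_e (n m : ℕ) : act p α s r .e (vec s r n m) =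
    ((m : ℂ) * ((r : ℂ) - m)) • vec s r n (m - 1) := by
  by_cases h : n < s ∧ m < r
  · rw [act, opOn_vec h.1 h.2]
  · rw [vec_of_not h, map_zero]
    by_cases hns : m = r
    · subst hns; simp
    · rw [vec_of_not (by omega), smul_zero]

lemma aeval_apply_vec {V : Type} [AddCommGroup V] [Module ℂ V] {T : Module.End ℂ V} {v : V} {c : ℂ}
    (h : T v = c • v) (P : ℂ[X]) : aeval T P v = P.eval c • v := by
  induction P using Polynomial.induction_on' with
  | add P Q hP hQ => simp [hP, hQ, add_smul]
  | monomial n a =>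
    have : ∀ k : ℕ, (T ^ k) v = c ^ k • v := by
      intro k
      induction k with
      | zero => simp
      | succ k ih => rw [pow_succ', Module.End.mul_apply, ih, map_smul, h, smul_smul, pow_succ]
    simp [aeval_monomial, this, smul_smul, mul_comm]

lemma qNum_mul_qNum_sub (hp : 2 ≤ p) (s n : ℤ) :
    (q p - (q p)⁻¹) ^ 2 * (qNum p n * qNum p (s - n)) =
      q p ^ s + q p ^ (-s) - q p ^ (s - 2 * n) - q p ^ (-(s - 2 * n)) := by
  have h := q_sub_ne_zero hp
  have h0 : q p ≠ 0 := q_ne_zero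
  have : (q p - (q p)⁻¹) ^ 2 * (qNum p n * qNum p (s - n)) =
      (q p ^ n - q p ^ (-n)) * (q p ^ (s - n) - q p ^ (-(s - n))) := by
    simp only [qNum]
    generalize q p - (q p)⁻¹ = d at h
    field_simp
  rw [this, sub_mul, mul_sub, mul_sub, ← zpow_add₀ h0, ← zpow_add₀ h0, ← zpow_add₀ h0,
    ← zpow_add₀ h0]
  ring_nf

lemma act_EF (n m : ℕ) : act p α s r .E (act p α s r .F (vec s r n m)) =
    (sgn α * (qNum p (n + 1) * qNum p ((s : ℤ) - (n + 1)))) • vec s r n m := by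
  rw [act_F, act_E]
  simp [mul_assoc]

lemma act_FE (n m : ℕ) : act p α s r .F (act p α s r .E (vec s r n m)) =
    (sgn α * (qNum p n * qNum p ((s : ℤ) - n))) • vec s r n m := by
  rw [act_E, map_smul, act_F]
  rcases n with _ | n
  · simp [qNum_zero]
  · simp [mul_assoc]

lemma casimir_vec (hp : 2 ≤ p) (n m : ℕ) : casimir p (act p α s r) (vec s r n m) =
    (sgn α * (q p ^ (s : ℤ) + q p ^ (-(s : ℤ)))) • vec s r n m := by
  simp only [casimir, LinearMap.add_apply, LinearMap.smul_apply, Module.End.mul_apply, act_EF,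
    act_K, act_Kinv, smul_smul, ← add_smul]
  congr 1
  have h1 := qNum_mul_qNum_sub hp s (n + 1)
  have h0 : q p ≠ 0 := q_ne_zero
  have h2 : (q p)⁻¹ * q p ^ ((s : ℤ) - 1 - 2 * n) = q p ^ ((s : ℤ) - 2 * (n + 1)) := by
    rw [← zpow_neg_one, ← zpow_add₀ h0]; congr 1; ring
  have h3 : q p * q p ^ (-((s : ℤ) - 1 - 2 * n)) = q p ^ (-((s : ℤ) - 2 * (n + 1))) := by
    nth_rewrite 1 [← zpow_one (q p)]
    rw [← zpow_add₀ h0]; congr 1; ring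
  linear_combination (sgn α) * h1 + sgn α * h2 + sgn α * h3

lemma idemPoly_eval_beta {t j : ℕ} (hj : j ≤ p) (h : j ≠ t) :
    (idemPoly p t).eval (beta p j) = 0 := by
  have : (psi p t).eval (beta p j) = 0 := by
    by_cases h0 : j = 0
    · simp [psi, h0]
    by_cases hjp : j = p
    · simp [psi, hjp]
    have : j ∈ (Finset.Icc 1 (p - 1)).erase t :=
      Finset.mem_erase.2 ⟨h, Finset.mem_Icc.2 ⟨by omega, by omega⟩⟩
    simp only [psi, eval_mul, eval_prod]
    rw [Finset.prod_eq_zero this (by simp), mul_zero]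
  simp [idemPoly, this]

lemma uPoly_eval {t k : ℕ} (hk : k ∈ Finset.Icc 1 (p - 1)) (h : k ≠ t) :
    (uPoly p t).eval (q p ^ ((t : ℤ) - 1 - 2 * k)) = 0 := by
  simp only [uPoly, eval_prod]
  exact Finset.prod_eq_zero (Finset.mem_erase.2 ⟨h, hk⟩) (by simp)

lemma q_zpow_p (hp : 2 ≤ p) : q p ^ (p : ℤ) = -1 := by
  rw [zpow_natCast, q_pow_p hp]

lemma q_zpow_neg_p (hp : 2 ≤ p) : q p ^ (-(p : ℤ)) = -1 := by
  rw [zpow_neg, q_zpow_p hp]; norm_num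

lemma idem_mul_u_eval (hp : 2 ≤ p) (hs : s ≤ p) {t n : ℕ} (h1 : 1 ≤ n) (hn : n < s) :
    (idemPoly p t).eval (sgn α * (q p ^ (s : ℤ) + q p ^ (-(s : ℤ)))) *
      (uPoly p t).eval (sgn α * q p ^ ((s : ℤ) - 1 - 2 * n)) = 0 := by
  have h0 : q p ≠ 0 := q_ne_zero
  rcases Int.units_eq_one_or α with rfl | rfl
  · have hb : sgn 1 * (q p ^ (s : ℤ) + q p ^ (-(s : ℤ))) = beta p s := by simp [sgn, beta]
    rw [hb]
    by_cases hst : s = t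
    · subst hst
      have := uPoly_eval (p := p) (t := s) (k := n) (Finset.mem_Icc.2 ⟨h1, by omega⟩) (by omega)
      simp [sgn, this]
    · rw [idemPoly_eval_beta hs hst, zero_mul]
  · have hb : sgn (-1) * (q p ^ (s : ℤ) + q p ^ (-(s : ℤ))) = beta p (p - s) := by
      have e1 : (((p - s : ℕ) : ℤ)) = p - s := by omega
      have e2 : -((p : ℤ) - s) = -p + s := by ring
      rw [beta, e1, e2, zpow_add₀ h0, sub_eq_add_neg, zpow_add₀ h0, q_zpow_p hp, q_zpow_neg_p hp]
      simp [sgn]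
    rw [hb]
    by_cases hst : p - s = t
    · have := uPoly_eval (p := p) (t := t) (k := t + n) (Finset.mem_Icc.2 ⟨by omega, by omega⟩)
        (by omega)
      have e : (t : ℤ) - 1 - 2 * ((t + n : ℕ) : ℤ) = -p + (s - 1 - 2 * n) := by omega
      rw [e, zpow_add₀ h0, q_zpow_neg_p hp] at this
      simp [sgn] at this ⊢
      exact Or.inr this
    · rw [idemPoly_eval_beta (by omega) hst, zero_mul]

lemma elemA_vec (hp : 2 ≤ p) (hs : s ≤ p) (n m : ℕ) : ∃ a : ℂ,
    elemA p (act p α s r) (vec s r n m) = a • vec s r n m ∧ (1 ≤ n → n < s → a = 0) := by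
  have key : ∀ t : ℕ, ∃ a : ℂ, elemATerm p (act p α s r) t (vec s r n m) = a • vec s r n m ∧
      (1 ≤ n → n < s → a = 0) := by
    intro t
    have hi : idem p (act p α s r) t (vec s r n m) = _ :=
      aeval_apply_vec (casimir_vec (α := α) (s := s) (r := r) hp n m) (idemPoly p t)
    have hu : aeval (act p α s r .K) (uPoly p t) (vec s r n m) = _ :=
      aeval_apply_vec (act_K (α := α) (s := s) (r := r) n m) (uPoly p t)
    simp only [elemATerm, LinearMap.smul_apply, Module.End.mul_apply, hi, map_smul, hu,
      LinearMap.add_apply, act_K, Module.algebraMap_end_apply, smul_smul, ← add_smul]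
    refine ⟨_, rfl, fun h1 hn => ?_⟩
    have := idem_mul_u_eval (α := α) hp hs (t := t) h1 hn
    generalize (idemPoly p t).eval (sgn α * (q p ^ (s : ℤ) + q p ^ (-(s : ℤ)))) = x at this ⊢
    generalize (uPoly p t).eval (sgn α * q p ^ ((s : ℤ) - 1 - 2 * n)) = y at this ⊢
    rcases mul_eq_zero.1 this with h | h <;> simp [h]
  choose a ha ha' using key
  refine ⟨∑ t ∈ Finset.Icc 1 (p - 1), a t, ?_, fun h1 hn =>
    Finset.sum_eq_zero fun t _ => ha' t h1 hn⟩
  simp [elemA, LinearMap.sum_apply, ha, Finset.sum_smul]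

lemma act_F_pow (k n m : ℕ) : (act p α s r .F ^ k) (vec s r n m) = vec s r (n + k) m := by
  induction k generalizing n with
  | zero => simp
  | succ k ih => rw [pow_succ, Module.End.mul_apply, act_F, ih]; congr 1; omega

lemma act_E_pow (k n m : ℕ) : ∃ a : ℂ,
    (act p α s r .E ^ k) (vec s r n m) = a • vec s r (n - k) m ∧ (n < k → a = 0) := by
  induction k with
  | zero => exact ⟨1, by simp⟩
  | succ k ih =>
    obtain ⟨a, ha, ha'⟩ := ih
    rw [pow_succ', Module.End.mul_apply, ha, map_smul, act_E, smul_smul]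
    refine ⟨_, by rw [Nat.sub_sub], fun h => ?_⟩
    by_cases hn : n < k
    · rw [ha' hn, zero_mul]
    · have : n - k = 0 := by omega
      simp [this, qNum_zero]

lemma elemT_vec (n m : ℕ) : ∃ a : ℂ,
    elemT p (act p α s r) (vec s r n m) = a • vec s r n m := by
  simp only [elemT, LinearMap.smul_apply, LinearMap.sub_apply, act_K, act_Kinv, smul_smul,
    ← sub_smul]
  exact ⟨_, rfl⟩

lemma elemT_vec_zero (hp : 2 ≤ p) (hs : s = p) (m : ℕ) :
    elemT p (act p α s r) (vec s r 0 m) = 0 := by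
  subst hs
  have h0 : q s ≠ 0 := q_ne_zero
  have h1 : q s * q s ^ ((s : ℤ) - 1) = -1 := by
    nth_rewrite 1 [← zpow_one (q s)]
    rw [← zpow_add₀ h0, ← q_zpow_p hp]; congr 1; ring
  have h2 : (q s)⁻¹ * q s ^ (-((s : ℤ) - 1)) = -1 := by
    rw [← zpow_neg_one, ← zpow_add₀ h0, ← q_zpow_neg_p hp]; congr 1; ring
  simp only [elemT, LinearMap.smul_apply, LinearMap.sub_apply, act_K, act_Kinv, smul_smul,
    ← sub_smul]
  convert zero_smul ℂ _
  simp only [Nat.cast_zero, mul_zero, sub_zero]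
  linear_combination (1 / (q s - (q s)⁻¹)) * sgn α * (h1 - h2)

lemma act_K_pow (k n m : ℕ) : (act p α s r .K ^ k) (vec s r n m) =
    (sgn α * q p ^ ((s : ℤ) - 1 - 2 * n)) ^ k • vec s r n m := by
  induction k with
  | zero => simp
  | succ k ih => rw [pow_succ', Module.End.mul_apply, ih, map_smul, act_K, smul_smul, pow_succ]

/-- The operators `act` satisfy the defining relations. -/
lemma act_rel (hp : 2 ≤ p) (hs : s ≤ p) {x y : Module.End ℂ (Fin s × Fin r → ℂ)}
    (hxy : Rel p (act p α s r) x y) : x = y := by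
  have h0 : q p ≠ 0 := q_ne_zero
  have hq := q_sub_ne_zero hp
  have hα : sgn α * sgn α = 1 := sgn_mul_self
  refine ext_vec fun n m hn hm => ?_
  cases hxy with
  | K_mul_Kinv =>
    rw [Module.End.mul_apply, act_Kinv, map_smul, act_K, smul_smul, Module.End.one_apply]
    convert one_smul ℂ _
    rw [mul_mul_mul_comm, hα, ← zpow_add₀ h0]; simp
  | Kinv_mul_K =>
    rw [Module.End.mul_apply, act_K, map_smul, act_Kinv, smul_smul, Module.End.one_apply]
    convert one_smul ℂ _
    rw [mul_mul_mul_comm, hα, ← zpow_add₀ h0]; simp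
  | KE =>
    simp only [Module.End.mul_apply, act_Kinv, map_smul, act_E, act_K, smul_smul,
      LinearMap.smul_apply]
    rcases n with _ | n
    · simp [qNum_zero]
    congr 1
    have h2 : q p ^ (-((s : ℤ) - 1 - 2 * ((n + 1 : ℕ) : ℤ))) * q p ^ ((s : ℤ) - 1 - 2 * (n : ℕ)) =
        q p ^ 2 := by
      rw [← zpow_add₀ h0, ← zpow_natCast]; congr 1; push_cast; ring
    simp only [Nat.add_sub_cancel]
    generalize qNum p ((n + 1 : ℕ) : ℤ) = A
    generalize qNum p ((s : ℤ) - ((n + 1 : ℕ) : ℤ)) = B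
    linear_combination (sgn α * sgn α * sgn α * A * B) * h2 + (q p ^ 2 * sgn α * A * B) * hα
  | KF =>
    simp only [Module.End.mul_apply, act_Kinv, map_smul, act_F, act_K, smul_smul,
      LinearMap.smul_apply]
    congr 1
    have h2 : q p ^ (-((s : ℤ) - 1 - 2 * (n : ℕ))) * q p ^ ((s : ℤ) - 1 - 2 * ((n + 1 : ℕ) : ℤ)) =
        (q p)⁻¹ ^ 2 := by
      rw [← zpow_add₀ h0, ← zpow_neg_one, ← zpow_natCast, ← zpow_mul]; congr 1; push_cast; ring
    linear_combination (sgn α * sgn α) * h2 + ((q p)⁻¹ ^ 2) * hα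
  | EF =>
    simp only [Module.End.mul_apply, LinearMap.sub_apply, LinearMap.smul_apply, act_EF, act_FE,
      act_K, act_Kinv, ← sub_smul, smul_smul]
    congr 1
    have e1 := qNum_mul_qNum_sub hp s (n + 1)
    have e2 := qNum_mul_qNum_sub hp s n
    have e3 : q p ^ ((s : ℤ) - 2 * (n + 1)) = (q p)⁻¹ * q p ^ ((s : ℤ) - 1 - 2 * n) := by
      rw [← zpow_neg_one, ← zpow_add₀ h0]; congr 1; ring
    have e4 : q p ^ (-((s : ℤ) - 2 * (n + 1))) = q p * q p ^ (-((s : ℤ) - 1 - 2 * n)) := by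
      nth_rewrite 2 [← zpow_one (q p)]
      rw [← zpow_add₀ h0]; congr 1; ring
    have e5 : q p ^ ((s : ℤ) - 2 * n) = q p * q p ^ ((s : ℤ) - 1 - 2 * n) := by
      nth_rewrite 2 [← zpow_one (q p)]
      rw [← zpow_add₀ h0]; congr 1; ring
    have e6 : q p ^ (-((s : ℤ) - 2 * n)) = (q p)⁻¹ * q p ^ (-((s : ℤ) - 1 - 2 * n)) := by
      rw [← zpow_neg_one, ← zpow_add₀ h0]; congr 1; ring
    rw [e3, e4] at e1
    rw [e5, e6] at e2
    have hq2 : (q p - (q p)⁻¹) ^ 2 ≠ 0 := pow_ne_zero _ hq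
    apply mul_left_cancel₀ hq2
    have e7 : (q p - (q p)⁻¹) * (1 / (q p - (q p)⁻¹)) = 1 := mul_one_div_cancel hq
    generalize q p ^ ((s : ℤ) - 1 - 2 * n) = P at *
    generalize q p ^ (-((s : ℤ) - 1 - 2 * n)) = N at *
    linear_combination sgn α * (e1 - e2) - (q p - (q p)⁻¹) * sgn α * (P - N) * e7
  | E_pow =>
    obtain ⟨a, ha, ha'⟩ := act_E_pow (p := p) (α := α) (s := s) (r := r) p n m
    rw [ha, ha' (by omega), zero_smul, LinearMap.zero_apply]
  | F_pow => rw [act_F_pow, vec_of_not (by omega), LinearMap.zero_apply]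
  | K_pow =>
    rw [act_K_pow, Module.End.one_apply]
    convert one_smul ℂ _
    rw [mul_pow, pow_mul (sgn α), pow_two (sgn α), hα, one_pow, one_mul, ← zpow_natCast,
      ← zpow_mul]
    have : ((s : ℤ) - 1 - 2 * n) * (2 * p : ℕ) = (p : ℤ) * (2 * ((s : ℤ) - 1 - 2 * n)) := by
      push_cast; ring
    rw [this, zpow_mul, q_zpow_p hp, zpow_mul]
    norm_num
  | he =>
    simp only [Module.End.mul_apply, LinearMap.sub_apply, act_h, act_e, map_smul, smul_smul,
      ← sub_smul]
    rcases m with _ | m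
    · simp
    congr 1
    simp only [Nat.add_sub_cancel]
    push_cast
    ring
  | hf =>
    simp only [Module.End.mul_apply, LinearMap.sub_apply, act_h, act_f, map_smul,
      ← sub_smul, LinearMap.neg_apply, ← neg_one_smul ℂ (vec s r n (m + 1))]
    congr 1
    push_cast
    ring
  | ef =>
    simp only [Module.End.mul_apply, LinearMap.sub_apply, act_h, act_f, act_e, map_smul, smul_smul,
      LinearMap.smul_apply, Nat.add_sub_cancel]
    rcases m with _ | m
    · simp
    · simp only [Nat.add_sub_cancel, ← sub_smul]
      congr 1
      push_cast
      ring
  | hK =>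
    simp only [Module.End.mul_apply, LinearMap.sub_apply, act_h, act_K, map_smul, smul_smul,
      ← sub_smul, LinearMap.zero_apply]
    rw [mul_comm, sub_self, zero_smul]
  | Ee =>
    simp only [Module.End.mul_apply, LinearMap.sub_apply, act_E, act_e, map_smul, smul_smul,
      ← sub_smul, LinearMap.zero_apply]
    rw [mul_comm, sub_self, zero_smul]
  | Ke =>
    simp only [Module.End.mul_apply, LinearMap.sub_apply, act_K, act_e, map_smul, smul_smul,
      ← sub_smul, LinearMap.zero_apply]
    rw [mul_comm, sub_self, zero_smul]
  | Ff =>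
    simp only [Module.End.mul_apply, LinearMap.sub_apply, act_F, act_f, LinearMap.zero_apply,
      sub_self]
  | Kf =>
    simp only [Module.End.mul_apply, LinearMap.sub_apply, act_K, act_f, map_smul,
      LinearMap.zero_apply, sub_self]
  | Fe =>
    have hl : (act p α s r .F * act p α s r .e - act p α s r .e * act p α s r .F) (vec s r n m) =
        0 := by
      simp only [Module.End.mul_apply, LinearMap.sub_apply, act_F, act_e, map_smul, sub_self]
    rw [hl, LinearMap.smul_apply, Module.End.mul_apply, Module.End.mul_apply]
    obtain ⟨a, ha, ha'⟩ := act_E_pow (p := p) (α := α) (s := s) (r := r) (p - 1) n m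
    rw [ha]
    by_cases hsp : s = p
    · have : n - (p - 1) = 0 := by omega
      rw [this, map_smul, elemT_vec_zero hp hsp]
      simp
    · rw [ha' (by omega)]
      simp
  | Ef =>
    have hl : (act p α s r .E * act p α s r .f - act p α s r .f * act p α s r .E) (vec s r n m) =
        0 := by
      simp only [Module.End.mul_apply, LinearMap.sub_apply, act_E, act_f, map_smul, sub_self]
    rw [hl, LinearMap.smul_apply, Module.End.mul_apply]
    by_cases hsp : s = p ∧ n = 0
    · obtain ⟨h1, rfl⟩ := hsp
      rw [elemT_vec_zero hp h1]
      simp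
    · obtain ⟨a, ha⟩ := elemT_vec (p := p) (α := α) (s := s) (r := r) n m
      rw [ha, map_smul, act_F_pow, vec_of_not (by omega)]
      simp
  | hE =>
    have hl : (act p α s r .h * act p α s r .E - act p α s r .E * act p α s r .h) (vec s r n m) =
        0 := by
      simp only [Module.End.mul_apply, LinearMap.sub_apply, act_E, act_h, map_smul, smul_smul]
      rw [mul_comm, sub_self]
    obtain ⟨a, ha, ha'⟩ := elemA_vec (α := α) (r := r) hp hs n m
    rw [hl, LinearMap.smul_apply, Module.End.mul_apply, ha, map_smul, act_E]
    rcases n with _ | n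
    · simp [qNum_zero]
    · rw [ha' (by omega) hn]; simp
  | hF =>
    have hl : (act p α s r .h * act p α s r .F - act p α s r .F * act p α s r .h) (vec s r n m) =
        0 := by
      simp only [Module.End.mul_apply, LinearMap.sub_apply, act_F, act_h, map_smul, sub_self]
    obtain ⟨a, ha, ha'⟩ := elemA_vec (α := α) (r := r) hp hs (n + 1) m
    rw [hl, LinearMap.neg_apply, LinearMap.smul_apply, Module.End.mul_apply, act_F, ha]
    by_cases h1 : n + 1 < s
    · rw [ha' (by omega) h1]; simp
    · rw [vec_of_not (by omega)]; simp

end Simple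

section Map

variable {R S : Type} [Ring R] [Algebra ℂ R] [Ring S] [Algebra ℂ S] {p : ℕ} {g : Gen → R}

lemma map_casimir (φ : R →ₐ[ℂ] S) : φ (casimir p g) = casimir p (φ ∘ g) := by
  simp [casimir]

lemma map_elemT (φ : R →ₐ[ℂ] S) : φ (elemT p g) = elemT p (φ ∘ g) := by
  simp [elemT]

lemma map_elemA (φ : R →ₐ[ℂ] S) : φ (elemA p g) = elemA p (φ ∘ g) := by
  simp only [elemA, elemATerm, idem, map_sum, map_smul, map_mul, map_add, AlgHom.commutes,
    ← aeval_algHom_apply, map_casimir, Function.comp_apply]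

/-- The defining relations are preserved by algebra homomorphisms. -/
lemma Rel.map (φ : R →ₐ[ℂ] S) {x y : R} (h : Rel p g x y) : Rel p (φ ∘ g) (φ x) (φ y) := by
  cases h <;>
    simp only [map_mul, map_smul, map_sub, map_neg, map_pow, map_one, map_zero,
      map_elemT, map_elemA]
  · exact .K_mul_Kinv
  · exact .Kinv_mul_K
  · exact .KE
  · exact .KF
  · exact .EF
  · exact .E_pow
  · exact .F_pow
  · exact .K_pow
  · exact .he
  · exact .hf
  · exact .ef
  · exact .hK
  · exact .Ee
  · exact .Ke
  · exact .Ff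
  · exact .Kf
  · exact .Fe
  · exact .Ef
  · exact .hE
  · exact .hF

end Map

/-- The representation of `LU p` on the space with basis `v_{n,m}` in which the generators act by
the operators `act`. -/
def rep (p : ℕ) (hp : 2 ≤ p) (α : ℤˣ) (s r : ℕ) (hs : s ≤ p) :
    LU p →ₐ[ℂ] Module.End ℂ (Fin s × Fin r → ℂ) :=
  RingQuot.liftAlgHom ℂ ⟨FreeAlgebra.lift ℂ (act p α s r), fun _ _ h => by
    have := h.map (FreeAlgebra.lift ℂ (act p α s r))
    rw [FreeAlgebra.ι_comp_lift] at this
    exact act_rel hp hs this⟩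

/-! ### The category of finite-dimensional modules -/

open scoped ModuleCat

/-- The property of an `LU p`-module of being finite-dimensional over `ℂ`. -/
def isFinDim (p : ℕ) : ObjectProperty (ModuleCat.{0} (LU p)) := fun M => Module.Finite ℂ M

instance (p : ℕ) : (isFinDim p).IsClosedUnderSubobjects where
  prop_of_mono {X Y} f _ hY := by
    have : Module.Finite ℂ Y := hY
    exact Module.Finite.of_injective (f.hom.restrictScalars ℂ)
      ((ModuleCat.mono_iff_injective f).1 inferInstance)

instance (p : ℕ) : (isFinDim p).IsClosedUnderQuotients where
  prop_of_epi {X Y} f _ hX := by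
    have : Module.Finite ℂ X := hX
    exact Module.Finite.of_surjective (f.hom.restrictScalars ℂ)
      ((ModuleCat.epi_iff_surjective f).1 inferInstance)

instance (p : ℕ) : (isFinDim p).ContainsZero where
  exists_zero := ⟨ModuleCat.of (LU p) PUnit, ModuleCat.isZero_of_subsingleton _,
    (inferInstance : Module.Finite ℂ PUnit)⟩

instance (p : ℕ) : (isFinDim p).IsClosedUnderFiniteProducts where
  isClosedUnderLimitsOfShape J _ := ⟨by
    rintro X ⟨P⟩
    have : ∀ j : J, Module.Finite ℂ (P.diag.obj ⟨j⟩) := fun j => P.prop_diag_obj ⟨j⟩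
    let φ : X →ₗ[ℂ] ∀ j : J, P.diag.obj ⟨j⟩ :=
      LinearMap.pi fun j => (P.π.app ⟨j⟩).hom.restrictScalars ℂ
    refine Module.Finite.of_injective φ fun x y hxy => ?_
    refine Limits.Concrete.isLimit_ext _ P.isLimit _ _ ?_
    rintro ⟨j⟩
    exact congrFun hxy j⟩

/-- The category `𝒞_p` of finite-dimensional left `LU p`-modules. -/
abbrev FDMod (p : ℕ) : Type 1 := (isFinDim p).FullSubcategory

/-- `Ext`-groups in the category of finite-dimensional modules, computed in that category. -/
instance (p : ℕ) : HasExt.{1} (FDMod p) := HasExt.standard _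

/-- The module `X^α_{s,r}` as an object of the category of finite-dimensional modules. -/
def simpleMod (p : ℕ) (hp : 2 ≤ p) (α : ℤˣ) (s r : ℕ) (hs : s ≤ p) : FDMod p :=
  letI : Module (LU p) (Fin s × Fin r → ℂ) := Module.compHom _ (rep p hp α s r hs).toRingHom
  ⟨ModuleCat.of (LU p) (Fin s × Fin r → ℂ), by
    have h : Module.restrictScalars ℂ (LU p) (Fin s × Fin r → ℂ) =
        (inferInstance : Module ℂ (Fin s × Fin r → ℂ)) := Module.ext' _ _ fun c x => by
      change rep p hp α s r hs (algebraMap ℂ (LU p) c) x = c • x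
      rw [AlgHom.commutes, Module.algebraMap_end_apply]
    change @Module.Finite ℂ (Fin s × Fin r → ℂ) _ _ (Module.restrictScalars ℂ (LU p) _)
    rw [h]
    infer_instance⟩

/-! ### The parameters of the nonzero extension groups -/

/-- `k` runs through `a, a + 1, a + 2, …` as long as `k ≤ b`. -/
def steps (a b : ℚ) : Set ℚ := {k | (∃ j : ℕ, k = a + j) ∧ k ≤ b}

/-- The list of parameters for which the `n`-th extension group from `X^α_{s,r}` to `X^α'_{s',r'}`
is one-dimensional. -/
def ExtIsLine (p n : ℕ) (α : ℤˣ) (s r : ℕ) (α' : ℤˣ) (s' r' : ℕ) : Prop :=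
  if r = 1 then
    (Even n ∧ α' = α ∧ s' = s ∧ r' = n + 1) ∨
    (Odd n ∧ α' = -α ∧ s' = p - s ∧ r' = n + 1)
  else
    (Even n ∧ n < r ∧ α' = α ∧ s' = s ∧
      ∃ k ∈ steps (-(n / 2)) (n / 2), (r' : ℚ) = r + 2 * k) ∨
    (Even n ∧ r ≤ n ∧ α' = α ∧ s' = s ∧
      ∃ k ∈ steps ((n - r + 2) / 2) ((n + r) / 2), (r' : ℚ) = 2 * k) ∨
    (Odd n ∧ n < r ∧ α' = -α ∧ s' = p - s ∧
      ∃ k ∈ steps (-((n + 1) / 2)) ((n - 1) / 2), (r' : ℚ) = r + 2 * k + 1) ∨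
    (Odd n ∧ r ≤ n ∧ α' = -α ∧ s' = p - s ∧
      ∃ k ∈ steps ((n - r + 1) / 2) ((n + r - 1) / 2), (r' : ℚ) = 2 * k + 1)

end

end LUq

namespace LUq

noncomputable section

open Polynomial CategoryTheory

open Limits

/-! The types (α, s) and (−α, p − s) make up one block: their K-weights together are the p points of
the cycle `ZMod p`, which is cut at the two junctions 0 and s. The block is controlled by sl(2) and
the exterior algebra Λ of its two-dimensional representation.

Let D be an sl(2)-module with operators x, y that transform as a doublet and satisfy the exterior
relations (`SlData`). On functions from the cycle to D the full quantum group acts as follows. At a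
junction F is x and E is a multiple of y. Elsewhere F is the identity and E is a scalar plus a
multiple of xy (`isRep_actT`). If D is a sum of two parts exchanged by x and y, the functions taking
values in one part on one arc and in the other part on the other arc form a submodule
(`isRep_graded`). Write L_r for the r-dimensional representation of sl(2). Then D = L_r gives the
irreducible module X, D = L_{r+1} ⊗ Λ gives a module P, and D = L_{r+1} ⊕ L_r, with x and y acting
as the partial derivatives of binary forms, gives an intermediate module W.

Three facts carry the computation. There are short exact sequences W(r+1) → P(r) → W(r)
(`shortExact_WPW`) and X(r) → W(r) → X(r+1) (`shortExact_XWX`), where the left-hand terms have the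
opposite type; the first is the exactness of the polynomial de Rham complex in two variables. The
module P is projective (`projective_pMod`): it is generated by one vector, highest for sl(2) and of
weight index 0; such vectors lift along surjections (`exists_lift_highest`), and each of them
extends to a homomorphism from P (`extMap_actT`). Homomorphisms from W and X to an irreducible
module are read off from the image of a highest weight vector (`isLineIf_wMod_hom`,
`isLineIf_xMod_hom`).

Dimension shifting along P turns Ext^n of W(r) into Hom from W(r+n) of the n times flipped type.
Induction on r along the second sequence then gives a line in Ext^n(X(r), X(r')) exactly when the
types fit and r' = r + n − 2x with 0 ≤ x ≤ min(n, r − 1) (`isLineIf_ext_of_system`). These are the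
Clebsch–Gordan constituents of L_r ⊗ S^n(ℂ²), as one expects since the symmetric algebra is Koszul
dual to Λ. The table in the theorem is the same list in other parameters (`extIsLine_iff`). -/

/-- The space `V` is a line if `c` holds, and zero otherwise. -/
def IsLineIf (V : Type*) [AddCommGroup V] [Module ℂ V] (c : Prop) : Prop :=
  (c → Nonempty (V ≃ₗ[ℂ] ℂ)) ∧ (¬ c → Subsingleton V)

/-! ### Homological algebra: extension groups from two families of short exact sequences. -/

section ExtLine

lemma IsLineIf.congr {V V' : Type*} [AddCommGroup V] [Module ℂ V] [AddCommGroup V'] [Module ℂ V']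
    {c c' : Prop} (h : IsLineIf V c) (e : V ≃ₗ[ℂ] V') (hc : c ↔ c') : IsLineIf V' c' :=
  ⟨fun hc' => (h.1 (hc.2 hc')).map fun e' => e.symm.trans e',
    fun hc' => have := h.2 fun h' => hc' (hc.1 h'); e.symm.toEquiv.subsingleton⟩

variable {𝒞 : Type*} [Category 𝒞] [Abelian 𝒞] [Linear ℂ 𝒞] [HasExt 𝒞]

/-- If the middle term does not contribute, the connecting map is an isomorphism. -/
def extShift {S : ShortComplex 𝒞} (hS : S.ShortExact) (Y : 𝒞) (n : ℕ)
    (h0 : ∀ x : Abelian.Ext S.X₂ Y n, (Abelian.Ext.mk₀ S.f).comp x (zero_add n) = 0)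
    (h1 : Subsingleton (Abelian.Ext S.X₂ Y (n + 1))) :
    Abelian.Ext S.X₁ Y n ≃ₗ[ℂ] Abelian.Ext S.X₃ Y (n + 1) :=
  LinearEquiv.ofBijective (hS.extClass.precompOfLinear ℂ Y (add_comm 1 n)) (by
    constructor
    · rw [injective_iff_map_eq_zero]
      intro x hx
      obtain ⟨y, rfl⟩ := Abelian.Ext.contravariant_sequence_exact₁ hS Y x (add_comm 1 n) hx
      exact h0 y
    · intro x
      exact Abelian.Ext.contravariant_sequence_exact₃ hS Y x (Subsingleton.elim _ _)
        (add_comm 1 n))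

/-- In the long exact sequence the group of `S.X₃` sits between those of `S.X₁` in degree n and of
`S.X₂` in degree n + 1. Whenever one of these is a line, `ha` or `hb` makes the next group outwards
vanish, so the line survives; `hab` excludes two contributions at once. -/
lemma isLineIf_ext_of_shortExact {S : ShortComplex 𝒞} (hS : S.ShortExact) (Y : 𝒞) (n : ℕ)
    {a b : Prop} (h1 : IsLineIf (Abelian.Ext S.X₁ Y n) a)
    (h2 : IsLineIf (Abelian.Ext S.X₂ Y (n + 1)) b)
    (ha : a → Subsingleton (Abelian.Ext S.X₂ Y n))
    (hb : b → Subsingleton (Abelian.Ext S.X₁ Y (n + 1))) (hab : ¬ (a ∧ b)) :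
    IsLineIf (Abelian.Ext S.X₃ Y (n + 1)) (a ∨ b) := by
  have hinj : ¬ a → Function.Injective ((Abelian.Ext.mk₀ S.g).precompOfLinear ℂ Y
      (zero_add (n + 1))) := by
    intro ha'
    have := h1.2 ha'
    rw [injective_iff_map_eq_zero]
    intro x hx
    obtain ⟨y, rfl⟩ := Abelian.Ext.contravariant_sequence_exact₃ hS Y x hx (add_comm 1 n)
    rw [Subsingleton.elim y 0, Abelian.Ext.comp_zero]
  refine ⟨fun h => ?_, fun h => ?_⟩
  · rcases h with h | h
    · have := ha h
      have hb' : ¬ b := fun h' => hab ⟨h, h'⟩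
      have := extShift hS Y n (fun x => by rw [Subsingleton.elim x 0, Abelian.Ext.comp_zero])
        (h2.2 hb')
      exact (h1.1 h).map fun e => this.symm.trans e
    · have := hb h
      have ha' : ¬ a := fun h' => hab ⟨h', h⟩
      refine (h2.1 h).map fun e => LinearEquiv.trans (LinearEquiv.ofBijective
        ((Abelian.Ext.mk₀ S.g).precompOfLinear ℂ Y (zero_add (n + 1))) ⟨hinj ha', fun x => ?_⟩) e
      exact Abelian.Ext.contravariant_sequence_exact₂ hS Y x (Subsingleton.elim _ _)
  · rw [not_or] at h
    have := h2.2 h.2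
    exact (hinj h.1).subsingleton

/-- Extension groups between objects `X t r`, computed from a system of projective objects `P` and
intermediate objects `W`, where `t` runs through a set of types with a self-map `φ`. -/
theorem isLineIf_ext_of_system {T : Type*} (φ : T → T) (X W P : T → ℕ → 𝒞) (Y : 𝒞)
    (hX0 : ∀ t, IsZero (X t 0)) [∀ t r, Projective (P t r)]
    (hP : ∀ t r, ∃ (f : W (φ t) (r + 1) ⟶ P t r) (g : P t r ⟶ W t r) (w : f ≫ g = 0),
      (ShortComplex.mk f g w).ShortExact)
    (hW : ∀ t r, ∃ (f : X (φ t) r ⟶ W t r) (g : W t r ⟶ X t (r + 1)) (w : f ≫ g = 0),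
      (ShortComplex.mk f g w).ShortExact)
    (c : T → Prop) (r' : ℕ) (hc : ∀ t, c t → ¬ c (φ t))
    (homX : ∀ t r, IsLineIf (X t (r + 1) ⟶ Y) (c t ∧ r' = r + 1))
    (homW : ∀ t r, IsLineIf (W t r ⟶ Y) (c t ∧ r' = r + 1))
    (homP : ∀ t r, r' ≠ r + 1 → Subsingleton (P t r ⟶ Y)) (n : ℕ) (t : T) (r : ℕ) :
    IsLineIf (Abelian.Ext (X t r) Y n) (c (φ^[n] t) ∧ ∃ x, x < r ∧ x ≤ n ∧ r' + 2 * x = r + n) := by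
  -- Dimension shifting along `P`: each step flips the type and raises r by one, until degree 0 is
  -- reached.
  have hWn : ∀ n t r, IsLineIf (Abelian.Ext (W t r) Y n) (c (φ^[n] t) ∧ r' = r + 1 + n) := by
    intro n
    induction n with
    | zero =>
      exact fun t r => (homW t r).congr (Abelian.Ext.linearEquiv₀ (R := ℂ)).symm (by simp)
    | succ n ih =>
      intro t r
      obtain ⟨f, g, w, hS⟩ := hP t r
      have h1 : Subsingleton (Abelian.Ext (P t r) Y (n + 1)) :=
        Abelian.Ext.subsingleton_of_projective _ _ _
      by_cases h : ∀ x : Abelian.Ext (P t r) Y n, (Abelian.Ext.mk₀ f).comp x (zero_add n) = 0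
      · refine (ih (φ t) (r + 1)).congr (extShift hS Y n h h1) ?_
        rw [Function.iterate_succ_apply]
        exact and_congr_right fun _ => by omega
      -- The shift could fail only in degree 0, through maps P → Y. If such maps exist then r' = r +
      -- 1, and in that case W (φ t) (r + 1) has no maps to Y at all.
      · push Not at h
        obtain ⟨x, hx⟩ := h
        rcases n with _ | n
        · have h2 := homP t r
          have h3 := (ih (φ t) (r + 1)).2
          by_cases hr : r' = r + 1
          · have := h3 (by omega)
            exact absurd (Subsingleton.elim _ _) hx
          · have := h2 hr
            have : Subsingleton (Abelian.Ext (P t r) Y 0) :=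
              (Abelian.Ext.linearEquiv₀ (R := ℂ)).toEquiv.subsingleton
            rw [Subsingleton.elim x 0, Abelian.Ext.comp_zero] at hx
            exact absurd rfl hx
        · have : Subsingleton (Abelian.Ext (P t r) Y (n + 1)) :=
            Abelian.Ext.subsingleton_of_projective _ _ _
          rw [Subsingleton.elim x 0, Abelian.Ext.comp_zero] at hx
          exact absurd rfl hx
  have hcn : ∀ n t, c (φ^[n] t) → ¬ c (φ^[n + 1] t) := fun n t h => by
    rw [Function.iterate_succ_apply']; exact hc _ h
  induction r generalizing n t with
  | zero =>
    refine ⟨by rintro ⟨_, x, hx, _⟩; omega, fun _ => ⟨fun x y => ?_⟩⟩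
    rw [← Abelian.Ext.mk₀_id_comp x, ← Abelian.Ext.mk₀_id_comp y, (hX0 t).eq_of_src (𝟙 _) 0,
      Abelian.Ext.mk₀_zero, Abelian.Ext.zero_comp, Abelian.Ext.zero_comp]
  | succ r ih =>
    rcases n with _ | n
    · refine (homX t r).congr (Abelian.Ext.linearEquiv₀ (R := ℂ)).symm (and_congr_right fun _ => ?_)
      exact ⟨fun h => ⟨0, by omega⟩, fun ⟨x, h1, h2, h3⟩ => by omega⟩
    · obtain ⟨f, g, w, hS⟩ := hW t r
      -- The groups that must vanish have a type of the wrong parity. The two possible contributions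
      -- require r' ≤ r + n and r' = r + n + 2, so they exclude each other.
      refine (isLineIf_ext_of_shortExact hS Y n (ih n (φ t)) (hWn (n + 1) t r) ?_ ?_ ?_).congr
        (LinearEquiv.refl ℂ _) ?_
      · rintro ⟨h, -⟩
        exact (hWn n t r).2 fun h' => hcn n t h'.1 h
      · rintro ⟨h, -⟩
        exact (ih (n + 1) (φ t)).2 fun h' => hcn (n + 1) t h h'.1
      · rintro ⟨⟨-, x, -, -, h⟩, -, h'⟩
        omega
      · rw [← Function.iterate_succ_apply, ← and_or_left]
        -- The submodule X (φ t) r supplies the solutions with x ≥ 1, and W t r the solution x = 0.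
        refine and_congr_right fun _ => ⟨?_, ?_⟩
        · rintro (⟨x, h1, h2, h3⟩ | h)
          · exact ⟨x + 1, by omega⟩
          · exact ⟨0, by omega⟩
        · rintro ⟨x, h1, h2, h3⟩
          rcases x with _ | x
          · exact Or.inr (by omega)
          · exact Or.inl ⟨x, by omega⟩

end ExtLine

/-! ### Translation between families of operators and objects of the category of finite-dimensional
modules. -/

section Modules

open scoped ModuleCat

variable {p : ℕ}

/-- The generators of `LU p`. -/
def gen (p : ℕ) (g : Gen) : LU p := RingQuot.mkAlgHom ℂ _ (FreeAlgebra.ι ℂ g)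

/-- The relations hold in the image of every homomorphism from `LU p`. -/
lemma eq_of_rel {S : Type} [Ring S] [Algebra ℂ S] (φ : LU p →ₐ[ℂ] S) {x y : S}
    (h : Rel p (φ ∘ gen p) x y) : x = y := by
  have key : ∀ {x y : FreeAlgebra ℂ Gen}, Rel p (FreeAlgebra.ι ℂ) x y →
      (φ.comp (RingQuot.mkAlgHom ℂ _)) x = (φ.comp (RingQuot.mkAlgHom ℂ _)) y :=
    fun h => congrArg φ (RingQuot.mkAlgHom_rel ℂ h)
  have hg : φ ∘ gen p = (φ.comp (RingQuot.mkAlgHom ℂ (Rel p (FreeAlgebra.ι ℂ)))) ∘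
    FreeAlgebra.ι ℂ := rfl
  rw [hg] at h
  generalize φ.comp (RingQuot.mkAlgHom ℂ _) = ψ at h key
  -- The relations of the free algebra are pushed forward along ψ, one constructor at a time.
  cases h
  · simpa [map_elemT, map_elemA] using key .K_mul_Kinv
  · simpa [map_elemT, map_elemA] using key .Kinv_mul_K
  · simpa [map_elemT, map_elemA] using key .KE
  · simpa [map_elemT, map_elemA] using key .KF
  · simpa [map_elemT, map_elemA] using key .EF
  · simpa [map_elemT, map_elemA] using key .E_pow
  · simpa [map_elemT, map_elemA] using key .F_pow
  · simpa [map_elemT, map_elemA] using key .K_pow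
  · simpa [map_elemT, map_elemA] using key .he
  · simpa [map_elemT, map_elemA] using key .hf
  · simpa [map_elemT, map_elemA] using key .ef
  · simpa [map_elemT, map_elemA] using key .hK
  · simpa [map_elemT, map_elemA] using key .Ee
  · simpa [map_elemT, map_elemA] using key .Ke
  · simpa [map_elemT, map_elemA] using key .Ff
  · simpa [map_elemT, map_elemA] using key .Kf
  · simpa [map_elemT, map_elemA] using key .Fe
  · simpa [map_elemT, map_elemA] using key .Ef
  · simpa [map_elemT, map_elemA] using key .hE
  · simpa [map_elemT, map_elemA] using key .hF

/-- Induction on the elements of `LU p`. -/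
lemma LU.induction {C : LU p → Prop} (hc : ∀ c : ℂ, C (algebraMap ℂ _ c)) (hg : ∀ g, C (gen p g))
    (hmul : ∀ a b, C a → C b → C (a * b)) (hadd : ∀ a b, C a → C b → C (a + b)) (a : LU p) :
    C a := by
  obtain ⟨a, rfl⟩ := RingQuot.mkAlgHom_surjective ℂ _ a
  induction a with
  | grade0 r => rw [AlgHom.commutes]; exact hc r
  | grade1 x => exact hg x
  | mul a b ha hb => rw [map_mul]; exact hmul _ _ ha hb
  | add a b ha hb => rw [map_add]; exact hadd _ _ ha hb

section Rep

variable {V V' V'' : Type} [AddCommGroup V] [Module ℂ V] [AddCommGroup V'] [Module ℂ V']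
  [AddCommGroup V''] [Module ℂ V'']

/-- A family of operators satisfies the defining relations of `LU p`. -/
def IsRep (p : ℕ) (a : Gen → Module.End ℂ V) : Prop := ∀ ⦃x y⦄, Rel p a x y → x = y

/-- The representation given by operators that satisfy the relations. -/
def repOf {a : Gen → Module.End ℂ V} (h : IsRep p a) : LU p →ₐ[ℂ] Module.End ℂ V :=
  RingQuot.liftAlgHom ℂ ⟨FreeAlgebra.lift ℂ a, fun _ _ h' => by
    have := h'.map (FreeAlgebra.lift ℂ a)
    rw [FreeAlgebra.ι_comp_lift] at this
    exact h this⟩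

lemma repOf_gen {a : Gen → Module.End ℂ V} (h : IsRep p a) (g : Gen) :
    repOf h (gen p g) = a g := by
  rw [repOf, gen, RingQuot.liftAlgHom_mkAlgHom_apply, FreeAlgebra.lift_ι_apply]

lemma repOf_comm {a : Gen → Module.End ℂ V} (h : IsRep p a) {a' : Gen → Module.End ℂ V'}
    (h' : IsRep p a') {φ : V →ₗ[ℂ] V'} (hφ : ∀ g v, φ (a g v) = a' g (φ v)) (x : LU p) :
    ∀ v, φ (repOf h x v) = repOf h' x (φ v) := by
  induction x using LU.induction with
  | hc c => simp [AlgHom.commutes]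
  | hg g => simpa [repOf_gen] using hφ g
  | hmul x y hx hy => simp [hx, hy]
  | hadd x y hx hy => simp [hx, hy]

variable [Module.Finite ℂ V] [Module.Finite ℂ V'] [Module.Finite ℂ V'']

/-- The finite-dimensional `LU p`-module given by operators that satisfy the relations. -/
def modOf {a : Gen → Module.End ℂ V} (h : IsRep p a) : FDMod p :=
  letI : Module (LU p) V := Module.compHom _ (repOf h).toRingHom
  ⟨ModuleCat.of (LU p) V, by
    have h' : Module.restrictScalars ℂ (LU p) V = (inferInstance : Module ℂ V) :=
      Module.ext' _ _ fun c x => by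
        change repOf h (algebraMap ℂ (LU p) c) x = c • x
        rw [AlgHom.commutes, Module.algebraMap_end_apply]
    change @Module.Finite ℂ V _ _ (Module.restrictScalars ℂ (LU p) _)
    rw [h']
    infer_instance⟩

lemma isRep_act (hp : 2 ≤ p) (α : ℤˣ) {s : ℕ} (r : ℕ) (hs : s ≤ p) : IsRep p (act p α s r) :=
  fun _ _ h => act_rel hp hs h

/-- Makes the modules of the theorem accessible to the results on `modOf`. -/
lemma simpleMod_eq (hp : 2 ≤ p) (α : ℤˣ) (s r : ℕ) (hs : s ≤ p) :
    simpleMod p hp α s r hs = modOf (isRep_act hp α r hs) := rfl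

/-- The module homomorphism given by a linear map that commutes with the generators. -/
def homOf {a : Gen → Module.End ℂ V} (h : IsRep p a) {a' : Gen → Module.End ℂ V'}
    (h' : IsRep p a') (φ : V →ₗ[ℂ] V') (hφ : ∀ g v, φ (a g v) = a' g (φ v)) :
    modOf h ⟶ modOf h' :=
  letI : Module (LU p) V := Module.compHom _ (repOf h).toRingHom
  letI : Module (LU p) V' := Module.compHom _ (repOf h').toRingHom
  ObjectProperty.homMk (ModuleCat.ofHom (X := V) (Y := V')
    { toFun := φ, map_add' := map_add φ, map_smul' := repOf_comm h h' hφ })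

/-- The linear map underlying a homomorphism. -/
def linOf {a : Gen → Module.End ℂ V} {h : IsRep p a} {a' : Gen → Module.End ℂ V'}
    {h' : IsRep p a'} : (modOf h ⟶ modOf h') →ₗ[ℂ] (V →ₗ[ℂ] V') where
  toFun φ :=
    { toFun := fun v => φ.hom.hom v
      map_add' := map_add φ.hom.hom
      map_smul' := fun c v => by
        have e1 : repOf h (algebraMap ℂ (LU p) c) v = c • v := by
          rw [AlgHom.commutes, Module.algebraMap_end_apply]
        have e2 := fun v => congrArg (fun f => f v) ((repOf h').commutes c)
        have := φ.hom.hom.map_smul (algebraMap ℂ (LU p) c) v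
        rw [← e1]
        exact this.trans (e2 _) }
  map_add' _ _ := rfl
  map_smul' c φ := by
    ext v
    exact congrArg (fun f => f (φ.hom.hom v)) ((repOf h').commutes c)

lemma linOf_injective {a : Gen → Module.End ℂ V} {h : IsRep p a} {a' : Gen → Module.End ℂ V'}
    {h' : IsRep p a'} : Function.Injective (linOf (h := h) (h' := h')) := by
  intro f g hfg
  refine ObjectProperty.hom_ext _ (ModuleCat.hom_ext (LinearMap.ext fun v => ?_))
  exact congrArg (fun f => f v) hfg

lemma linOf_comm {a : Gen → Module.End ℂ V} {h : IsRep p a} {a' : Gen → Module.End ℂ V'}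
    {h' : IsRep p a'} (φ : modOf h ⟶ modOf h') (g : Gen) (v : V) :
    linOf φ (a g v) = a' g (linOf φ v) := by
  rw [← repOf_gen h g, ← repOf_gen h' g]
  exact φ.hom.hom.map_smul (gen p g) v

/-- The inclusion into all modules is faithful and preserves homology, so exactness is tested on the
underlying maps. -/
lemma shortExact_of {a : Gen → Module.End ℂ V} {h : IsRep p a} {a' : Gen → Module.End ℂ V'}
    {h' : IsRep p a'} {a'' : Gen → Module.End ℂ V''} {h'' : IsRep p a''}
    (φ : V →ₗ[ℂ] V') (hφ : ∀ g v, φ (a g v) = a' g (φ v))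
    (ψ : V' →ₗ[ℂ] V'') (hψ : ∀ g v, ψ (a' g v) = a'' g (ψ v))
    (h1 : Function.Injective φ) (h2 : Function.Exact φ ψ) (h3 : Function.Surjective ψ) :
    ∃ (f : modOf h ⟶ modOf h') (g : modOf h' ⟶ modOf h'') (w : f ≫ g = 0),
      (ShortComplex.mk f g w).ShortExact := by
  have w : homOf h h' φ hφ ≫ homOf h' h'' ψ hψ = 0 :=
    linOf_injective (LinearMap.ext fun v => h2.apply_apply_eq_zero v)
  refine ⟨homOf h h' φ hφ, homOf h' h'' ψ hψ, w, ?_⟩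
  have : (isFinDim p).ι.PreservesHomology :=
    { preservesKernels := fun _ _ f => (isFinDim p).preservesKernels_ι f
      preservesCokernels := fun _ _ f => (isFinDim p).preservesCokernels_ι f }
  have m : Mono (homOf h h' φ hφ) := by
    refine (isFinDim p).ι.mono_of_mono_map ?_
    exact (ModuleCat.mono_iff_injective _).2 h1
  have e : Epi (homOf h' h'' ψ hψ) := by
    refine (isFinDim p).ι.epi_of_epi_map ?_
    exact (ModuleCat.epi_iff_surjective _).2 h3
  refine { exact := ?_, mono_f := m, epi_g := e }
  rw [← ShortComplex.exact_map_iff_of_faithful _ (isFinDim p).ι]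
  exact (ShortComplex.ShortExact.moduleCat_exact_iff_function_exact _).2 h2

end Rep

/-- The operators by which the generators act on a module. -/
def actOf (M : FDMod p) (g : Gen) : Module.End ℂ M.obj :=
  Algebra.lsmul ℂ ℂ M.obj (gen p g)

lemma isRep_actOf (M : FDMod p) : IsRep p (actOf M) :=
  fun _ _ h => eq_of_rel (Algebra.lsmul ℂ ℂ M.obj) h

lemma repOf_actOf (M : FDMod p) (x : LU p) (v : M.obj) : repOf (isRep_actOf M) x v = x • v := by
  induction x using LU.induction generalizing v with
  | hc c => rw [AlgHom.commutes, Module.algebraMap_end_apply]; rfl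
  | hg g => rw [repOf_gen]; rfl
  | hmul x y hx hy => rw [map_mul, Module.End.mul_apply, hy, hx, mul_smul]
  | hadd x y hx hy => rw [map_add, LinearMap.add_apply, hy, hx, add_smul]

/-- A module is projective if homomorphisms lift in terms of operators. -/
lemma projective_modOf {V : Type} [AddCommGroup V] [Module ℂ V] [Module.Finite ℂ V]
    {a : Gen → Module.End ℂ V} (h : IsRep p a)
    (H : ∀ (M N : FDMod p) (ψ : M.obj →ₗ[ℂ] N.obj) (φ : V →ₗ[ℂ] N.obj),
      Function.Surjective ψ → (∀ g v, ψ (actOf M g v) = actOf N g (ψ v)) →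
      (∀ g v, φ (a g v) = actOf N g (φ v)) →
      ∃ χ : V →ₗ[ℂ] M.obj, (∀ g v, χ (a g v) = actOf M g (χ v)) ∧ ∀ v, ψ (χ v) = φ v) :
    Projective (modOf h) where
  factors {M N} f e he := by
    have he' : Function.Surjective e.hom.hom := by
      have := (isFinDim p).preservesEpimorphisms_ι_of_isNormalMonoCategory
      exact (ModuleCat.epi_iff_surjective _).1 ((isFinDim p).ι.map_epi e)
    obtain ⟨χ, hχ, hχ'⟩ := H M N (e.hom.hom.restrictScalars ℂ)
      { toFun := fun v => f.hom.hom v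
        map_add' := map_add f.hom.hom
        map_smul' := fun c v => by
          have e1 : repOf h (algebraMap ℂ (LU p) c) v = c • v := by
            rw [AlgHom.commutes, Module.algebraMap_end_apply]
          have := f.hom.hom.map_smul (algebraMap ℂ (LU p) c) v
          rw [← e1]
          exact this } he' (fun g v => e.hom.hom.map_smul (gen p g) v) (fun g v => by
        rw [← repOf_gen h g]
        exact f.hom.hom.map_smul (gen p g) v)
    let : Module (LU p) V := Module.compHom _ (repOf h).toRingHom
    refine ⟨ObjectProperty.homMk (ModuleCat.ofHom (X := V) (Y := M.obj)
      { toFun := χ, map_add' := map_add χ, map_smul' := fun x v => ?_ }), ?_⟩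
    · exact (repOf_comm h (isRep_actOf M) hχ x v).trans (repOf_actOf M x _)
    · exact ObjectProperty.hom_ext _ (ModuleCat.hom_ext (LinearMap.ext hχ'))

end Modules

/-! ### Arithmetic of q-numbers and of the structure constants on the cycle of weights. -/

section Numbers

variable {p : ℕ}

lemma q_isPrimitiveRoot (hp : 2 ≤ p) : IsPrimitiveRoot (q p) (2 * p) := by
  have h := Complex.isPrimitiveRoot_exp (2 * p) (by omega)
  have h0 : (p : ℂ) ≠ 0 := by exact_mod_cast (by omega : p ≠ 0)
  have : q p = Complex.exp (2 * Real.pi * Complex.I / (2 * p : ℕ)) := by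
    rw [q]; congr 1; push_cast; field_simp
  rwa [this]

lemma q_zpow_eq_one_iff (hp : 2 ≤ p) (k : ℤ) : q p ^ k = 1 ↔ (2 * p : ℤ) ∣ k := by
  rw [(q_isPrimitiveRoot hp).zpow_eq_one_iff_dvd]; push_cast; rfl

lemma q_zpow_inj_iff (hp : 2 ≤ p) (k l : ℤ) : q p ^ k = q p ^ l ↔ (2 * p : ℤ) ∣ k - l := by
  rw [← q_zpow_eq_one_iff hp, zpow_sub₀ q_ne_zero, div_eq_one_iff_eq (zpow_ne_zero _ q_ne_zero)]

lemma qNum_neg (n : ℤ) : qNum p (-n) = -qNum p n := by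
  simp only [qNum, neg_neg]; ring

lemma qNum_add_p (hp : 2 ≤ p) (n : ℤ) : qNum p (n + p) = -qNum p n := by
  simp only [qNum, neg_add, zpow_add₀ (q_ne_zero (p := p)), q_zpow_p hp, q_zpow_neg_p hp]; ring

lemma qNum_sub_p (hp : 2 ≤ p) (n : ℤ) : qNum p (n - p) = -qNum p n := by
  rw [← neg_eq_iff_eq_neg, ← qNum_add_p hp, sub_add_cancel]

lemma qNum_ne_zero (hp : 2 ≤ p) {n : ℤ} (h : ¬ (p : ℤ) ∣ n) : qNum p n ≠ 0 := by
  refine div_ne_zero (fun h' => h ?_) (q_sub_ne_zero hp)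
  have := (q_zpow_inj_iff hp n (-n)).1 (sub_eq_zero.1 h')
  have e : n - -n = 2 * n := by ring
  rw [e] at this
  exact Int.dvd_of_mul_dvd_mul_left (by norm_num) this

lemma qNum_natCast_ne_zero (hp : 2 ≤ p) {n : ℕ} (h0 : 0 < n) (h : n < p) :
    qNum p (n : ℤ) ≠ 0 :=
  qNum_ne_zero hp fun h' => by
    have := Nat.le_of_dvd h0 (Int.natCast_dvd_natCast.1 h')
    omega

lemma qFact_ne_zero (hp : 2 ≤ p) : qFact p (p - 1) ≠ 0 :=
  Finset.prod_ne_zero_iff.2 fun j hj => by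
    rw [Finset.mem_Icc] at hj
    exact qNum_natCast_ne_zero hp (by omega) (by omega)

lemma sgn_ne_zero (α : ℤˣ) : sgn α ≠ 0 := by
  rcases Int.units_eq_one_or α with rfl | rfl <;> simp [sgn]

lemma sgn_neg (α : ℤˣ) : sgn (-α) = -sgn α := by simp [sgn]

/-- The eigenvalue of `K` on the `n`-th weight space. -/
def kap (p : ℕ) (α : ℤˣ) (s : ℕ) (n : ZMod p) : ℂ := sgn α * q p ^ ((s : ℤ) - 1 - 2 * n.val)

/-- The coefficient `α [n] [s - n]`. -/
def co (p : ℕ) (α : ℤˣ) (s : ℕ) (n : ZMod p) : ℂ :=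
  sgn α * qNum p n.val * qNum p ((s : ℤ) - n.val)

/-- The eigenvalue of the Casimir element. -/
def cas (p : ℕ) (α : ℤˣ) (s : ℕ) : ℂ := sgn α * (q p ^ (s : ℤ) + q p ^ (-(s : ℤ)))

/-- The normalization `(-1)^{p+1} α [s] / [p-1]!`. -/
def dlt (p : ℕ) (α : ℤˣ) (s : ℕ) : ℂ := (-1) ^ (p + 1) * sgn α * qNum p s / qFact p (p - 1)

variable (α : ℤˣ) (s : ℕ)

/-- The formula has period p in k because q has order 2p; representatives in `ZMod p` need never be
reduced. -/
lemma kap_natCast (hp : 2 ≤ p) (k : ℕ) :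
    kap p α s (k : ZMod p) = sgn α * q p ^ ((s : ℤ) - 1 - 2 * k) := by
  rw [kap]
  congr 1
  rw [q_zpow_inj_iff hp, ZMod.val_natCast]
  exact ⟨(k / p : ℕ), by have := Nat.mod_add_div k p; zify at this ⊢; linarith⟩

/-- Both q-numbers change sign when k is shifted by p. -/
lemma co_natCast (hp : 2 ≤ p) (k : ℕ) :
    co p α s (k : ZMod p) = sgn α * qNum p k * qNum p ((s : ℤ) - k) := by
  induction k using Nat.strong_induction_on with
  | _ k ih =>
    by_cases hk : k < p
    · rw [co, ZMod.val_natCast, Nat.mod_eq_of_lt hk]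
    · obtain ⟨j, rfl⟩ := Nat.exists_eq_add_of_le' (not_lt.1 hk)
      have e1 : ((j + p : ℕ) : ZMod p) = (j : ZMod p) := by simp
      rw [e1, ih j (by omega)]
      push_cast
      rw [qNum_add_p hp, ← sub_sub, qNum_sub_p hp]
      ring

lemma exists_natCast [NeZero p] (n : ZMod p) : ∃ k < p, n = (k : ℕ) :=
  ⟨n.val, n.val_lt, (ZMod.natCast_zmod_val n).symm⟩

lemma kap_succ [NeZero p] (hp : 2 ≤ p) (n : ZMod p) : kap p α s n = q p ^ 2 * kap p α s (n + 1) :=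
    by
  obtain ⟨k, -, rfl⟩ := exists_natCast n
  rw [← Nat.cast_succ, kap_natCast α s hp, kap_natCast α s hp, ← zpow_natCast, mul_left_comm,
    ← zpow_add₀ q_ne_zero]
  congr 2; push_cast; ring

lemma kap_ne_zero (n : ZMod p) : kap p α s n ≠ 0 :=
  mul_ne_zero (sgn_ne_zero α) (zpow_ne_zero _ q_ne_zero)

lemma kap_inv (hp : 2 ≤ p) (k : ℕ) :
    (kap p α s (k : ZMod p))⁻¹ = sgn α * q p ^ (-((s : ℤ) - 1 - 2 * k)) := by
  rw [kap_natCast α s hp, mul_inv, zpow_neg, inv_eq_of_mul_eq_one_left sgn_mul_self]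

/-- The coefficient depends only on the K-weight and the Casimir eigenvalue; comparisons between
different types therefore reduce to `kap` and `cas`. -/
lemma co_eq [NeZero p] (hp : 2 ≤ p) (n : ZMod p) : (q p - (q p)⁻¹) ^ 2 * co p α s n =
    cas p α s - q p * kap p α s n - (q p)⁻¹ * (kap p α s n)⁻¹ := by
  obtain ⟨k, -, rfl⟩ := exists_natCast n
  rw [co_natCast α s hp, kap_inv α s hp, kap_natCast α s hp, cas]
  have h0 : q p ≠ 0 := q_ne_zero
  have h := qNum_mul_qNum_sub hp s k
  have h2 : q p * q p ^ ((s : ℤ) - 1 - 2 * k) = q p ^ ((s : ℤ) - 2 * k) := by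
    nth_rewrite 1 [← zpow_one (q p)]
    rw [← zpow_add₀ h0]; congr 1; ring
  have h3 : (q p)⁻¹ * q p ^ (-((s : ℤ) - 1 - 2 * k)) = q p ^ (-((s : ℤ) - 2 * k)) := by
    rw [← zpow_neg_one, ← zpow_add₀ h0]; congr 1; ring
  linear_combination sgn α * h + sgn α * h2 + sgn α * h3

lemma co_succ_sub [NeZero p] (hp : 2 ≤ p) (n : ZMod p) : co p α s (n + 1) - co p α s n =
    1 / (q p - (q p)⁻¹) * (kap p α s n - (kap p α s n)⁻¹) := by
  have h := q_sub_ne_zero hp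
  have h0 : q p ≠ 0 := q_ne_zero
  have h1 := co_eq α s hp n
  have h2 := co_eq α s hp (n + 1)
  have h3 := kap_succ α s hp n
  have h4 := kap_ne_zero α s (n + 1)
  have h5 : (kap p α s (n + 1)) = (q p)⁻¹ ^ 2 * kap p α s n := by rw [h3]; field_simp
  rw [h5] at h2
  apply mul_left_cancel₀ (pow_ne_zero 2 h)
  have h6 := kap_ne_zero α s n
  have h7 : (q p - (q p)⁻¹) ^ 2 * (1 / (q p - (q p)⁻¹) * (kap p α s n - (kap p α s n)⁻¹)) =
      (q p - (q p)⁻¹) * (kap p α s n - (kap p α s n)⁻¹) := by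
    generalize q p - (q p)⁻¹ = d at h
    field_simp
  rw [mul_sub, h1, h2, h7]
  field_simp
  ring

lemma cas_eq [NeZero p] (hp : 2 ≤ p) (n : ZMod p) :
    (q p - (q p)⁻¹) ^ 2 * co p α s (n + 1) + (q p)⁻¹ * kap p α s n + q p * (kap p α s n)⁻¹ =
      cas p α s := by
  have h0 : q p ≠ 0 := q_ne_zero
  have h6 := kap_ne_zero α s (n + 1)
  rw [co_eq α s hp, kap_succ α s hp n]
  field_simp
  ring

lemma co_zero : co p α s 0 = 0 := by simp [co, qNum_zero]

lemma co_self (hp : 2 ≤ p) : co p α s (s : ZMod p) = 0 := by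
  simp [co_natCast α s hp, qNum_zero]

lemma co_natCast_ne_zero (hp : 2 ≤ p) (hs : s < p) {k : ℕ} (h0 : 0 < k) (hk : k < p)
    (hks : k ≠ s) : co p α s (k : ZMod p) ≠ 0 := by
  rw [co_natCast α s hp]
  refine mul_ne_zero (mul_ne_zero (sgn_ne_zero α) (qNum_natCast_ne_zero hp h0 hk))
    (qNum_ne_zero hp fun ⟨c, hc⟩ => ?_)
  have h1 : (p : ℤ) * c < p * 1 := by omega
  have h2 : (p : ℤ) * (-1) < p * c := by omega
  have hp' : (0 : ℤ) < p := by omega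
  have := lt_of_mul_lt_mul_left h1 hp'.le
  have := lt_of_mul_lt_mul_left h2 hp'.le
  have : c = 0 := by omega
  subst this
  omega

/-- The product of the nonzero coefficients. -/
lemma prod_co (hp : 2 ≤ p) (hs1 : 1 ≤ s) (hs : s < p) :
    qNum p s ^ 2 * ∏ k ∈ (Finset.Icc 1 (p - 1)).erase s, co p α s (k : ZMod p) =
      sgn α ^ p * (-1) ^ (p - 1 - s) * qFact p (p - 1) ^ 2 := by
  have hmem : s ∈ Finset.Icc 1 (p - 1) := Finset.mem_Icc.2 ⟨hs1, by omega⟩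
  have hU : (Finset.Icc 1 (p - 1)).erase s = Finset.Ico 1 s ∪ Finset.Ico (s + 1) p := by
    ext k; simp; omega
  have hD : Disjoint (Finset.Ico 1 s) (Finset.Ico (s + 1) p) := by
    rw [Finset.disjoint_left]; intro k; simp; omega
  -- Below s the product is reversed by k ↦ s − k. Above s one writes [s − k] = −[p + s − k] and
  -- reverses by k ↦ p + s − k.
  have h1 : ∏ k ∈ Finset.Ico 1 s, qNum p ((s : ℤ) - k) = ∏ k ∈ Finset.Ico 1 s, qNum p k := by
    refine Finset.prod_nbij' (fun k => s - k) (fun k => s - k) ?_ ?_ ?_ ?_ ?_ <;>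
      intro k hk <;> simp only [Finset.mem_Ico] at hk ⊢
    · omega
    · omega
    · omega
    · omega
    · congr 1; omega
  have h2 : ∏ k ∈ Finset.Ico (s + 1) p, qNum p ((s : ℤ) - k) =
      (-1) ^ (p - 1 - s) * ∏ k ∈ Finset.Ico (s + 1) p, qNum p k := by
    have : (-1 : ℂ) ^ (p - 1 - s) = ∏ k ∈ Finset.Ico (s + 1) p, (-1) := by
      rw [Finset.prod_const, Nat.card_Ico]; congr 1; omega
    rw [this, ← Finset.prod_mul_distrib]
    have e : ∀ k ∈ Finset.Ico (s + 1) p, qNum p ((s : ℤ) - k) =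
        -1 * qNum p ((p + s - k : ℕ) : ℤ) := by
      intro k hk
      rw [Finset.mem_Ico] at hk
      have : ((p + s - k : ℕ) : ℤ) = (s - k : ℤ) + p := by omega
      rw [this, qNum_add_p hp]; ring
    rw [Finset.prod_congr rfl e, Finset.prod_mul_distrib, Finset.prod_mul_distrib]
    congr 1
    refine Finset.prod_nbij' (fun k => p + s - k) (fun k => p + s - k) ?_ ?_ ?_ ?_ ?_ <;>
      intro k hk <;> simp only [Finset.mem_Ico] at hk ⊢ <;> omega
  have h3 : ∏ k ∈ (Finset.Icc 1 (p - 1)).erase s, qNum p ((s : ℤ) - k) =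
      (-1) ^ (p - 1 - s) * ∏ k ∈ (Finset.Icc 1 (p - 1)).erase s, qNum p k := by
    rw [hU, Finset.prod_union hD, Finset.prod_union hD, h1, h2]; ring
  have h4 : ((Finset.Icc 1 (p - 1)).erase s).card = p - 2 := by
    rw [Finset.card_erase_of_mem hmem, Nat.card_Icc]; omega
  have h5 : sgn α ^ p = sgn α ^ (p - 2) := by
    nth_rewrite 1 [show p = p - 2 + 2 by omega]
    rw [pow_add, pow_two, sgn_mul_self, mul_one]
  have h6 : qFact p (p - 1) = qNum p s * ∏ k ∈ (Finset.Icc 1 (p - 1)).erase s, qNum p k :=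
    (Finset.mul_prod_erase _ _ hmem).symm
  simp only [co_natCast α s hp, Finset.prod_mul_distrib, Finset.prod_const, h3, h4, h5, h6]
  ring

lemma sum_range_zmod [NeZero p] {A : Type*} [AddCommMonoid A] (f : ZMod p → A) :
    ∑ i ∈ Finset.range p, f (i : ZMod p) = ∑ m, f m :=
  Finset.sum_nbij' (fun i => (i : ZMod p)) ZMod.val (by simp) (by simp [ZMod.val_lt])
    (fun i hi => by simpa using ZMod.val_cast_of_lt (Finset.mem_range.1 hi)) (by simp) (by simp)

end Numbers

/-! ### The idempotents and the element `A` on vectors of a given weight. -/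

section ElementA

variable {p : ℕ}

lemma beta_injective (hp : 2 ≤ p) {i j : ℕ} (hi : i ≤ p) (hj : j ≤ p) (h : beta p i = beta p j) :
    i = j := by
  by_contra hij
  have h0 : q p ≠ 0 := q_ne_zero
  -- The factorization of β_i − β_j.
  have key : (q p ^ (i : ℤ) - q p ^ (j : ℤ)) * (1 - q p ^ (-((i : ℤ) + j))) = 0 := by
    have e1 : q p ^ (i : ℤ) * q p ^ (-((i : ℤ) + j)) = q p ^ (-(j : ℤ)) := by
      rw [← zpow_add₀ h0]; congr 1; ring
    have e2 : q p ^ (j : ℤ) * q p ^ (-((i : ℤ) + j)) = q p ^ (-(i : ℤ)) := by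
      rw [← zpow_add₀ h0]; congr 1; ring
    simp only [beta] at h
    linear_combination h - e1 + e2
  have hd : ∀ z : ℤ, (2 * p : ℤ) ∣ z → z ≠ 0 → |z| < 2 * p → False := fun z hz h0 hlt =>
    absurd (Int.le_of_dvd (abs_pos.2 h0) ((dvd_abs _ _).2 hz)) (by omega)
  rcases mul_eq_zero.1 key with h | h
  · refine hd _ ((q_zpow_inj_iff hp _ _).1 (sub_eq_zero.1 h)) (by omega) ?_
    rw [abs_lt]; omega
  · refine hd _ ((q_zpow_eq_one_iff hp _).1 (sub_eq_zero.1 h).symm) (by omega) ?_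
    rw [abs_lt]; omega

lemma psi_eval_ne_zero (hp : 2 ≤ p) {t : ℕ} (h1 : 1 ≤ t) (ht : t < p) :
    (psi p t).eval (beta p t) ≠ 0 := by
  simp only [psi, eval_mul, eval_prod, eval_pow, eval_sub, eval_X, eval_C]
  refine mul_ne_zero (mul_ne_zero ?_ ?_) (Finset.prod_ne_zero_iff.2 fun j hj => pow_ne_zero _ ?_)
  · exact sub_ne_zero.2 fun h => by have := beta_injective hp ht.le (Nat.zero_le _) h; omega
  · exact sub_ne_zero.2 fun h => by have := beta_injective hp ht.le le_rfl h; omega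
  · simp only [Finset.mem_erase, Finset.mem_Icc] at hj
    exact sub_ne_zero.2 fun h => hj.1 (beta_injective hp ht.le (by omega) h).symm

/-- The polynomial is a Hermite interpolation: value 1 with zero derivative at its own node. The
double zeros at the other interior nodes are treated in `derivative_idemPoly_eval_beta`. Vanishing
derivatives are what is needed when the Casimir is a scalar plus an operator of square zero. -/
lemma derivative_idemPoly_eval_self (hp : 2 ≤ p) {t : ℕ} (h1 : 1 ≤ t) (ht : t < p) :
    (derivative (idemPoly p t)).eval (beta p t) = 0 ∧ (idemPoly p t).eval (beta p t) = 1 := by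
  have := psi_eval_ne_zero hp h1 ht
  constructor
  · simp only [idemPoly, derivative_mul, derivative_C, derivative_sub, derivative_X, eval_add,
      eval_mul, eval_sub, eval_C, eval_X]
    simp only [eval_zero, eval_one]
    field_simp
    ring
  · simp only [idemPoly, eval_mul, eval_sub, eval_C, eval_X]
    field_simp
    ring

lemma derivative_idemPoly_eval_beta {t j : ℕ} (h1 : 1 ≤ j) (hj : j < p) (h : j ≠ t) :
    (derivative (idemPoly p t)).eval (beta p j) = 0 := by
  have hm : j ∈ (Finset.Icc 1 (p - 1)).erase t :=
    Finset.mem_erase.2 ⟨h, Finset.mem_Icc.2 ⟨by omega, by omega⟩⟩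
  obtain ⟨Q, hQ⟩ : (X - C (beta p j)) ^ 2 ∣ idemPoly p t := by
    have : (X - C (beta p j)) ^ 2 ∣ psi p t :=
      Dvd.dvd.mul_left (Finset.dvd_prod_of_mem (fun j => (X - C (beta p j)) ^ 2) hm) _
    exact Dvd.dvd.mul_left (dvd_sub this (Dvd.dvd.mul_left this _)) _
  rw [hQ]
  simp [derivative_mul, derivative_pow]

/-- The index of the block that contains the modules of type `(α, s)`. -/
def blk (p : ℕ) (α : ℤˣ) (s : ℕ) : ℕ := if α = 1 then s else p - s

lemma cas_eq_beta (hp : 2 ≤ p) (α : ℤˣ) {s : ℕ} (hs : s ≤ p) :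
    cas p α s = beta p (blk p α s) := by
  have h0 : q p ≠ 0 := q_ne_zero
  rcases Int.units_eq_one_or α with rfl | rfl
  · simp [cas, beta, blk, sgn]
  · have e1 : (((p - s : ℕ) : ℤ)) = p - s := by omega
    have e2 : -((p : ℤ) - s) = -p + s := by ring
    have e3 : blk p (-1) s = p - s := if_neg (by decide)
    rw [e3, cas, beta, e1, e2, zpow_add₀ h0, sub_eq_add_neg, zpow_add₀ h0, q_zpow_p hp,
      q_zpow_neg_p hp]
    simp [sgn]

/-- The Taylor expansion stops after the linear term. -/
lemma aeval_add_of_mul_self {R : Type} [Ring R] [Algebra ℂ R] {c : ℂ} {N : R} (hN : N * N = 0)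
    (P : ℂ[X]) :
    aeval (algebraMap ℂ R c + N) P = algebraMap ℂ R (P.eval c) + (derivative P).eval c • N := by
  induction P using Polynomial.induction_on with
  | C a => simp
  | add P Q hP hQ => simp only [map_add, hP, hQ, eval_add, add_smul]; abel
  | monomial n a ih =>
    have e : (C a * X ^ (n + 1) : ℂ[X]) = C a * X ^ n * X := by ring
    rw [e]
    generalize (C a * X ^ n : ℂ[X]) = Q at ih
    rw [map_mul, ih, aeval_X, derivative_mul, derivative_X, eval_mul, eval_X, eval_add,
      eval_mul, eval_X, mul_one, map_mul]
    rw [add_mul, mul_add, mul_add, smul_mul_assoc, smul_mul_assoc, hN, smul_zero, add_zero,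
      ← Algebra.commutes c N, ← Algebra.smul_def, ← Algebra.smul_def, ← Algebra.smul_def,
      smul_smul, add_smul]
    abel

lemma idem_eq (hp : 2 ≤ p) {α : ℤˣ} {s : ℕ} (hs1 : 1 ≤ s) (hs : s < p) {R : Type} [Ring R]
    [Algebra ℂ R] {g : Gen → R} {N : R} (hN : N * N = 0)
    (hC : casimir p g = algebraMap ℂ R (cas p α s) + N) (t : ℕ) :
    idem p g t = if t = blk p α s then 1 else 0 := by
  have hb : 1 ≤ blk p α s ∧ blk p α s < p := by unfold blk; split_ifs <;> omega
  rw [idem, hC, aeval_add_of_mul_self hN, cas_eq_beta hp α hs.le]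
  split_ifs with h
  · subst h
    obtain ⟨h1, h2⟩ := derivative_idemPoly_eval_self hp hb.1 hb.2
    simp [h1, h2]
  · rw [idemPoly_eval_beta hb.2.le (Ne.symm h), derivative_idemPoly_eval_beta hb.1 hb.2 (Ne.symm h)]
    simp

/-- The scalar by which the summand of `A` acts on a vector of weight `κ`. -/
def coefA (p t : ℕ) (κ : ℂ) : ℂ :=
  (1 / ((q p ^ ((t : ℤ) - 1) - q p ^ (-(t : ℤ) - 1)) *
      (uPoly p t).eval (q p ^ (-(t : ℤ) - 1)) * (uPoly p t).eval (q p ^ ((t : ℤ) - 1)))) *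
    ((((uPoly p t).eval (q p ^ (-(t : ℤ) - 1)) - (uPoly p t).eval (q p ^ ((t : ℤ) - 1))) * κ +
        (q p ^ ((t : ℤ) - 1) * (uPoly p t).eval (q p ^ ((t : ℤ) - 1)) -
        q p ^ (-(t : ℤ) - 1) * (uPoly p t).eval (q p ^ (-(t : ℤ) - 1)))) *
      (uPoly p t).eval κ)

lemma coefA_denominators (hp : 2 ≤ p) {t : ℕ} (h1 : 1 ≤ t) (ht : t < p) :
    q p ^ ((t : ℤ) - 1) - q p ^ (-(t : ℤ) - 1) ≠ 0 ∧
      (uPoly p t).eval (q p ^ (-(t : ℤ) - 1)) ≠ 0 ∧ (uPoly p t).eval (q p ^ ((t : ℤ) - 1)) ≠ 0 := by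
  have hd : ∀ z : ℤ, (2 * p : ℤ) ∣ z → z ≠ 0 → |z| < 2 * p → False := fun z hz h0 hlt =>
    absurd (Int.le_of_dvd (abs_pos.2 h0) ((dvd_abs _ _).2 hz)) (by omega)
  refine ⟨fun h => ?_, ?_, ?_⟩
  · refine hd _ ((q_zpow_inj_iff hp _ _).1 (sub_eq_zero.1 h)) (by omega) ?_
    rw [abs_lt]; omega
  · simp only [uPoly, eval_prod, eval_sub, eval_X, eval_C]
    refine Finset.prod_ne_zero_iff.2 fun j hj h => ?_
    simp only [Finset.mem_erase, Finset.mem_Icc] at hj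
    refine hd _ ((q_zpow_inj_iff hp _ _).1 (sub_eq_zero.1 h)) (by omega) ?_
    rw [abs_lt]; omega
  · simp only [uPoly, eval_prod, eval_sub, eval_X, eval_C]
    refine Finset.prod_ne_zero_iff.2 fun j hj h => ?_
    simp only [Finset.mem_erase, Finset.mem_Icc] at hj
    refine hd _ ((q_zpow_inj_iff hp _ _).1 (sub_eq_zero.1 h)) (by omega) ?_
    rw [abs_lt]; omega

/-- The factor u_t kills every weight of the cycle except k = 0 and k = t; the linear factor is the
Lagrange interpolation that normalizes these two values to 1. -/
lemma coefA_zpow (hp : 2 ≤ p) {t : ℕ} (h1 : 1 ≤ t) (ht : t < p) {k : ℕ} (hk : k < p) :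
    coefA p t (q p ^ ((t : ℤ) - 1 - 2 * k)) = if k = 0 ∨ k = t then 1 else 0 := by
  obtain ⟨d1, d2, d3⟩ := coefA_denominators hp h1 ht
  rw [coefA]
  split_ifs with h
  · rcases h with rfl | rfl
    · have e : (t : ℤ) - 1 - 2 * (0 : ℕ) = t - 1 := by simp
      rw [e]
      generalize Polynomial.eval (q p ^ ((t : ℤ) - 1)) (uPoly p t) = u at *
      generalize Polynomial.eval (q p ^ (-(t : ℤ) - 1)) (uPoly p t) = v at *
      generalize q p ^ ((t : ℤ) - 1) = x at *
      generalize q p ^ (-(t : ℤ) - 1) = y at *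
      field_simp
      ring
    · have e : (k : ℤ) - 1 - 2 * k = -k - 1 := by ring
      rw [e]
      generalize Polynomial.eval (q p ^ ((k : ℤ) - 1)) (uPoly p k) = u at *
      generalize Polynomial.eval (q p ^ (-(k : ℤ) - 1)) (uPoly p k) = v at *
      generalize q p ^ ((k : ℤ) - 1) = x at *
      generalize q p ^ (-(k : ℤ) - 1) = y at *
      field_simp
      ring
  · rw [not_or] at h
    rw [uPoly_eval (Finset.mem_Icc.2 ⟨by omega, by omega⟩) h.2]
    simp

lemma natCast_eq_iff {k s : ℕ} (hk : k < p) (hs : s < p) : (k : ZMod p) = s ↔ k = s := by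
  rw [ZMod.natCast_eq_natCast_iff', Nat.mod_eq_of_lt hk, Nat.mod_eq_of_lt hs]

lemma natCast_eq_zero_iff {k : ℕ} (hk : k < p) : (k : ZMod p) = 0 ↔ k = 0 := by
  have := natCast_eq_iff hk (s := 0) (by omega)
  simpa using this

/-- For α = −1 the sign is absorbed by q^p = −1, that is, by a rotation of the cycle which exchanges
the two junctions. -/
lemma coefA_kap (hp : 2 ≤ p) (α : ℤˣ) {s : ℕ} (hs1 : 1 ≤ s) (hs : s < p) (n : ZMod p) :
    coefA p (blk p α s) (kap p α s n) = if n = 0 ∨ n = s then 1 else 0 := by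
  have : NeZero p := ⟨by omega⟩
  obtain ⟨k, hk, rfl⟩ := exists_natCast n
  rw [kap_natCast α s hp,
    if_congr (or_congr (natCast_eq_zero_iff hk) (natCast_eq_iff hk hs)) rfl rfl]
  rcases Int.units_eq_one_or α with rfl | rfl
  · have := coefA_zpow hp hs1 hs hk
    simpa [blk, sgn] using this
  · have e3 : blk p (-1) s = p - s := if_neg (by decide)
    have h0 : q p ≠ 0 := q_ne_zero
    rw [e3]
    by_cases hks : k < s
    · have := coefA_zpow hp (t := p - s) (by omega) (by omega) (k := k + (p - s)) (by omega)
      have e : ((p - s : ℕ) : ℤ) - 1 - 2 * (k + (p - s) : ℕ) = -p + (s - 1 - 2 * k) := by omega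
      rw [e, zpow_add₀ h0, q_zpow_neg_p hp] at this
      have hc : sgn (-1) = -1 := by simp [sgn]
      rw [hc, this]
      exact if_congr (by omega) rfl rfl
    · have := coefA_zpow hp (t := p - s) (by omega) (by omega) (k := k - s) (by omega)
      have e : ((p - s : ℕ) : ℤ) - 1 - 2 * (k - s : ℕ) = p + (s - 1 - 2 * k) := by omega
      rw [e, zpow_add₀ h0, q_zpow_p hp] at this
      have hc : sgn (-1) = -1 := by simp [sgn]
      rw [hc, this]
      exact if_congr (by omega) rfl rfl

lemma elemA_weight (hp : 2 ≤ p) {α : ℤˣ} {s : ℕ} (hs1 : 1 ≤ s) (hs : s < p) {V : Type}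
    [AddCommGroup V] [Module ℂ V] {a : Gen → Module.End ℂ V} {N : Module.End ℂ V} (hN : N * N = 0)
    (hC : casimir p a = algebraMap ℂ _ (cas p α s) + N) {n : ZMod p} {v : V}
    (hv : a .K v = kap p α s n • v) :
    elemA p a v = (if n = 0 ∨ n = s then (1 : ℂ) else 0) • v := by
  have hb : blk p α s ∈ Finset.Icc 1 (p - 1) := by
    rw [Finset.mem_Icc]; unfold blk; split_ifs <;> omega
  rw [elemA, LinearMap.sum_apply, Finset.sum_eq_single_of_mem _ hb, ← coefA_kap hp α hs1 hs n]
  · simp only [elemATerm, idem_eq hp hs1 hs hN hC, if_true, mul_one, LinearMap.smul_apply,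
      Module.End.mul_apply, aeval_apply_vec hv, LinearMap.add_apply, map_smul, hv,
      Module.algebraMap_end_apply, ← add_smul, smul_smul, coefA]
    congr 1
    ring
  · intro t _ ht
    simp [elemATerm, idem_eq hp hs1 hs hN hC, ht]

end ElementA

/-! ### Operators on functions from the cycle of weights to a module over sl(2) and the exterior
algebra. -/

section Theta

/-- Operators on a space that define a representation of `sl₂` and of the exterior algebra of its
two-dimensional representation. -/
structure SlData (D : Type) [AddCommGroup D] [Module ℂ D] where
  (e f h x y : Module.End ℂ D)
  he : h * e - e * h = e
  hf : h * f - f * h = -f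
  ef : e * f - f * e = (2 : ℂ) • h
  xe : x * e - e * x = y
  ye : y * e = e * y
  xf : x * f = f * x
  yf : y * f - f * y = x
  xx : x * x = 0
  yy : y * y = 0
  yx : y * x = -(x * y)

variable {p : ℕ} {D : Type} [AddCommGroup D] [Module ℂ D]

namespace SlData

variable (S : SlData D)

/-- The weights of the doublet are not part of the data: they follow from 2h = [e, f]. -/
lemma hx : S.h * S.x - S.x * S.h = -((1 / 2 : ℂ) • S.x) := by
  have h1 : (2 : ℂ) • (S.h * S.x - S.x * S.h) = -S.x := by
    rw [smul_sub, ← smul_mul_assoc, ← mul_smul_comm, ← S.ef]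
    calc (S.e * S.f - S.f * S.e) * S.x - S.x * (S.e * S.f - S.f * S.e)
        = S.e * (S.f * S.x - S.x * S.f) - (S.x * S.e - S.e * S.x) * S.f
          + (S.x * S.f - S.f * S.x) * S.e + S.f * (S.x * S.e - S.e * S.x) := by noncomm_ring
      _ = -(S.y * S.f - S.f * S.y) := by rw [S.xf, S.xe]; noncomm_ring
      _ = -S.x := by rw [S.yf]
  rw [← smul_right_inj (two_ne_zero : (2 : ℂ) ≠ 0), h1, smul_neg, smul_smul]
  norm_num

lemma hy : S.h * S.y - S.y * S.h = (1 / 2 : ℂ) • S.y := by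
  have h1 : (2 : ℂ) • (S.h * S.y - S.y * S.h) = S.y := by
    rw [smul_sub, ← smul_mul_assoc, ← mul_smul_comm, ← S.ef]
    calc (S.e * S.f - S.f * S.e) * S.y - S.y * (S.e * S.f - S.f * S.e)
        = -S.e * (S.y * S.f - S.f * S.y) - (S.y * S.e - S.e * S.y) * S.f
          + (S.y * S.f - S.f * S.y) * S.e + S.f * (S.y * S.e - S.e * S.y) := by noncomm_ring
      _ = S.x * S.e - S.e * S.x := by rw [S.yf, S.ye]; noncomm_ring
      _ = S.y := S.xe
  rw [← smul_right_inj (two_ne_zero : (2 : ℂ) ≠ 0), h1, smul_smul]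
  norm_num

lemma xy_x : S.x * S.y * S.x = 0 := by
  rw [mul_assoc, S.yx, mul_neg, ← mul_assoc, S.xx, zero_mul, neg_zero]

lemma xy_xy : S.x * S.y * (S.x * S.y) = 0 := by
  rw [← mul_assoc, S.xy_x, zero_mul]

lemma xy_y : S.x * S.y * S.y = 0 := by rw [mul_assoc, S.yy, mul_zero]

lemma y_xy : S.y * (S.x * S.y) = 0 := by
  rw [← mul_assoc, S.yx, neg_mul, S.xy_y, neg_zero]

/-- The product xy spans the top exterior power, on which sl(2) acts trivially. -/
lemma xy_e : S.x * S.y * S.e = S.e * (S.x * S.y) := by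
  have h := S.xe
  rw [sub_eq_iff_eq_add] at h
  rw [mul_assoc, S.ye, ← mul_assoc, h, add_mul, S.yy, zero_add, mul_assoc]

lemma xy_f : S.x * S.y * S.f = S.f * (S.x * S.y) := by
  have h := S.yf
  rw [sub_eq_iff_eq_add] at h
  rw [mul_assoc, h, mul_add, S.xx, zero_add, ← mul_assoc, S.xf, mul_assoc]

lemma h_xy : S.h * (S.x * S.y) = S.x * S.y * S.h := by
  rw [← smul_right_inj (two_ne_zero : (2 : ℂ) ≠ 0), ← smul_mul_assoc, ← mul_smul_comm, ← S.ef,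
    sub_mul, mul_sub, mul_assoc S.e, mul_assoc S.f, ← S.xy_e, ← S.xy_f, ← mul_assoc S.e,
    ← mul_assoc S.f, ← S.xy_e, ← S.xy_f, mul_assoc (S.x * S.y), mul_assoc (S.x * S.y)]

end SlData

/-- The operator `φ ↦ (n ↦ T n (φ (n + c)))`. -/
def shf (c : ZMod p) (T : ZMod p → Module.End ℂ D) : Module.End ℂ (ZMod p → D) :=
  LinearMap.pi fun n => T n ∘ₗ LinearMap.proj (n + c)

@[simp] lemma shf_apply (c : ZMod p) (T : ZMod p → Module.End ℂ D) (φ : ZMod p → D) (n : ZMod p) :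
    shf c T φ n = T n (φ (n + c)) := rfl

variable (α : ℤˣ) (s : ℕ) (S : SlData D)

/-- The indices at which the two blocks of weight spaces meet. -/
def Junction (s : ℕ) (n : ZMod p) : Prop := n = 0 ∨ n = s

instance (s : ℕ) (n : ZMod p) : Decidable (Junction s n) := inferInstanceAs (Decidable (_ ∨ _))

/-- The signed normalization on the weight space of index `n`. -/
def eta (p : ℕ) (α : ℤˣ) (s : ℕ) (n : ZMod p) : ℂ :=
  if n.val < s then dlt p α s else -dlt p α s

/-- The component of `F` with target the index `n`. -/
def opX (n : ZMod p) : Module.End ℂ D := if Junction s n then S.x else 1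

/-- The nilpotent part of `opY`. -/
def opZ (n : ZMod p) : Module.End ℂ D :=
  eta p α s n • (if Junction s n then S.y else S.x * S.y)

/-- The component of `E` with source the index `n`. -/
def opY (n : ZMod p) : Module.End ℂ D := co p α s n • 1 + opZ α s S n

/-- The operators by which the generators act on `ZMod p → D`. -/
def actT : Gen → Module.End ℂ (ZMod p → D)
  | .K => shf 0 fun n => kap p α s n • 1
  | .Kinv => shf 0 fun n => (kap p α s n)⁻¹ • 1
  | .E => shf 1 fun n => opY α s S (n + 1)
  | .F => shf (-1) fun n => opX s S n
  | .h => shf 0 fun _ => S.h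
  | .e => shf 0 fun _ => S.e
  | .f => shf 0 fun _ => S.f

variable (φ : ZMod p → D) (n : ZMod p)

@[simp] lemma actT_K : actT α s S .K φ n = kap p α s n • φ n := by simp [actT]
@[simp] lemma actT_Kinv : actT α s S .Kinv φ n = (kap p α s n)⁻¹ • φ n := by simp [actT]
@[simp] lemma actT_E : actT α s S .E φ n = opY α s S (n + 1) (φ (n + 1)) := rfl
@[simp] lemma actT_F : actT α s S .F φ n = opX s S n (φ (n - 1)) := by
  simp [actT, sub_eq_add_neg]
@[simp] lemma actT_h : actT α s S .h φ n = S.h (φ n) := by simp [actT]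
@[simp] lemma actT_e : actT α s S .e φ n = S.e (φ n) := by simp [actT]
@[simp] lemma actT_f : actT α s S .f φ n = S.f (φ n) := by simp [actT]

variable {α s}

lemma junction_natCast {k : ℕ} (hk : k < p) (hs : s < p) :
    Junction s (k : ZMod p) ↔ k = 0 ∨ k = s :=
  or_congr (natCast_eq_zero_iff hk) (natCast_eq_iff hk hs)

lemma junction_zero : Junction s (0 : ZMod p) := Or.inl rfl

lemma eta_zero (hp : 2 ≤ p) (hs1 : 1 ≤ s) : eta p α s 0 = dlt p α s := by
  have : NeZero p := ⟨by omega⟩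
  exact if_pos (by rw [ZMod.val_zero]; omega)

lemma eta_self (hs : s < p) : eta p α s (s : ZMod p) = -dlt p α s :=
  if_neg (by rw [ZMod.val_cast_of_lt hs]; omega)

/-- The sign change of `eta` at a junction compensates yx = −xy. It gives FE and EF the same
nilpotent part at each index, so that their commutator is a scalar there. -/
lemma eta_succ (hs1 : 1 ≤ s) (hs : s < p) (n : ZMod p) :
    eta p α s n = (if Junction s (n + 1) then -1 else 1) * eta p α s (n + 1) := by
  have : NeZero p := ⟨by omega⟩
  obtain ⟨k, hk, rfl⟩ := exists_natCast n
  by_cases h : k + 1 < p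
  · have e : ((k : ZMod p) + 1) = ((k + 1 : ℕ) : ZMod p) := by push_cast; rfl
    rw [e, eta, eta, ZMod.val_cast_of_lt h, ZMod.val_cast_of_lt hk,
      if_congr ((junction_natCast h hs).trans (by omega : _ ↔ k + 1 = s)) rfl rfl]
    split_ifs <;> first | (exfalso; omega) | ring
  · have e : ((k : ZMod p) + 1) = 0 := by
      have : ((k + 1 : ℕ) : ZMod p) = 0 := by
        rw [show k + 1 = p by omega, ZMod.natCast_self]
      rw [← this]; push_cast; rfl
    rw [e, if_pos junction_zero, eta_zero (by omega) hs1, eta, ZMod.val_cast_of_lt hk,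
      if_neg (by omega)]
    ring

lemma co_junction (hp : 2 ≤ p) {n : ZMod p} (h : Junction s n) : co p α s n = 0 := by
  rcases h with rfl | rfl
  · exact co_zero α s
  · exact co_self α s hp

lemma opX_mul_opY (hp : 2 ≤ p) (n : ZMod p) :
    opX s S n * opY α s S n = co p α s n • 1 + eta p α s n • (S.x * S.y) := by
  rw [opX, opY, opZ]
  split_ifs with h
  · rw [co_junction hp h, zero_smul, zero_add, zero_add, mul_smul_comm]
  · rw [one_mul]

lemma opY_mul_opX (hp : 2 ≤ p) (hs1 : 1 ≤ s) (hs : s < p) (n : ZMod p) :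
    opY α s S (n + 1) * opX s S (n + 1) = co p α s (n + 1) • 1 + eta p α s n • (S.x * S.y) := by
  rw [opX, opY, opZ, eta_succ hs1 hs n]
  split_ifs with h
  · rw [co_junction hp h, zero_smul, zero_add, zero_add, smul_mul_assoc, S.yx, smul_neg,
      neg_one_mul, neg_smul]
  · rw [mul_one, one_mul]

/-- Each `opZ` carries a factor y. Powers of E are therefore computed to first order in `opZ`, see
`actT_E_pow`. -/
lemma opZ_mul_opZ (m n : ZMod p) : opZ α s S m * opZ α s S n = 0 := by
  simp only [opZ, smul_mul_assoc, mul_smul_comm]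
  split_ifs <;> simp [S.yy, S.y_xy, S.xy_y, S.xy_xy]

lemma junction_sum (hp : 2 ≤ p) (hs1 : 1 ≤ s) (hs : s < p) :
    have : NeZero p := ⟨by omega⟩
    ∑ m : ZMod p, (if Junction s m then 1 else 0) = 2 := by
  intro _
  rw [Finset.sum_boole]
  have : Finset.univ.filter (fun m : ZMod p => Junction s m) = {0, (s : ZMod p)} := by
    ext m; rw [Finset.mem_filter, Finset.mem_insert, Finset.mem_singleton, Junction]; simp
  rw [this, Finset.card_pair, Nat.cast_two]
  exact fun h => by have := (natCast_eq_zero_iff hs).1 h.symm; omega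

lemma opX_eq_pow (n : ZMod p) : opX s S n = S.x ^ (if Junction s n then 1 else 0) := by
  rw [opX]; split_ifs <;> simp

/-- F contributes one factor x for each junction crossed. -/
lemma actT_F_pow (k : ℕ) (φ : ZMod p → D) (n : ZMod p) : (actT α s S .F ^ k) φ n =
    (S.x ^ ∑ i ∈ Finset.range k, (if Junction s (n - ((i : ℕ) : ZMod p)) then 1 else 0)) (φ (n -
        k)) := by
  induction k generalizing φ with
  | zero => simp
  | succ k ih =>
    rw [pow_succ, Module.End.mul_apply, ih, actT_F, opX_eq_pow, ← Module.End.mul_apply, ← pow_add,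
      Finset.sum_range_succ]
    congr 2
    push_cast; ring

lemma sum_junction_sub (hp : 2 ≤ p) (hs1 : 1 ≤ s) (hs : s < p) (n : ZMod p) :
    ∑ i ∈ Finset.range p, (if Junction s (n - ((i : ℕ) : ZMod p)) then 1 else 0) = 2 := by
  have : NeZero p := ⟨by omega⟩
  rw [sum_range_zmod (fun i : ZMod p => if Junction s (n - i) then 1 else 0)]
  rw [← junction_sum hp hs1 hs]
  exact Equiv.sum_comp (Equiv.subLeft n) (fun m => if Junction s m then 1 else 0)

lemma actT_F_pow_p (hp : 2 ≤ p) (hs1 : 1 ≤ s) (hs : s < p) : actT (p := p) α s S .F ^ p = 0 := by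
  ext1 φ
  funext n
  rw [actT_F_pow, sum_junction_sub hp hs1 hs, pow_two, S.xx]; rfl

/-- A path of p − 1 steps that ends at n misses only the arrow into n + 1. If that arrow is a
junction a single x is left, otherwise both junctions are crossed and x² = 0. -/
lemma actT_F_pow_sub_one (hp : 2 ≤ p) (hs1 : 1 ≤ s) (hs : s < p) (φ : ZMod p → D) (n : ZMod p) :
    (actT α s S .F ^ (p - 1)) φ n = (if Junction s (n + 1) then S.x else 0) (φ (n + 1)) := by
  have h := sum_junction_sub hp hs1 hs n
  have e : n - ((p - 1 : ℕ) : ZMod p) = n + 1 := by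
    rw [Nat.cast_sub (by omega)]; simp
  nth_rewrite 1 [show p = p - 1 + 1 by omega] at h
  rw [Finset.sum_range_succ, e] at h
  rw [actT_F_pow, e]
  split_ifs at h ⊢
  · rw [show ∑ i ∈ Finset.range (p - 1), (if Junction s (n - ((i : ℕ) : ZMod p)) then 1 else 0) = 1
      by omega,
      pow_one]
  · rw [show ∑ i ∈ Finset.range (p - 1), (if Junction s (n - ((i : ℕ) : ZMod p)) then 1 else 0) = 2
      by omega,
      pow_two, S.xx]

lemma actT_E_pow (k : ℕ) (φ : ZMod p → D) (n : ZMod p) : (actT α s S .E ^ k) φ n =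
    (((∏ i ∈ Finset.range k, co p α s (n + 1 + ((i : ℕ) : ZMod p))) • (1 : Module.End ℂ D) +
      ∑ j ∈ Finset.range k, (∏ i ∈ (Finset.range k).erase j, co p α s (n + 1 + ((i : ℕ) : ZMod p)))
          •
        opZ α s S (n + 1 + ((j : ℕ) : ZMod p)) : Module.End ℂ D)) (φ (n + k)) := by
  induction k generalizing φ with
  | zero => simp
  | succ k ih =>
    have e : n + ((k + 1 : ℕ) : ZMod p) = n + k + 1 := by push_cast; ring
    rw [pow_succ, Module.End.mul_apply, ih, actT_E, ← Module.End.mul_apply, e]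
    congr 1
    rw [opY, add_mul, mul_add, mul_add, Finset.prod_range_succ, Finset.sum_range_succ,
      Finset.sum_mul, Finset.sum_mul]
    have h1 : ∀ j ∈ Finset.range k, ∏ i ∈ (Finset.range (k + 1)).erase j,
        co p α s (n + 1 + ((i : ℕ) : ZMod p)) = co p α s (n + 1 + k) * ∏ i ∈ (Finset.range k).erase
            j, co p α s (n + 1 + ((i : ℕ) : ZMod p)) := by
      intro j hj
      rw [Finset.mem_range] at hj
      rw [Finset.range_add_one, Finset.erase_insert_of_ne (by omega), Finset.prod_insert (by simp)]
    have h2 : (Finset.range (k + 1)).erase k = Finset.range k := by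
      rw [Finset.range_add_one, Finset.erase_insert (by simp)]
    have h4 : ∑ j ∈ Finset.range k, (∏ i ∈ (Finset.range (k + 1)).erase j,
          co p α s (n + 1 + ((i : ℕ) : ZMod p))) • opZ α s S (n + 1 + ((j : ℕ) : ZMod p)) =
        ∑ j ∈ Finset.range k, (co p α s (n + 1 + k) * ∏ i ∈ (Finset.range k).erase j,
          co p α s (n + 1 + ((i : ℕ) : ZMod p))) • opZ α s S (n + 1 + ((j : ℕ) : ZMod p)) :=
      Finset.sum_congr rfl fun j hj => by rw [h1 j hj]
    rw [h2, h4]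
    have h3 : n + (k : ZMod p) + 1 = n + 1 + k := by ring
    simp only [h3, smul_mul_assoc, mul_smul_comm, one_mul, mul_one, opZ_mul_opZ, smul_zero,
      Finset.sum_const_zero, add_zero, smul_smul]
    rw [add_assoc, add_comm (_ • opZ α s S _), mul_comm (∏ i ∈ Finset.range k, _)]

end Theta

/-! ### Verification of the defining relations for the operators on the cycle. -/

section ThetaRelations

variable {p : ℕ} {D : Type} [AddCommGroup D] [Module ℂ D] {α : ℤˣ} {s : ℕ} (S : SlData D)

lemma exists_range_add [NeZero p] (n m : ZMod p) :
    ∃ i ∈ Finset.range p, n + 1 + ((i : ℕ) : ZMod p) = m :=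
  ⟨(m - n - 1).val, Finset.mem_range.2 (ZMod.val_lt _), by rw [ZMod.natCast_zmod_val]; ring⟩

lemma exists_range_sub_one_add [NeZero p] {n m : ZMod p} (h : m ≠ n) :
    ∃ i ∈ Finset.range (p - 1), n + 1 + ((i : ℕ) : ZMod p) = m := by
  obtain ⟨i, hi, e⟩ := exists_range_add n m
  rw [Finset.mem_range] at hi
  refine ⟨i, Finset.mem_range.2 (lt_of_le_of_ne (by omega) ?_), e⟩
  rintro rfl
  refine h ?_
  rw [← e, Nat.cast_sub (by omega)]
  simp

lemma self_ne_zero (hs1 : 1 ≤ s) (hs : s < p) : (s : ZMod p) ≠ 0 := fun h => by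
  have := (natCast_eq_zero_iff hs).1 h; omega

lemma junction_self : Junction s (s : ZMod p) := Or.inr rfl

lemma exists_junction_ne (hs1 : 1 ≤ s) (hs : s < p) (m : ZMod p) :
    ∃ m', Junction s m' ∧ m' ≠ m := by
  by_cases h : m = 0
  · exact ⟨s, Or.inr rfl, by rw [h]; exact self_ne_zero hs1 hs⟩
  · exact ⟨0, Or.inl rfl, Ne.symm h⟩

lemma actT_E_pow_p (hp : 2 ≤ p) (hs1 : 1 ≤ s) (hs : s < p) : actT (p := p) α s S .E ^ p = 0 := by
  have : NeZero p := ⟨by omega⟩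
  refine LinearMap.ext fun φ => funext fun n => ?_
  rw [actT_E_pow]
  have h1 : ∏ i ∈ Finset.range p, co p α s (n + 1 + ((i : ℕ) : ZMod p)) = 0 := by
    obtain ⟨i, hi, e⟩ := exists_range_add n 0
    exact Finset.prod_eq_zero hi (by rw [e, co_zero])
  -- Each first-order term omits one coefficient, but two coefficients on the cycle vanish.
  rw [h1, zero_smul, zero_add, Finset.sum_eq_zero]
  · rfl
  · intro j hj
    obtain ⟨m, hm, hne⟩ := exists_junction_ne hs1 hs (n + 1 + ((j : ℕ) : ZMod p))
    obtain ⟨i, hi, e⟩ := exists_range_add n m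
    rw [Finset.prod_eq_zero (i := i), zero_smul]
    · exact Finset.mem_erase.2 ⟨by rintro rfl; exact hne e.symm, hi⟩
    · rw [e, co_junction hp hm]

/-- The product of the nonzero coefficients of `E`. -/
def prodCo (p : ℕ) (α : ℤˣ) (s : ℕ) : ℂ :=
  ∏ k ∈ (Finset.Icc 1 (p - 1)).erase s, co p α s (k : ZMod p)

/-- The path visits every index except n. A first-order term survives only if n is a junction and
the nilpotent part is taken at the other junction, where `eta` has the opposite sign. -/
lemma actT_E_pow_sub_one (hp : 2 ≤ p) (hs1 : 1 ≤ s) (hs : s < p) (φ : ZMod p → D) (n : ZMod p) :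
    (actT α s S .E ^ (p - 1)) φ n =
      (if Junction s n then (-(eta p α s n) * prodCo p α s) • S.y else 0) (φ (n - 1)) := by
  have : NeZero p := ⟨by omega⟩
  have e1 : n + ((p - 1 : ℕ) : ZMod p) = n - 1 := by
    rw [Nat.cast_sub (by omega)]; simp; ring
  rw [actT_E_pow, e1]
  congr 1
  have h1 : ∏ i ∈ Finset.range (p - 1), co p α s (n + 1 + ((i : ℕ) : ZMod p)) = 0 := by
    obtain ⟨m, hm, hne⟩ := exists_junction_ne hs1 hs n
    obtain ⟨i, hi, e⟩ := exists_range_sub_one_add hne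
    exact Finset.prod_eq_zero hi (by rw [e, co_junction hp hm])
  have h2 : ∀ (m : ZMod p) (j : ℕ), Junction s m → m ≠ n → n + 1 + ((j : ℕ) : ZMod p) ≠ m →
      ∏ i ∈ (Finset.range (p - 1)).erase j, co p α s (n + 1 + ((i : ℕ) : ZMod p)) = 0 := by
    intro m j hm hmn hj
    obtain ⟨i, hi, e⟩ := exists_range_sub_one_add hmn
    refine Finset.prod_eq_zero (Finset.mem_erase.2 ⟨?_, hi⟩) (by rw [e, co_junction hp hm])
    rintro rfl; exact hj e
  rw [h1, zero_smul, zero_add]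
  split_ifs with h
  · rcases h with rfl | rfl
    -- Starting from n = 0, position s − 1 of the path is the junction s.
    · rw [Finset.sum_eq_single_of_mem (s - 1) (Finset.mem_range.2 (by omega))]
      · have e2 : (0 + 1 + ((s - 1 : ℕ) : ZMod p)) = s := by
          rw [Nat.cast_sub hs1]; simp
        rw [e2, opZ, if_pos junction_self, smul_smul, eta_self hs, eta_zero hp hs1, mul_comm]
        congr 2
        refine Finset.prod_nbij' (fun i => i + 1) (fun k => k - 1) ?_ ?_ ?_ ?_ ?_
        · intro i hi; simp only [Finset.mem_erase, Finset.mem_range, Finset.mem_Icc] at hi ⊢; omega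
        · intro i hi; simp only [Finset.mem_erase, Finset.mem_range, Finset.mem_Icc] at hi ⊢; omega
        · intro i hi; simp only [Finset.mem_erase, Finset.mem_range] at hi ⊢; omega
        · intro i hi; simp only [Finset.mem_erase, Finset.mem_Icc] at hi ⊢; omega
        · intro i _; congr 1; push_cast; ring
      · intro j hj hj'
        rw [h2 s j (Or.inr rfl) (self_ne_zero hs1 hs), zero_smul]
        intro e
        have e' : ((j + 1 : ℕ) : ZMod p) = s := by rw [← e]; push_cast; ring
        rw [Finset.mem_range] at hj
        have := (natCast_eq_iff (by omega) hs).1 e'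
        omega
    -- Starting from n = s, position p − s − 1 is the junction 0, and the later positions wrap
    -- around the cycle.
    · rw [Finset.sum_eq_single_of_mem (p - s - 1) (Finset.mem_range.2 (by omega))]
      · have e2 : ((s : ZMod p) + 1 + ((p - s - 1 : ℕ) : ZMod p)) = 0 := by
          rw [Nat.cast_sub (by omega), Nat.cast_sub hs.le]; simp
        rw [e2, opZ, if_pos junction_zero, smul_smul, eta_self hs, eta_zero hp hs1, mul_comm,
            neg_neg]
        congr 2
        refine Finset.prod_nbij' (fun i => if i < p - s - 1 then s + 1 + i else s + 1 + i - p)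
          (fun k => if s < k then k - s - 1 else k + p - s - 1) ?_ ?_ ?_ ?_ ?_
        · intro i hi; simp only [Finset.mem_erase, Finset.mem_range, Finset.mem_Icc] at hi ⊢
          split_ifs <;> omega
        · intro i hi; simp only [Finset.mem_erase, Finset.mem_range, Finset.mem_Icc] at hi ⊢
          split_ifs <;> omega
        · intro i hi; simp only [Finset.mem_erase, Finset.mem_range] at hi ⊢
          split_ifs <;> omega
        · intro i hi; simp only [Finset.mem_erase, Finset.mem_Icc] at hi ⊢
          split_ifs <;> omega
        · intro i hi
          simp only [Finset.mem_erase, Finset.mem_range] at hi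
          congr 1
          split_ifs
          · push_cast; ring
          · rw [Nat.cast_sub (by omega)]; push_cast; simp
      · intro j hj hj'
        rw [h2 0 j (Or.inl rfl) (self_ne_zero hs1 hs).symm, zero_smul]
        intro e
        have e' : ((s + 1 + j : ℕ) : ZMod p) = 0 := by rw [← e]; push_cast; ring
        rw [Finset.mem_range] at hj
        rw [ZMod.natCast_eq_zero_iff] at e'
        obtain ⟨c, hc⟩ := e'
        have hc1 : 0 < c := Nat.pos_of_ne_zero (by rintro rfl; omega)
        have hc2 : c < 2 := by
          by_contra! h
          have := Nat.mul_le_mul_left p h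
          omega
        have : c = 1 := by omega
        subst this
        omega
  · rw [Junction, not_or] at h
    refine Finset.sum_eq_zero fun j _ => ?_
    by_cases hj : n + 1 + ((j : ℕ) : ZMod p) = 0
    · rw [h2 s j (Or.inr rfl) (Ne.symm h.2) (by rw [hj]; exact (self_ne_zero hs1 hs).symm),
        zero_smul]
    · rw [h2 0 j (Or.inl rfl) (Ne.symm h.1) hj, zero_smul]

lemma elemT_coef_zero (hp : 2 ≤ p) :
    1 / (q p - (q p)⁻¹) * (q p * kap p α s 0 - (q p)⁻¹ * (kap p α s 0)⁻¹) =
      sgn α * qNum p s := by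
  have h0 : q p ≠ 0 := q_ne_zero
  have h1 := kap_natCast α s hp 0
  have h2 := kap_inv α s hp 0
  rw [Nat.cast_zero] at h1 h2
  have e1 : q p * q p ^ ((s : ℤ) - 1 - 2 * (0 : ℕ)) = q p ^ (s : ℤ) := by
    nth_rewrite 1 [← zpow_one (q p)]
    rw [← zpow_add₀ h0]; congr 1; simp
  have e2 : (q p)⁻¹ * q p ^ (-((s : ℤ) - 1 - 2 * (0 : ℕ))) = q p ^ (-(s : ℤ)) := by
    rw [← zpow_neg_one, ← zpow_add₀ h0]; congr 1; push_cast; ring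
  rw [h2, h1, mul_left_comm, mul_left_comm _ (sgn α), e1, e2, qNum]
  ring

lemma elemT_coef_self (hp : 2 ≤ p) :
    1 / (q p - (q p)⁻¹) * (q p * kap p α s (s : ZMod p) - (q p)⁻¹ * (kap p α s (s : ZMod p))⁻¹) =
      -(sgn α * qNum p s) := by
  have h0 : q p ≠ 0 := q_ne_zero
  have e1 : q p * q p ^ ((s : ℤ) - 1 - 2 * s) = q p ^ (-(s : ℤ)) := by
    nth_rewrite 1 [← zpow_one (q p)]
    rw [← zpow_add₀ h0]; congr 1; ring
  have e2 : (q p)⁻¹ * q p ^ (-((s : ℤ) - 1 - 2 * s)) = q p ^ (s : ℤ) := by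
    rw [← zpow_neg_one, ← zpow_add₀ h0]; congr 1; ring
  rw [kap_inv α s hp, kap_natCast α s hp, mul_left_comm, mul_left_comm _ (sgn α), e1, e2, qNum]
  ring

/-- This is the relation for [E, f] at a junction; it dictates the normalization `dlt`. -/
lemma eta_eq_elemT_coef (hp : 2 ≤ p) (hs1 : 1 ≤ s) (hs : s < p) {n : ZMod p} (h : Junction s n) :
    eta p α s n = (-1) ^ (p + 1) / qFact p (p - 1) *
      (1 / (q p - (q p)⁻¹) * (q p * kap p α s n - (q p)⁻¹ * (kap p α s n)⁻¹)) := by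
  rcases h with rfl | rfl
  · rw [elemT_coef_zero hp, eta_zero hp hs1, dlt]; ring
  · rw [elemT_coef_self hp, eta_self hs, dlt]; ring

lemma kap_pow (hp : 2 ≤ p) (n : ZMod p) : kap p α s n ^ p = sgn α ^ p * (-1) ^ (s + 1) := by
  rw [kap, mul_pow, ← zpow_natCast (q p ^ _), ← zpow_mul, mul_comm _ (p : ℤ), zpow_mul, q_zpow_p hp,
    ← zpow_natCast (-1)]
  congr 1
  have : ((s : ℤ) - 1 - 2 * n.val) = (s + 1 : ℕ) + 2 * (-1 - n.val) := by push_cast; ring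
  rw [this, zpow_add₀ (by norm_num), zpow_mul (-1 : ℂ) 2]
  norm_num

/-- At a junction F is x and [x, e] = y, so the relation for [F, e] requires the coefficient of y to
be exactly 1. Since `dlt` is already fixed by [E, f], this is a genuine condition; it holds by
`prod_co`. -/
lemma Fe_coef (hp : 2 ≤ p) (hs1 : 1 ≤ s) (hs : s < p) {n : ZMod p} (h : Junction s n) :
    1 / qFact p (p - 1) * (kap p α s n ^ p *
      ((1 / (q p - (q p)⁻¹) * (q p * kap p α s n - (q p)⁻¹ * (kap p α s n)⁻¹)) *
        (-(eta p α s n) * prodCo p α s))) = 1 := by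
  have hE := eta_eq_elemT_coef (α := α) hp hs1 hs h
  have hQ := qFact_ne_zero hp
  have hT : (1 / (q p - (q p)⁻¹) * (q p * kap p α s n - (q p)⁻¹ * (kap p α s n)⁻¹)) ^ 2 =
      qNum p s ^ 2 := by
    have := sgn_mul_self (α := α)
    rcases h with rfl | rfl
    · rw [elemT_coef_zero hp]; linear_combination qNum p s ^ 2 * this
    · rw [elemT_coef_self hp]; linear_combination qNum p s ^ 2 * this
  have hP := prod_co α s hp hs1 hs
  rw [← prodCo] at hP
  rw [hE, kap_pow hp]
  generalize (1 / (q p - (q p)⁻¹) * (q p * kap p α s n - (q p)⁻¹ * (kap p α s n)⁻¹)) = T at *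
  have e1 : sgn α ^ p * sgn α ^ p = 1 := by rw [← mul_pow, sgn_mul_self, one_pow]
  have e2 : (-1 : ℂ) ^ (s + 1) * (-1) ^ (p + 1) * (-1) ^ (p - 1 - s) = -1 := by
    rw [← pow_add, ← pow_add]
    exact Odd.neg_one_pow ⟨p, by omega⟩
  rw [show (1 / qFact p (p - 1) * (sgn α ^ p * (-1) ^ (s + 1) *
      (T * (-((-1) ^ (p + 1) / qFact p (p - 1) * T) * prodCo p α s)))) =
      -(sgn α ^ p * (-1) ^ (s + 1) * (-1) ^ (p + 1)) * (T ^ 2 * prodCo p α s) /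
        qFact p (p - 1) ^ 2 by field_simp, hT, hP, div_eq_one_iff_eq (pow_ne_zero _ hQ)]
  linear_combination -(sgn α ^ p * sgn α ^ p * qFact p (p - 1) ^ 2) * e2 +
    qFact p (p - 1) ^ 2 * e1

lemma actT_elemT (φ : ZMod p → D) (n : ZMod p) : elemT p (actT α s S) φ n =
    (1 / (q p - (q p)⁻¹) * (q p * kap p α s n - (q p)⁻¹ * (kap p α s n)⁻¹)) • φ n := by
  simp only [elemT, LinearMap.smul_apply, LinearMap.sub_apply, Pi.smul_apply, Pi.sub_apply, actT_K,
    actT_Kinv, smul_smul, ← sub_smul]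

lemma actT_K_pow (k : ℕ) (φ : ZMod p → D) (n : ZMod p) :
    (actT α s S .K ^ k) φ n = kap p α s n ^ k • φ n := by
  induction k with
  | zero => simp
  | succ k ih => rw [pow_succ', Module.End.mul_apply, actT_K, ih, smul_smul, pow_succ']

/-- The nilpotent part of the Casimir operator. -/
def casN (p : ℕ) (α : ℤˣ) (s : ℕ) (S : SlData D) : Module.End ℂ (ZMod p → D) :=
  shf 0 fun n => ((q p - (q p)⁻¹) ^ 2 * eta p α s n) • (S.x * S.y)

lemma casN_mul_self : casN p α s S * casN p α s S = 0 := by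
  refine LinearMap.ext fun φ => funext fun n => ?_
  simp only [casN, Module.End.mul_apply, shf_apply, add_zero, LinearMap.smul_apply, map_smul]
  rw [← Module.End.mul_apply, ← Module.End.mul_apply, S.xy_x]
  simp

lemma casimir_actT (hp : 2 ≤ p) (hs1 : 1 ≤ s) (hs : s < p) :
    casimir p (actT (p := p) α s S) = algebraMap ℂ _ (cas p α s) + casN p α s S := by
  have : NeZero p := ⟨by omega⟩
  refine LinearMap.ext fun φ => funext fun n => ?_
  have h := opY_mul_opX (α := α) S hp hs1 hs n
  simp only [casimir, LinearMap.add_apply, LinearMap.smul_apply, Module.End.mul_apply, Pi.add_apply,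
    Pi.smul_apply, actT_E, actT_F, actT_K, actT_Kinv, add_sub_cancel_right, casN, shf_apply,
    add_zero, Module.algebraMap_end_apply, ← cas_eq α s hp n]
  rw [← Module.End.mul_apply (opY α s S (n + 1)), h]
  simp only [LinearMap.add_apply, LinearMap.smul_apply, Module.End.one_apply, smul_add, smul_smul,
    add_smul, Module.End.mul_apply]
  abel

/-- `A` is the indicator of the junctions. This is what the relations for [h, E] and [h, F] need, as
only x and y have nonzero h-weight. -/
lemma elemA_actT (hp : 2 ≤ p) (hs1 : 1 ≤ s) (hs : s < p) (φ : ZMod p → D) (n : ZMod p) :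
    elemA p (actT α s S) φ n = (if Junction s n then (1 : ℂ) else 0) • φ n := by
  have : NeZero p := ⟨by omega⟩
  have h : elemA p (actT α s S) =
      shf (0 : ZMod p) fun n => (if Junction s n then (1 : ℂ) else 0) • (1 : Module.End ℂ D) := by
    refine LinearMap.pi_ext fun m d => ?_
    rw [elemA_weight hp hs1 hs (casN_mul_self S) (casimir_actT S hp hs1 hs) (n := m)]
    · funext k
      rw [shf_apply, add_zero]
      by_cases hk : k = m
      · subst hk; rfl
      · simp [hk]
    · funext k
      rw [actT_K]
      by_cases hk : k = m
      · subst hk; simp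
      · simp [hk]
  rw [h, shf_apply, add_zero, LinearMap.smul_apply, Module.End.one_apply]

lemma opY_comm_e (n : ZMod p) : opY α s S n * S.e = S.e * opY α s S n := by
  rw [opY, opZ, add_mul, mul_add, smul_mul_assoc, mul_smul_comm, one_mul, mul_one, smul_mul_assoc,
    mul_smul_comm]
  split_ifs
  · rw [S.ye]
  · rw [S.xy_e]

/-- The operators `actT` satisfy the defining relations. -/
lemma isRep_actT (hp : 2 ≤ p) (hs1 : 1 ≤ s) (hs : s < p) : IsRep p (actT (p := p) α s S) := by
  have : NeZero p := ⟨by omega⟩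
  intro a b hab
  refine LinearMap.ext fun φ => funext fun n => ?_
  have hk := kap_ne_zero α s n
  cases hab with
  | K_mul_Kinv => simp [hk]
  | Kinv_mul_K => simp [hk]
  | KE =>
    simp only [Module.End.mul_apply, actT_K, actT_E, actT_Kinv, map_smul, smul_smul,
      LinearMap.smul_apply, Pi.smul_apply]
    rw [kap_succ α s hp n, mul_assoc, mul_inv_cancel₀ (kap_ne_zero α s _), mul_one]
  | KF =>
    have h := kap_succ α s hp (n - 1)
    rw [sub_add_cancel] at h
    simp only [Module.End.mul_apply, actT_K, actT_F, actT_Kinv, map_smul, smul_smul,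
      LinearMap.smul_apply, Pi.smul_apply]
    congr 1
    rw [h, mul_inv, inv_pow]
    field_simp
  | EF =>
    simp only [Module.End.mul_apply, LinearMap.sub_apply, Pi.sub_apply, actT_K, actT_F, actT_E,
      actT_Kinv, LinearMap.smul_apply, Pi.smul_apply, add_sub_cancel_right, sub_add_cancel]
    rw [← Module.End.mul_apply (opY α s S (n + 1)), opY_mul_opX S hp hs1 hs, ← Module.End.mul_apply,
      opX_mul_opY S hp, ← sub_smul, smul_smul, ← co_succ_sub α s hp]
    simp [sub_smul]
  | E_pow => rw [actT_E_pow_p S hp hs1 hs]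
  | F_pow => rw [actT_F_pow_p S hp hs1 hs]
  | K_pow =>
    rw [actT_K_pow, mul_comm, pow_mul, kap_pow hp, mul_pow, ← pow_mul, ← pow_mul, mul_comm p,
      pow_mul, pow_two, sgn_mul_self, one_pow, mul_comm (s + 1), pow_mul]
    simp
  | he =>
    have := congrArg (fun T => T (φ n)) S.he
    simpa using this
  | hf =>
    have := congrArg (fun T => T (φ n)) S.hf
    simpa using this
  | ef =>
    have := congrArg (fun T => T (φ n)) S.ef
    simpa using this
  | hK => simp
  | Ee =>
    have := congrArg (fun T => T (φ (n + 1))) (opY_comm_e (α := α) (s := s) S (n + 1))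
    simpa [sub_eq_zero] using this
  | Ke => simp
  | Ff =>
    have : opX s S n * S.f = S.f * opX s S n := by
      rw [opX]; split_ifs
      · exact S.xf
      · simp
    have := congrArg (fun T => T (φ (n - 1))) this
    simpa [sub_eq_zero] using this
  | Kf => simp
  | Fe =>
    simp only [LinearMap.smul_apply, Module.End.mul_apply, LinearMap.sub_apply, Pi.sub_apply,
      Pi.smul_apply, actT_F, actT_e]
    rw [actT_K_pow, actT_elemT, actT_E_pow_sub_one S hp hs1 hs, opX]
    split_ifs with h
    · rw [LinearMap.smul_apply, smul_smul, smul_smul, smul_smul, mul_assoc, mul_assoc,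
        Fe_coef hp hs1 hs h, one_smul]
      exact congrArg (fun T => T (φ (n - 1))) S.xe
    · simp
  | Ef =>
    simp only [LinearMap.smul_apply, Module.End.mul_apply, LinearMap.sub_apply, Pi.sub_apply,
      Pi.smul_apply, actT_E, actT_f]
    rw [actT_F_pow_sub_one S hp hs1 hs, actT_elemT, opY, opZ]
    split_ifs with h
    · rw [map_smul, smul_smul, ← eta_eq_elemT_coef hp hs1 hs h, co_junction hp h, zero_smul,
        zero_add]
      have := congrArg (fun T => T (φ (n + 1))) S.yf
      simp only [LinearMap.smul_apply, map_smul, ← smul_sub]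
      exact congrArg _ this
    · have := congrArg (fun T => T (φ (n + 1))) S.xy_f
      simp only [Module.End.mul_apply] at this
      simp [this]
  | hE =>
    simp only [LinearMap.smul_apply, Module.End.mul_apply, LinearMap.sub_apply, Pi.sub_apply,
      Pi.smul_apply, actT_E, actT_h, elemA_actT S hp hs1 hs]
    rw [opY, opZ]
    split_ifs with h
    · rw [co_junction hp h, zero_smul, zero_add, one_smul]
      have := congrArg (fun T => T (φ (n + 1))) S.hy
      simp only [LinearMap.smul_apply, map_smul, ← smul_sub]
      rw [smul_comm]
      exact congrArg _ this
    · have := congrArg (fun T => T (φ (n + 1))) S.h_xy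
      simp only [Module.End.mul_apply] at this
      simp [this]
  | hF =>
    simp only [LinearMap.smul_apply, Module.End.mul_apply, LinearMap.sub_apply, Pi.sub_apply,
      Pi.smul_apply, actT_F, actT_h, elemA_actT S hp hs1 hs, LinearMap.neg_apply, Pi.neg_apply]
    rw [opX]
    split_ifs with h
    · rw [one_smul]
      exact congrArg (fun T => T (φ (n - 1))) S.hx
    · simp

end ThetaRelations

/-! ### Irreducible sl(2)-modules as binary forms, and the data for the modules W and P. -/

section WeightData

/-- An `sl₂`-representation. -/
structure Sl2Data (V : Type) [AddCommGroup V] [Module ℂ V] where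
  (e f h : Module.End ℂ V)
  he : h * e - e * h = e
  hf : h * f - f * h = -f
  ef : e * f - f * e = (2 : ℂ) • h

/-- The `k`-th coordinate, which is zero out of range. -/
def cf (r k : ℕ) : (Fin r → ℂ) →ₗ[ℂ] ℂ := if h : k < r then LinearMap.proj ⟨k, h⟩ else 0

lemma cf_of_lt {r k : ℕ} (h : k < r) (a : Fin r → ℂ) : cf r k a = a ⟨k, h⟩ := by
  rw [cf, dif_pos h]; rfl

lemma cf_of_ge {r k : ℕ} (h : r ≤ k) (a : Fin r → ℂ) : cf r k a = 0 := by
  rw [cf, dif_neg (by omega)]; rfl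

lemma cf_fin {r : ℕ} (k : Fin r) (a : Fin r → ℂ) : cf r k a = a k := cf_of_lt k.2 a

lemma ext_cf {r : ℕ} {a b : Fin r → ℂ} (h : ∀ k < r, cf r k a = cf r k b) : a = b :=
  funext fun k => by have := h k k.2; rwa [cf_fin, cf_fin] at this

/-- The operator `e` on the `r`-dimensional representation. -/
def eL (r : ℕ) : Module.End ℂ (Fin r → ℂ) :=
  LinearMap.pi fun m => (((m : ℂ) + 1) * ((r : ℂ) - (m + 1))) • cf r (m + 1)

/-- The operator `f` on the `r`-dimensional representation. -/
def fL (r : ℕ) : Module.End ℂ (Fin r → ℂ) :=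
  LinearMap.pi fun m => if (m : ℕ) = 0 then 0 else cf r (m - 1)

/-- The operator `h` on the `r`-dimensional representation. -/
def hL (r : ℕ) : Module.End ℂ (Fin r → ℂ) :=
  LinearMap.pi fun m => ((1 / 2 : ℂ) * ((r : ℂ) - 1 - 2 * m)) • cf r m

lemma cf_eL (r k : ℕ) (a : Fin r → ℂ) :
    cf r k (eL r a) = ((k : ℂ) + 1) * ((r : ℂ) - (k + 1)) * cf r (k + 1) a := by
  by_cases h : k < r
  · rw [cf_of_lt h]; rfl
  · rw [cf_of_ge (by omega), cf_of_ge (by omega), mul_zero]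

lemma cf_fL_zero (r : ℕ) (a : Fin r → ℂ) : cf r 0 (fL r a) = 0 := by
  by_cases h : 0 < r
  · rw [cf_of_lt h]; simp [fL]
  · rw [cf_of_ge (by omega)]

lemma cf_fL_succ {r k : ℕ} (h : k + 1 < r) (a : Fin r → ℂ) :
    cf r (k + 1) (fL r a) = cf r k a := by
  rw [cf_of_lt h]; simp [fL]

lemma cf_hL (r k : ℕ) (a : Fin r → ℂ) :
    cf r k (hL r a) = (1 / 2 : ℂ) * ((r : ℂ) - 1 - 2 * k) * cf r k a := by
  by_cases h : k < r
  · rw [cf_of_lt h]; rfl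
  · rw [cf_of_ge (by omega), cf_of_ge (by omega), mul_zero]

/-- The coefficient vanishes at k + 1 = r, precisely where the shifted coordinate falls out of
range. The same device is used for `dX` in `coef_mul_cf_dX`. -/
lemma coef_mul_cf_fL {r k : ℕ} (a : Fin r → ℂ) :
    ((r : ℂ) - (k + 1)) * cf r (k + 1) (fL r a) = ((r : ℂ) - (k + 1)) * cf r k a := by
  rcases lt_trichotomy (k + 1) r with h | h | h
  · rw [cf_fL_succ h]
  · subst h; simp
  · rw [cf_of_ge (by omega), cf_of_ge (by omega)]

/-- The `r`-dimensional irreducible representation of `sl₂`. -/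
def repL (r : ℕ) : Sl2Data (Fin r → ℂ) where
  e := eL r
  f := fL r
  h := hL r
  he := by
    refine LinearMap.ext fun a => ext_cf fun k hk => ?_
    simp only [LinearMap.sub_apply, Module.End.mul_apply, map_sub, cf_hL, cf_eL]
    push_cast; ring
  hf := by
    refine LinearMap.ext fun a => ext_cf fun k hk => ?_
    rcases k with _ | k
    · simp [cf_hL, cf_fL_zero]
    · simp only [LinearMap.sub_apply, Module.End.mul_apply, map_sub, cf_hL, LinearMap.neg_apply,
        map_neg, cf_fL_succ hk]
      push_cast; ring
  ef := by
    refine LinearMap.ext fun a => ext_cf fun k hk => ?_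
    simp only [LinearMap.sub_apply, Module.End.mul_apply, map_sub, cf_hL, LinearMap.smul_apply,
      map_smul, smul_eq_mul, cf_eL]
    rw [mul_assoc, coef_mul_cf_fL]
    rcases k with _ | k
    · rw [cf_fL_zero]; push_cast; ring
    · rw [cf_fL_succ hk, cf_eL]
      push_cast; ring

/-- The partial derivative in the first variable. -/
def dX (r : ℕ) : (Fin (r + 1) → ℂ) →ₗ[ℂ] (Fin r → ℂ) :=
  LinearMap.pi fun m => cf (r + 1) m

/-- The partial derivative in the second variable. -/
def dY (r : ℕ) : (Fin (r + 1) → ℂ) →ₗ[ℂ] (Fin r → ℂ) :=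
  LinearMap.pi fun m => ((m : ℂ) + 1) • cf (r + 1) (m + 1)

lemma cf_dX {r k : ℕ} (h : k < r) (a : Fin (r + 1) → ℂ) : cf r k (dX r a) = cf (r + 1) k a := by
  rw [cf_of_lt h]; rfl

lemma cf_dY (r k : ℕ) (a : Fin (r + 1) → ℂ) :
    cf r k (dY r a) = ((k : ℂ) + 1) * cf (r + 1) (k + 1) a := by
  by_cases h : k < r
  · rw [cf_of_lt h]; rfl
  · rw [cf_of_ge (by omega), cf_of_ge (by omega), mul_zero]

lemma coef_mul_cf_dX {r k : ℕ} (a : Fin (r + 1) → ℂ) :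
    ((r : ℂ) - k) * cf r k (dX r a) = ((r : ℂ) - k) * cf (r + 1) k a := by
  rcases lt_trichotomy k r with h | h | h
  · rw [cf_dX h]
  · subst h; simp
  · rw [cf_of_ge (by omega), cf_of_ge (by omega)]

/-- In the basis X^{r−m} Y^m / (r−m)! of forms of degree r one has e = X ∂_Y, f = Y ∂_X, and `dX`,
`dY` are ∂_X, ∂_Y; this and the next three identities are the commutators of these operators. -/
lemma dX_eL (r : ℕ) (a : Fin (r + 1) → ℂ) : dX r (eL _ a) = eL r (dX r a) + dY r a := by
  refine ext_cf fun k hk => ?_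
  have := coef_mul_cf_dX (r := r) (k := k + 1) a
  push_cast at this
  rw [map_add, cf_dX hk, cf_eL, cf_eL, cf_dY, mul_assoc _ _ (cf r _ _), this]
  push_cast; ring

lemma dY_eL (r : ℕ) (a : Fin (r + 1) → ℂ) : dY r (eL _ a) = eL r (dY r a) := by
  refine ext_cf fun k hk => ?_
  rw [cf_dY, cf_eL, cf_eL, cf_dY]
  push_cast; ring

lemma dX_fL (r : ℕ) (a : Fin (r + 1) → ℂ) : dX r (fL _ a) = fL r (dX r a) := by
  refine ext_cf fun k hk => ?_
  rw [cf_dX hk]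
  rcases k with _ | k
  · rw [cf_fL_zero, cf_fL_zero]
  · rw [cf_fL_succ (by omega), cf_fL_succ hk, cf_dX (by omega)]

lemma dY_fL (r : ℕ) (a : Fin (r + 1) → ℂ) : dY r (fL _ a) = fL r (dY r a) + dX r a := by
  refine ext_cf fun k hk => ?_
  rw [map_add, cf_dY, cf_dX hk, cf_fL_succ (by omega)]
  rcases k with _ | k
  · rw [cf_fL_zero]; push_cast; ring
  · rw [cf_fL_succ hk, cf_dY]; push_cast; ring

/-- The data of the module with top `X^α_{s,r+1}` and socle `X^{-α}_{p-s,r}`. -/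
def dataW (r : ℕ) : SlData ((Fin (r + 1) → ℂ) × (Fin r → ℂ)) where
  e := (eL _).prodMap (eL _)
  f := (fL _).prodMap (fL _)
  h := (hL _).prodMap (hL _)
  x := LinearMap.inr ℂ _ _ ∘ₗ dX r ∘ₗ LinearMap.fst ℂ _ _
  y := LinearMap.inr ℂ _ _ ∘ₗ dY r ∘ₗ LinearMap.fst ℂ _ _
  he := LinearMap.ext fun v => Prod.ext (LinearMap.congr_fun (repL _).he v.1)
    (LinearMap.congr_fun (repL _).he v.2)
  hf := LinearMap.ext fun v => Prod.ext (LinearMap.congr_fun (repL _).hf v.1)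
    (LinearMap.congr_fun (repL _).hf v.2)
  ef := LinearMap.ext fun v => Prod.ext (LinearMap.congr_fun (repL _).ef v.1)
    (LinearMap.congr_fun (repL _).ef v.2)
  xe := LinearMap.ext fun v => Prod.ext (by simp) (by simp [dX_eL])
  ye := LinearMap.ext fun v => Prod.ext (by simp) (by simp [dY_eL])
  xf := LinearMap.ext fun v => Prod.ext (by simp) (by simp [dX_fL])
  yf := LinearMap.ext fun v => Prod.ext (by simp) (by simp [dY_fL])
  xx := LinearMap.ext fun v => Prod.ext (by simp) (by simp)
  yy := LinearMap.ext fun v => Prod.ext (by simp) (by simp)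
  yx := LinearMap.ext fun v => Prod.ext (by simp) (by simp)

/-- The data of the projective module attached to an `sl₂`-representation: its tensor product with
the exterior algebra, in the basis `1, x, y, xy`. -/
def dataP {V : Type} [AddCommGroup V] [Module ℂ V] (L : Sl2Data V) :
    SlData ((V × V) × (V × V)) where
  e :=
    { toFun := fun d => ((L.e d.1.1, L.e d.1.2), (L.e d.2.1, L.e d.2.2 - d.2.1))
      map_add' := fun a b => by ext <;> simp; abel
      map_smul' := fun c a => by ext <;> simp [smul_sub] }
  f :=
    { toFun := fun d => ((L.f d.1.1, L.f d.1.2), (L.f d.2.1 - d.2.2, L.f d.2.2))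
      map_add' := fun a b => by ext <;> simp; abel
      map_smul' := fun c a => by ext <;> simp [smul_sub] }
  h :=
    { toFun := fun d => ((L.h d.1.1, L.h d.1.2),
        (L.h d.2.1 - (1 / 2 : ℂ) • d.2.1, L.h d.2.2 + (1 / 2 : ℂ) • d.2.2))
      map_add' := fun a b => by ext <;> simp <;> abel
      map_smul' := fun c a => by ext <;> simp [smul_sub, smul_comm c] }
  x :=
    { toFun := fun d => ((0, d.2.2), (d.1.1, 0))
      map_add' := fun a b => by ext <;> simp
      map_smul' := fun c a => by ext <;> simp }
  y :=
    { toFun := fun d => ((0, -d.2.1), (0, d.1.1))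
      map_add' := fun a b => by ext <;> simp; abel
      map_smul' := fun c a => by ext <;> simp }
  he := by
    have h1 := fun v => LinearMap.congr_fun L.he v
    simp only [LinearMap.sub_apply, Module.End.mul_apply] at h1
    refine LinearMap.ext fun d => Prod.ext (Prod.ext ?_ ?_) (Prod.ext ?_ ?_)
    · exact h1 _
    · exact h1 _
    · have := h1 d.2.1
      simp only [LinearMap.sub_apply, Module.End.mul_apply, LinearMap.coe_mk, AddHom.coe_mk,
        Prod.fst_sub, Prod.snd_sub, map_sub, map_smul]
      rw [sub_eq_iff_eq_add] at this
      rw [this]; module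
    · have := h1 d.2.2
      simp only [LinearMap.sub_apply, Module.End.mul_apply, LinearMap.coe_mk, AddHom.coe_mk,
        Prod.snd_sub, map_sub, map_add, map_smul]
      rw [sub_eq_iff_eq_add] at this
      rw [this]; module
  hf := by
    have h1 := fun v => LinearMap.congr_fun L.hf v
    simp only [LinearMap.sub_apply, Module.End.mul_apply, LinearMap.neg_apply] at h1
    refine LinearMap.ext fun d => Prod.ext (Prod.ext ?_ ?_) (Prod.ext ?_ ?_)
    · exact h1 _
    · exact h1 _
    · have := h1 d.2.1
      simp only [LinearMap.sub_apply, Module.End.mul_apply, LinearMap.coe_mk, AddHom.coe_mk,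
        Prod.fst_sub, Prod.snd_sub, map_sub, map_smul, LinearMap.neg_apply, Prod.fst_neg,
        Prod.snd_neg]
      rw [sub_eq_iff_eq_add] at this
      rw [this]; module
    · have := h1 d.2.2
      simp only [LinearMap.sub_apply, Module.End.mul_apply, LinearMap.coe_mk, AddHom.coe_mk,
        Prod.snd_sub, map_add, map_smul, LinearMap.neg_apply, Prod.snd_neg]
      rw [sub_eq_iff_eq_add] at this
      rw [this]; module
  ef := by
    have h1 := fun v => LinearMap.congr_fun L.ef v
    simp only [LinearMap.sub_apply, Module.End.mul_apply, LinearMap.smul_apply] at h1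
    refine LinearMap.ext fun d => Prod.ext (Prod.ext ?_ ?_) (Prod.ext ?_ ?_)
    · exact h1 _
    · exact h1 _
    · have := h1 d.2.1
      simp only [LinearMap.sub_apply, Module.End.mul_apply, LinearMap.coe_mk, AddHom.coe_mk,
        Prod.fst_sub, Prod.snd_sub, map_sub, LinearMap.smul_apply, Prod.smul_fst,
        Prod.smul_snd]
      rw [sub_eq_iff_eq_add] at this
      rw [this]; module
    · have := h1 d.2.2
      simp only [LinearMap.sub_apply, Module.End.mul_apply, LinearMap.coe_mk, AddHom.coe_mk,
        Prod.snd_sub, map_sub, LinearMap.smul_apply, Prod.smul_snd]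
      rw [sub_eq_iff_eq_add] at this
      rw [this]; module
  xe := LinearMap.ext fun d => by ext <;> simp
  ye := LinearMap.ext fun d => by ext <;> simp
  xf := LinearMap.ext fun d => by ext <;> simp
  yf := LinearMap.ext fun d => by ext <;> simp
  xx := LinearMap.ext fun d => by ext <;> simp
  yy := LinearMap.ext fun d => by ext <;> simp
  yx := LinearMap.ext fun d => by ext <;> simp

end WeightData

/-! ### The submodule of functions graded by the two arcs of the cycle. -/

section Graded

variable {p : ℕ}

section Restrict

variable {V : Type} [AddCommGroup V] [Module ℂ V] {a : Gen → Module.End ℂ V}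

lemma repOf_mem (h : IsRep p a) (Q : Submodule ℂ V) (hQ : ∀ g, ∀ v ∈ Q, a g v ∈ Q) (x : LU p) :
    ∀ v ∈ Q, repOf h x v ∈ Q := by
  induction x using LU.induction with
  | hc c => intro v hv; rw [AlgHom.commutes]; exact Q.smul_mem c hv
  | hg g => intro v hv; rw [repOf_gen]; exact hQ g v hv
  | hmul x y hx hy => intro v hv; rw [map_mul]; exact hx _ (hy _ hv)
  | hadd x y hx hy => intro v hv; rw [map_add]; exact Q.add_mem (hx _ hv) (hy _ hv)

/-- The restrictions of operators to an invariant subspace satisfy the relations. -/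
lemma IsRep.restrict (h : IsRep p a) (Q : Submodule ℂ V) (hQ : ∀ g, ∀ v ∈ Q, a g v ∈ Q) :
    IsRep p fun g => (a g).restrict (hQ g) := by
  intro x y hxy
  -- Restriction of the whole representation gives a homomorphism from the algebra, so no relation
  -- has to be rechecked.
  let φ : LU p →ₐ[ℂ] Module.End ℂ Q := AlgHom.ofLinearMap
    { toFun := fun x => (repOf h x).restrict (repOf_mem h Q hQ x)
      map_add' := fun x y => by ext; simp
      map_smul' := fun c x => by ext; simp }
    (by ext; simp) (fun x y => by ext; simp)
  have hφ : φ ∘ gen p = fun g => (a g).restrict (hQ g) := by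
    funext g; ext v
    exact congrArg (fun T => T v.1) (repOf_gen h g)
  exact eq_of_rel φ (hφ ▸ hxy)

end Restrict

variable {A B : Type} [AddCommGroup A] [Module ℂ A] [AddCommGroup B] [Module ℂ B]

/-- The two summands of `A × B`. -/
def par : Bool → Submodule ℂ (A × B)
  | true => LinearMap.ker (LinearMap.snd ℂ A B)
  | false => LinearMap.ker (LinearMap.fst ℂ A B)

lemma mem_par_true {v : A × B} : v ∈ par true ↔ v.2 = 0 := Iff.rfl

lemma mem_par_false {v : A × B} : v ∈ par false ↔ v.1 = 0 := Iff.rfl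

/-- The operators `e, f` are even and `x, y` are odd for the decomposition of `A × B`. -/
structure SlData.IsGraded (S : SlData (A × B)) : Prop where
  he : ∀ b, ∀ v ∈ par b, S.e v ∈ par b
  hf : ∀ b, ∀ v ∈ par b, S.f v ∈ par b
  hx : ∀ b, ∀ v ∈ par b, S.x v ∈ par !b
  hy : ∀ b, ∀ v ∈ par b, S.y v ∈ par !b

lemma SlData.IsGraded.hh {S : SlData (A × B)} (hS : S.IsGraded) (b : Bool) (v : A × B)
    (hv : v ∈ par b) : S.h v ∈ par b := by
  have h1 := LinearMap.congr_fun S.ef v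
  have h2 : S.h v = (1 / 2 : ℂ) • ((2 : ℂ) • S.h v) := by rw [smul_smul]; norm_num
  rw [h2, ← LinearMap.smul_apply 2 S.h, ← h1]
  rw [LinearMap.sub_apply, Module.End.mul_apply, Module.End.mul_apply]
  refine Submodule.smul_mem _ _ ?_
  exact Submodule.sub_mem _ (hS.he _ _ (hS.hf _ _ hv)) (hS.hf _ _ (hS.he _ _ hv))

variable (A B) in
/-- The graded functions on `ZMod p`. -/
def grd (p s : ℕ) : Submodule ℂ (ZMod p → A × B) where
  carrier := {φ | ∀ n, φ n ∈ par (decide (n.val < s))}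
  add_mem' h h' n := (par _).add_mem (h n) (h' n)
  zero_mem' _ := (par _).zero_mem
  smul_mem' c _ h n := (par _).smul_mem c (h n)

variable {α : ℤˣ} {s : ℕ} {S : SlData (A × B)}

/-- The arc changes exactly at a junction, where the odd operators x and y act; hence graded
functions are stable. -/
lemma decide_succ_val_lt (hs1 : 1 ≤ s) (hs : s < p) (n : ZMod p) :
    decide ((n + 1).val < s) =
      if Junction s (n + 1) then !decide (n.val < s) else decide (n.val < s) := by
  have : NeZero p := ⟨by omega⟩
  obtain ⟨k, hk, rfl⟩ := exists_natCast n
  by_cases h : k + 1 < p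
  · have e : ((k : ZMod p) + 1) = ((k + 1 : ℕ) : ZMod p) := by push_cast; rfl
    rw [e, ZMod.val_cast_of_lt h, ZMod.val_cast_of_lt hk,
      if_congr ((junction_natCast h hs).trans (by omega : _ ↔ k + 1 = s)) rfl rfl]
    split_ifs
    · rw [← decide_not, decide_eq_decide]; omega
    · rw [decide_eq_decide]; omega
  · have e : ((k : ZMod p) + 1) = 0 := by
      have : ((k + 1 : ℕ) : ZMod p) = 0 := by
        rw [show k + 1 = p by omega, ZMod.natCast_self]
      rw [← this]; push_cast; rfl
    rw [e, if_pos junction_zero, ZMod.val_zero, ZMod.val_cast_of_lt hk, ← decide_not,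
        decide_eq_decide]
    omega

lemma opX_mem (hS : S.IsGraded) (hs1 : 1 ≤ s) (hs : s < p) (n : ZMod p) {v : A × B}
    (hv : v ∈ par (decide (n.val < s))) :
    opX s S (n + 1) v ∈ par (decide ((n + 1).val < s)) := by
  rw [opX, decide_succ_val_lt hs1 hs]
  split_ifs
  · exact hS.hx _ _ hv
  · exact hv

lemma opY_mem (hS : S.IsGraded) (hp : 2 ≤ p) (hs1 : 1 ≤ s) (hs : s < p) (n : ZMod p) {v : A × B}
    (hv : v ∈ par (decide ((n + 1).val < s))) :
    opY α s S (n + 1) v ∈ par (decide (n.val < s)) := by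
  rw [decide_succ_val_lt hs1 hs] at hv
  rw [opY, opZ]
  split_ifs at hv ⊢ with h
  · rw [co_junction hp h, zero_smul, zero_add]
    simpa using Submodule.smul_mem _ (eta p α s (n + 1)) (hS.hy _ _ hv)
  · refine Submodule.add_mem _ (Submodule.smul_mem _ _ hv) (Submodule.smul_mem _ _ ?_)
    simpa using hS.hx _ _ (hS.hy _ _ hv)

lemma actT_mem (hS : S.IsGraded) (hp : 2 ≤ p) (hs1 : 1 ≤ s) (hs : s < p) (g : Gen) :
    ∀ φ ∈ grd A B p s, actT (p := p) α s S g φ ∈ grd A B p s := by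
  intro φ hφ n
  cases g
  · exact opY_mem hS hp hs1 hs n (hφ _)
  · have := opX_mem hS hs1 hs (n - 1) (hφ (n - 1))
    rw [sub_add_cancel] at this
    rwa [actT_F]
  · rw [actT_K]; exact Submodule.smul_mem _ _ (hφ n)
  · rw [actT_Kinv]; exact Submodule.smul_mem _ _ (hφ n)
  · rw [actT_e]; exact hS.he _ _ (hφ n)
  · rw [actT_f]; exact hS.hf _ _ (hφ n)
  · rw [actT_h]; exact hS.hh _ _ (hφ n)

lemma isRep_graded (hS : S.IsGraded) (hp : 2 ≤ p) (hs1 : 1 ≤ s) (hs : s < p) :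
    IsRep p fun g => (actT α s S g).restrict (actT_mem (p := p) (α := α) hS hp hs1 hs g) :=
  (isRep_actT S hp hs1 hs).restrict _ _

lemma isGraded_dataW (r : ℕ) : (dataW r).IsGraded where
  he b v hv := by
    cases b
    · rw [mem_par_false] at hv ⊢; simp [dataW, hv]
    · rw [mem_par_true] at hv ⊢; simp [dataW, hv]
  hf b v hv := by
    cases b
    · rw [mem_par_false] at hv ⊢; simp [dataW, hv]
    · rw [mem_par_true] at hv ⊢; simp [dataW, hv]
  hx b v hv := by
    cases b
    · rw [mem_par_false] at hv; rw [Bool.not_false, mem_par_true]; simp [dataW, hv]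
    · rw [Bool.not_true, mem_par_false]; simp [dataW]
  hy b v hv := by
    cases b
    · rw [mem_par_false] at hv; rw [Bool.not_false, mem_par_true]; simp [dataW, hv]
    · rw [Bool.not_true, mem_par_false]; simp [dataW]

lemma isGraded_dataP {V : Type} [AddCommGroup V] [Module ℂ V] (L : Sl2Data V) :
    (dataP L).IsGraded where
  he b v hv := by
    cases b
    · rw [mem_par_false] at hv ⊢; simp [dataP, hv]
    · rw [mem_par_true] at hv ⊢; simp [dataP, hv]
  hf b v hv := by
    cases b
    · rw [mem_par_false] at hv ⊢; simp [dataP, hv]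
    · rw [mem_par_true] at hv ⊢; simp [dataP, hv]
  hx b v hv := by
    cases b
    · rw [mem_par_false] at hv; rw [Bool.not_false, mem_par_true]; simp [dataP, hv]
    · rw [mem_par_true] at hv; rw [Bool.not_true, mem_par_false]; simp [dataP, hv]
  hy b v hv := by
    cases b
    · rw [mem_par_false] at hv; rw [Bool.not_false, mem_par_true]; simp [dataP, hv]
    · rw [mem_par_true] at hv; rw [Bool.not_true, mem_par_false]; simp [dataP, hv]

end Graded

/-! ### Rotation of the cycle and short exact sequences of modules. -/

section Sequences

variable {p : ℕ}

section Shift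

variable {A B A' B' : Type} [AddCommGroup A] [Module ℂ A] [AddCommGroup B] [Module ℂ B]
  [AddCommGroup A'] [Module ℂ A'] [AddCommGroup B'] [Module ℂ B']

/-- Homomorphisms between the data of two modules. -/
structure SlData.IsHom {D D' : Type} [AddCommGroup D] [Module ℂ D] [AddCommGroup D'] [Module ℂ D']
    (S : SlData D) (S' : SlData D') (g : D →ₗ[ℂ] D') : Prop where
  he : ∀ v, g (S.e v) = S'.e (g v)
  hf : ∀ v, g (S.f v) = S'.f (g v)
  hx : ∀ v, g (S.x v) = S'.x (g v)
  hy : ∀ v, g (S.y v) = S'.y (g v)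

lemma SlData.IsHom.hh {D D' : Type} [AddCommGroup D] [Module ℂ D] [AddCommGroup D'] [Module ℂ D']
    {S : SlData D} {S' : SlData D'} {g : D →ₗ[ℂ] D'} (hg : S.IsHom S' g) (v : D) :
    g (S.h v) = S'.h (g v) := by
  have h1 := LinearMap.congr_fun S.ef v
  have h2 := LinearMap.congr_fun S'.ef (g v)
  simp only [LinearMap.sub_apply, Module.End.mul_apply, LinearMap.smul_apply] at h1 h2
  rw [← smul_right_inj (two_ne_zero : (2 : ℂ) ≠ 0), ← h2, ← map_smul, ← h1, map_sub, hg.he, hg.hf,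
    hg.hf, hg.he]

variable (p) in
/-- The shift by `c` identifies the combinatorial parameters of two types. -/
structure Matches (c : ZMod p) (α' : ℤˣ) (s' : ℕ) (α : ℤˣ) (s : ℕ) : Prop where
  kap : ∀ n : ZMod p, kap p α' s' (n + c) = kap p α s n
  co : ∀ n : ZMod p, co p α' s' (n + c) = co p α s n
  eta : ∀ n : ZMod p, eta p α' s' (n + c) = eta p α s n
  junction : ∀ n : ZMod p, Junction s' (n + c) ↔ Junction s n

lemma Matches.refl (α : ℤˣ) (s : ℕ) : Matches p 0 α s α s :=
  ⟨fun n => by rw [add_zero], fun n => by rw [add_zero], fun n => by rw [add_zero],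
    fun n => by rw [add_zero]⟩

lemma val_sub_self_lt {s : ℕ} (hs : s < p) (n : ZMod p) :
    decide ((n + -(s : ZMod p)).val < p - s) = !decide (n.val < s) := by
  have : NeZero p := ⟨by omega⟩
  obtain ⟨k, hk, rfl⟩ := exists_natCast n
  rw [← decide_not, decide_eq_decide, ZMod.val_cast_of_lt hk]
  by_cases h : k < s
  · have e : (k : ZMod p) + -(s : ZMod p) = ((k + p - s : ℕ) : ZMod p) := by
      rw [Nat.cast_sub (by omega)]; push_cast; simp; ring
    rw [e, ZMod.val_cast_of_lt (by omega)]; omega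
  · have e : (k : ZMod p) + -(s : ZMod p) = ((k - s : ℕ) : ZMod p) := by
      rw [Nat.cast_sub (by omega)]; ring
    rw [e, ZMod.val_cast_of_lt (by omega)]; omega

/-- The two types of a block give the same cycle read from its two junctions. Since q^p = −1,
rotation by s identifies the K-weights; the Casimir eigenvalues agree, so `co_eq` identifies the
coefficients. The arcs are exchanged and `dlt` changes sign, which preserves `eta`. -/
lemma matches_neg (hp : 2 ≤ p) {s : ℕ} (hs : s < p) (α : ℤˣ) :
    Matches p (-(s : ZMod p)) (-α) (p - s) α s := by
  have : NeZero p := ⟨by omega⟩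
  have hk : ∀ n : ZMod p, kap p (-α) (p - s) (n + -(s : ZMod p)) = kap p α s n := by
    intro n
    obtain ⟨k, hk, rfl⟩ := exists_natCast n
    have e : (k : ZMod p) + -(s : ZMod p) = ((k + p - s : ℕ) : ZMod p) := by
      rw [Nat.cast_sub (by omega)]; push_cast; simp; ring
    rw [e, kap_natCast _ _ hp, kap_natCast _ _ hp, sgn_neg]
    have : ((p - s : ℕ) : ℤ) - 1 - 2 * (k + p - s : ℕ) = ((s : ℤ) - 1 - 2 * k) + -p := by
      rw [Nat.cast_sub (by omega), Nat.cast_sub (by omega)]; push_cast; ring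
    rw [this, zpow_add₀ q_ne_zero, q_zpow_neg_p hp]; ring
  have hc : cas p (-α) (p - s) = cas p α s := by
    rw [cas, cas, Nat.cast_sub hs.le, neg_sub, sub_eq_add_neg, sub_eq_add_neg,
      zpow_add₀ q_ne_zero, zpow_add₀ q_ne_zero, q_zpow_p hp, q_zpow_neg_p hp, sgn_neg]
    ring
  refine ⟨hk, fun n => ?_, fun n => ?_, fun n => ?_⟩
  · have h := q_sub_ne_zero hp
    have h1 := co_eq (-α) (p - s) hp (n + -(s : ZMod p))
    have h2 := co_eq α s hp n
    rw [hk, hc, ← h2] at h1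
    exact mul_left_cancel₀ (pow_ne_zero 2 h) h1
  · have hd : dlt p (-α) (p - s) = -dlt p α s := by
      have : qNum p ((p - s : ℕ) : ℤ) = qNum p s := by
        rw [Nat.cast_sub hs.le, ← neg_sub, qNum_neg, qNum_sub_p hp, neg_neg]
      rw [dlt, dlt, this, sgn_neg]; ring
    have h := val_sub_self_lt hs n
    rw [← decide_not, decide_eq_decide] at h
    rw [eta, eta, hd, if_congr h rfl rfl, ite_not, neg_neg]
  · have e : ((p - s : ℕ) : ZMod p) = -(s : ZMod p) := by
      rw [Nat.cast_sub hs.le]; simp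
    rw [Junction, Junction, e, or_comm]
    refine or_congr ⟨fun h => by simpa using h, fun h => by simp [h]⟩
      ⟨fun h => by rwa [add_neg_eq_zero] at h, fun h => by simp [h]⟩

/-- The type enters the operators only through the four parameters compared by `Matches`. -/
lemma actT_shift {D D' : Type} [AddCommGroup D] [Module ℂ D] [AddCommGroup D'] [Module ℂ D']
    {S : SlData D} {S' : SlData D'} {g : D' →ₗ[ℂ] D} (hg : S'.IsHom S g) {c : ZMod p} {α' : ℤˣ}
    {s' : ℕ} {α : ℤˣ} {s : ℕ} (hm : Matches p c α' s' α s) (G : Gen) (φ : ZMod p → D')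
    (n : ZMod p) :
    g (actT α' s' S' G φ (n + c)) = actT α s S G (fun n => g (φ (n + c))) n := by
  cases G
  · rw [actT_E, actT_E, opY, opY, opZ, opZ, add_right_comm n c 1, hm.co, hm.eta,
      if_congr (hm.junction _) rfl rfl]
    split_ifs <;> simp [hg.hx, hg.hy]
  · rw [actT_F, actT_F, opX, opX, if_congr (hm.junction _) rfl rfl, add_sub_right_comm]
    split_ifs <;> simp [hg.hx]
  · rw [actT_K, actT_K, map_smul, hm.kap]
  · rw [actT_Kinv, actT_Kinv, map_smul, hm.kap]
  · rw [actT_e, actT_e, hg.he]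
  · rw [actT_f, actT_f, hg.hf]
  · rw [actT_h, actT_h, hg.hh]

/-- The linear map on graded functions induced by a linear map of the values and a shift. -/
def shiftMap (g : A' × B' →ₗ[ℂ] A × B) (c : ZMod p) {s' s : ℕ}
    (hpar : ∀ n : ZMod p, ∀ v ∈ par (decide ((n + c).val < s')), g v ∈ par (decide (n.val < s))) :
    grd A' B' p s' →ₗ[ℂ] grd A B p s where
  toFun φ := ⟨fun n => g (φ.1 (n + c)), fun n => hpar n _ (φ.2 _)⟩
  map_add' φ ψ := by ext n <;> simp
  map_smul' a φ := by ext n <;> simp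

lemma shiftMap_apply (g : A' × B' →ₗ[ℂ] A × B) (c : ZMod p) {s' s : ℕ}
    (hpar : ∀ n : ZMod p, ∀ v ∈ par (decide ((n + c).val < s')), g v ∈ par (decide (n.val < s)))
    (φ : grd A' B' p s') (n : ZMod p) : (shiftMap g c hpar φ).1 n = g (φ.1 (n + c)) := rfl

variable [NeZero p]

instance [Module.Finite ℂ A] [Module.Finite ℂ B] (s : ℕ) : Module.Finite ℂ (grd A B p s) :=
  inferInstance

/-- The finite-dimensional module of graded functions on `ZMod p`. -/
def gMod [Module.Finite ℂ A] [Module.Finite ℂ B] {S : SlData (A × B)} (hS : S.IsGraded)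
    (hp : 2 ≤ p) (α : ℤˣ) {s : ℕ} (hs1 : 1 ≤ s) (hs : s < p) : FDMod p :=
  modOf (isRep_graded (α := α) hS hp hs1 hs)

/-- Short exact sequences of data give short exact sequences of modules. -/
lemma shortExact_gMod {A'' B'' : Type} [AddCommGroup A''] [Module ℂ A''] [AddCommGroup B'']
    [Module ℂ B''] [Module.Finite ℂ A] [Module.Finite ℂ B] [Module.Finite ℂ A']
    [Module.Finite ℂ B'] [Module.Finite ℂ A''] [Module.Finite ℂ B''] {S : SlData (A × B)}
    (hS : S.IsGraded) {S' : SlData (A' × B')} (hS' : S'.IsGraded) {S'' : SlData (A'' × B'')}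
    (hS'' : S''.IsGraded) (hp : 2 ≤ p) (α : ℤˣ) {s : ℕ} (hs1 : 1 ≤ s) (hs : s < p)
    {g : A' × B' →ₗ[ℂ] A × B} (hg : S'.IsHom S g) (hg' : ∀ b v, g v ∈ par (!b) ↔ v ∈ par b)
    {k : A × B →ₗ[ℂ] A'' × B''} (hk : S.IsHom S'' k) (hk' : ∀ b, ∀ v ∈ par b, k v ∈ par b)
    (h1 : Function.Injective g) (h2 : Function.Exact g k)
    (h3 : ∀ b, ∀ w ∈ par b, ∃ v ∈ par b, k v = w) :
    ∃ (i : gMod hS' hp (-α) (s := p - s) (by omega) (by omega) ⟶ gMod hS hp α hs1 hs)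
      (j : gMod hS hp α hs1 hs ⟶ gMod hS'' hp α hs1 hs) (w : i ≫ j = 0),
      (ShortComplex.mk i j w).ShortExact := by
  -- The map g is odd; the rotation by −s, which exchanges the arcs, makes it compatible with the
  -- grading.
  have hpg : ∀ n : ZMod p, ∀ v, v ∈ par (decide ((n + -(s : ZMod p)).val < p - s)) ↔
      g v ∈ par (decide (n.val < s)) := fun n v => by
    rw [val_sub_self_lt hs, ← hg', Bool.not_not]
  have hpk : ∀ n : ZMod p, ∀ v ∈ par (decide ((n + 0).val < s)), k v ∈ par (decide (n.val < s)) :=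
    fun n v hv => by rw [add_zero] at hv; exact hk' _ _ hv
  refine shortExact_of (shiftMap g (-(s : ZMod p)) fun n v => (hpg n v).1) ?_ (shiftMap k 0 hpk) ?_
      ?_ ?_ ?_
  · exact fun G φ => Subtype.ext (funext fun n => actT_shift hg (matches_neg hp hs α) G φ.1 n)
  · exact fun G φ => Subtype.ext (funext fun n => by
      have := actT_shift hk (Matches.refl (p := p) α s) G φ.1 n
      simpa [shiftMap] using this)
  · intro φ ψ h
    refine Subtype.ext (funext fun n => h1 ?_)
    have := congrFun (congrArg Subtype.val h) (n + s)
    simpa [shiftMap_apply] using this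
  · intro φ
    constructor
    · intro h
      have h' : ∀ n, ∃ v, g v = φ.1 n := fun n => by
        have := congrFun (congrArg Subtype.val h) n
        rw [shiftMap_apply, add_zero] at this
        exact (h2 _).1 this
      choose u hu using h'
      refine ⟨⟨fun n => u (n + s), fun n => ?_⟩, ?_⟩
      · have h4 := hpg (n + s) (u (n + s))
        rw [hu, add_neg_cancel_right] at h4
        exact h4.2 (φ.2 _)
      · refine Subtype.ext (funext fun n => ?_)
        rw [shiftMap_apply]
        simp [hu]
    · rintro ⟨u, rfl⟩
      refine Subtype.ext (funext fun n => ?_)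
      exact (h2 _).2 ⟨_, rfl⟩
  · intro φ
    choose u hu hu' using fun n : ZMod p => h3 _ _ (φ.2 n)
    refine ⟨⟨u, hu⟩, Subtype.ext (funext fun n => ?_)⟩
    rw [shiftMap_apply, add_zero, hu']

end Shift

end Sequences

/-! ### The modules X, W, P and their exact sequences, from the de Rham complex in two variables. -/

section Concrete

variable {p : ℕ}

/-- The data of the irreducible modules. -/
def dataX (r : ℕ) : SlData ((Fin r → ℂ) × PUnit.{1}) where
  e := (eL _).prodMap 0
  f := (fL _).prodMap 0
  h := (hL _).prodMap 0
  x := 0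
  y := 0
  he := LinearMap.ext fun v => Prod.ext (LinearMap.congr_fun (repL _).he v.1) rfl
  hf := LinearMap.ext fun v => Prod.ext (LinearMap.congr_fun (repL _).hf v.1) rfl
  ef := LinearMap.ext fun v => Prod.ext (LinearMap.congr_fun (repL _).ef v.1) rfl
  xe := by simp
  ye := by simp
  xf := by simp
  yf := by simp
  xx := by simp
  yy := by simp
  yx := by simp

lemma isGraded_dataX (r : ℕ) : (dataX r).IsGraded where
  he b v hv := by
    cases b
    · rw [mem_par_false] at hv ⊢; simp [dataX, hv]
    · rw [mem_par_true]
  hf b v hv := by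
    cases b
    · rw [mem_par_false] at hv ⊢; simp [dataX, hv]
    · rw [mem_par_true]
  hx b v hv := Submodule.zero_mem _
  hy b v hv := Submodule.zero_mem _

/-- The inclusion of data `W → P`. -/
def inclWP (r : ℕ) : (Fin (r + 1 + 1) → ℂ) × (Fin (r + 1) → ℂ) →ₗ[ℂ]
    ((Fin (r + 1) → ℂ) × (Fin (r + 1) → ℂ)) × ((Fin (r + 1) → ℂ) × (Fin (r + 1) → ℂ)) where
  toFun v := ((0, -v.2), (dY _ v.1, -dX _ v.1))
  map_add' u v := by ext <;> simp <;> ring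
  map_smul' c v := by ext <;> simp

/-- The projection of data `P → W`. -/
def projPW (r : ℕ) : ((Fin (r + 1) → ℂ) × (Fin (r + 1) → ℂ)) × ((Fin (r + 1) → ℂ) ×
    (Fin (r + 1) → ℂ)) →ₗ[ℂ] (Fin (r + 1) → ℂ) × (Fin r → ℂ) where
  toFun v := (v.1.1, dX r v.2.1 + dY r v.2.2)
  map_add' u v := by ext <;> simp; ring
  map_smul' c v := by ext <;> simp

/-- The inclusion of data `X → W`. -/
def inclXW (r : ℕ) : (Fin r → ℂ) × PUnit.{1} →ₗ[ℂ] (Fin (r + 1) → ℂ) × (Fin r → ℂ) :=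
  LinearMap.inr ℂ _ _ ∘ₗ LinearMap.fst ℂ _ _

/-- The projection of data `W → X`. -/
def projWX (r : ℕ) : (Fin (r + 1) → ℂ) × (Fin r → ℂ) →ₗ[ℂ] (Fin (r + 1) → ℂ) × PUnit.{1} :=
  LinearMap.inl ℂ _ _ ∘ₗ LinearMap.fst ℂ _ _

lemma isHom_inclWP (r : ℕ) : (dataW (r + 1)).IsHom (dataP (repL (r + 1))) (inclWP r) where
  he v := by simp [dataW, dataP, inclWP, repL, dX_eL, dY_eL]; abel
  hf v := by simp [dataW, dataP, inclWP, repL, dX_fL, dY_fL]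
  hx v := by simp [dataW, dataP, inclWP]
  hy v := by simp [dataW, dataP, inclWP]

lemma dX_dY (r : ℕ) (a : Fin (r + 1 + 1) → ℂ) : dX r (dY _ a) = dY r (dX _ a) := by
  refine ext_cf fun k hk => ?_
  rw [cf_dX hk, cf_dY, cf_dY, cf_dX (by omega)]

lemma isHom_projPW (r : ℕ) : (dataP (repL (r + 1))).IsHom (dataW r) (projPW r) where
  he v := by simp [dataW, dataP, projPW, repL, dX_eL, dY_eL]
  hf v := by simp [dataW, dataP, projPW, repL, dX_fL, dY_fL]
  hx v := by simp [dataW, dataP, projPW]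
  hy v := by simp [dataW, dataP, projPW]

lemma isHom_inclXW (r : ℕ) : (dataX r).IsHom (dataW r) (inclXW r) where
  he v := by simp [dataW, dataX, inclXW]
  hf v := by simp [dataW, dataX, inclXW]
  hx v := by simp [dataW, dataX, inclXW]
  hy v := by simp [dataW, dataX, inclXW]

lemma isHom_projWX (r : ℕ) : (dataW r).IsHom (dataX (r + 1)) (projWX r) where
  he v := by simp [dataW, dataX, projWX]
  hf v := by simp [dataW, dataX, projWX]
  hx v := by simp [dataW, dataX, projWX]
  hy v := by simp [dataW, dataX, projWX]

/-- The vector with given first and remaining coordinates. -/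
lemma exists_dY_eq {r : ℕ} (a : Fin r → ℂ) : ∃ b : Fin (r + 1) → ℂ, dY r b = a := by
  -- Coordinate 0 gets the value 0 from the inverse of zero; it is immaterial, because `dY` does not
  -- read it.
  refine ⟨fun k => (k : ℂ)⁻¹ * cf r (k - 1) a, ext_cf fun k hk => ?_⟩
  have : (k : ℂ) + 1 ≠ 0 := by exact_mod_cast k.succ_ne_zero
  rw [cf_dY, cf_of_lt (by omega)]
  push_cast
  field_simp

lemma exists_dX_eq {r : ℕ} (a : Fin r → ℂ) : ∃ b : Fin (r + 1) → ℂ, dX r b = a := by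
  refine ⟨fun k => cf r k a, ext_cf fun k hk => ?_⟩
  rw [cf_dX hk, cf_of_lt (by omega)]

/-- A closed form on the plane is exact. -/
lemma exists_potential {r : ℕ} {c d : Fin (r + 1) → ℂ} (h : dX r c + dY r d = 0) :
    ∃ w : Fin (r + 1 + 1) → ℂ, dY _ w = c ∧ dX _ w = -d := by
  obtain ⟨w, hw⟩ := exists_dY_eq c
  have h1 : dY r (dX _ w + d) = 0 := by rw [map_add, ← dX_dY, hw, h]
  have h2 : ∀ k < r, cf (r + 1) (k + 1) (dX _ w + d) = 0 := fun k hk => by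
    have := congrArg (cf r k) h1
    rw [cf_dY, map_zero] at this
    exact (mul_eq_zero.1 this).resolve_left (by exact_mod_cast k.succ_ne_zero)
  -- The antiderivative w of c in the second variable misses the second equation by an element of
  -- the kernel of `dY`, which is concentrated in coordinate 0. The correction δ removes it without
  -- changing `dY`.
  let δ : Fin (r + 1 + 1) → ℂ := fun k => if (k : ℕ) = 0 then cf (r + 1) 0 (dX _ w + d) else 0
  have hδ : ∀ k < r + 1 + 1, cf (r + 1 + 1) k δ =
      if k = 0 then cf (r + 1) 0 (dX _ w + d) else 0 := fun k hk => by rw [cf_of_lt hk]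
  refine ⟨w - δ, ?_, ?_⟩
  · rw [map_sub, hw, sub_eq_self]
    refine ext_cf fun k hk => ?_
    rw [cf_dY, hδ _ (by omega)]; simp
  · rw [map_sub, sub_eq_iff_eq_add, neg_add_eq_sub, eq_sub_iff_add_eq]
    refine ext_cf fun k hk => ?_
    rw [cf_dX hk, hδ _ (by omega)]
    rcases k with _ | k
    · simp
    · rw [h2 k (by omega)]; simp

/-- A form of positive degree with vanishing partial derivatives is zero; the degree here is r + 1.
-/
lemma eq_zero_of_dX_dY {r : ℕ} {w : Fin (r + 1 + 1) → ℂ} (hX : dX _ w = 0) (hY : dY _ w = 0) :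
    w = 0 := by
  refine ext_cf fun k hk => ?_
  rw [map_zero]
  rcases k with _ | k
  · rw [← cf_dX (by omega), hX, map_zero]
  · have := cf_dY (r + 1) k w
    rw [hY, map_zero] at this
    exact (mul_eq_zero.1 this.symm).resolve_left (by exact_mod_cast k.succ_ne_zero)

/-- The kernel consists of a free component and of the closed forms, which are exact by
`exists_potential`. -/
lemma exact_WPW (r : ℕ) : Function.Exact (inclWP r) (projPW r) := by
  rintro ⟨⟨b, a⟩, ⟨c, d⟩⟩
  constructor
  · intro h
    have h1 : b = 0 := congrArg Prod.fst h
    have h2 : dX r c + dY r d = 0 := congrArg Prod.snd h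
    obtain ⟨w, hw1, hw2⟩ := exists_potential h2
    exact ⟨(w, -a), by simp [inclWP, hw1, hw2, h1]⟩
  · rintro ⟨⟨w, v⟩, h⟩
    rw [← h]
    simp [inclWP, projPW, dX_dY]

lemma injective_inclWP (r : ℕ) : Function.Injective (inclWP r) := by
  rw [injective_iff_map_eq_zero]
  rintro ⟨w, v⟩ h
  simp only [inclWP, LinearMap.coe_mk, AddHom.coe_mk, Prod.mk_eq_zero, neg_eq_zero, true_and] at h
  rw [h.1, eq_zero_of_dX_dY h.2.2 h.2.1]; rfl

lemma inclWP_mem (r : ℕ) (b : Bool) (v) : inclWP r v ∈ par (!b) ↔ v ∈ par b := by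
  cases b
  · rw [Bool.not_false, mem_par_true, mem_par_false]
    simp only [inclWP, LinearMap.coe_mk, AddHom.coe_mk, Prod.mk_eq_zero, neg_eq_zero]
    exact ⟨fun h => eq_zero_of_dX_dY h.2 h.1, fun h => by simp [h]⟩
  · rw [Bool.not_true, mem_par_true, mem_par_false]
    simp [inclWP]

lemma projPW_mem (r : ℕ) (b : Bool) (v) (hv : v ∈ par b) : projPW r v ∈ par b := by
  cases b
  · rw [mem_par_false] at hv ⊢; simp [projPW, hv]
  · rw [mem_par_true] at hv ⊢; simp [projPW, hv]

lemma projPW_surj (r : ℕ) (b : Bool) (w) (hw : w ∈ par b) : ∃ v ∈ par b, projPW r v = w := by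
  obtain ⟨w1, w2⟩ := w
  cases b
  · obtain ⟨c, hc⟩ := exists_dX_eq w2
    obtain rfl : w1 = 0 := hw
    exact ⟨((0, 0), (c, 0)), rfl, by simp [projPW, hc]⟩
  · obtain rfl : w2 = 0 := hw
    exact ⟨((w1, 0), (0, 0)), rfl, by simp [projPW]⟩

variable [NeZero p]

/-- The module with top `X^α_{s,r+1}` and socle `X^{-α}_{p-s,r}`. -/
def wMod (hp : 2 ≤ p) (α : ℤˣ) {s : ℕ} (hs1 : 1 ≤ s) (hs : s < p) (r : ℕ) : FDMod p :=
  gMod (isGraded_dataW r) hp α hs1 hs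

/-- The projective cover of `X^α_{s,r+1}`. -/
def pMod (hp : 2 ≤ p) (α : ℤˣ) {s : ℕ} (hs1 : 1 ≤ s) (hs : s < p) (r : ℕ) : FDMod p :=
  gMod (isGraded_dataP (repL (r + 1))) hp α hs1 hs

/-- The irreducible module as a space of graded functions. -/
def xMod (hp : 2 ≤ p) (α : ℤˣ) {s : ℕ} (hs1 : 1 ≤ s) (hs : s < p) (r : ℕ) : FDMod p :=
  gMod (isGraded_dataX r) hp α hs1 hs

lemma shortExact_WPW (hp : 2 ≤ p) (α : ℤˣ) {s : ℕ} (hs1 : 1 ≤ s) (hs : s < p) (r : ℕ) :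
    ∃ (i : wMod hp (-α) (s := p - s) (by omega) (by omega) (r + 1) ⟶ pMod hp α hs1 hs r)
      (j : pMod hp α hs1 hs r ⟶ wMod hp α hs1 hs r) (w : i ≫ j = 0),
      (ShortComplex.mk i j w).ShortExact :=
  shortExact_gMod _ _ _ hp α hs1 hs (isHom_inclWP r) (inclWP_mem r) (isHom_projPW r)
    (projPW_mem r) (injective_inclWP r) (exact_WPW r) (projPW_surj r)

lemma shortExact_XWX (hp : 2 ≤ p) (α : ℤˣ) {s : ℕ} (hs1 : 1 ≤ s) (hs : s < p) (r : ℕ) :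
    ∃ (i : xMod hp (-α) (s := p - s) (by omega) (by omega) r ⟶ wMod hp α hs1 hs r)
      (j : wMod hp α hs1 hs r ⟶ xMod hp α hs1 hs (r + 1)) (w : i ≫ j = 0),
      (ShortComplex.mk i j w).ShortExact := by
  refine shortExact_gMod _ _ _ hp α hs1 hs (isHom_inclXW r) ?_ (isHom_projWX r) ?_ ?_ ?_ ?_
  · rintro (_ | _) v
    · rw [Bool.not_false, mem_par_true, mem_par_false]; simp [inclXW]
    · rw [Bool.not_true, mem_par_true, mem_par_false]; simp [inclXW]
  · rintro (_ | _) v hv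
    · rw [mem_par_false] at hv ⊢; simp [projWX, hv]
    · rw [mem_par_true]
  · rintro ⟨u, _⟩ ⟨v, _⟩ h
    simpa [inclXW] using h
  · rintro ⟨u, v⟩
    constructor
    · intro h
      have h1 : u = 0 := congrArg Prod.fst h
      exact ⟨(v, 0), by simp [inclXW, h1]⟩
    · rintro ⟨w, h⟩
      rw [← h]; simp [inclXW, projWX]
  · rintro (_ | _) ⟨v, _⟩ hv
    · obtain rfl : v = 0 := hv
      exact ⟨0, Submodule.zero_mem _, rfl⟩
    · exact ⟨(v, 0), rfl, rfl⟩

end Concrete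

/-! ### P is generated by its values at the index 0. -/

section Generation

variable {p : ℕ} {D : Type} [AddCommGroup D] [Module ℂ D] {α : ℤˣ} {s : ℕ} (S : SlData D)

lemma actT_E_single (n : ZMod p) (d : D) :
    actT α s S .E (Pi.single n d) = Pi.single (n - 1) (opY α s S n d) := by
  funext m
  rw [actT_E]
  by_cases h : m + 1 = n
  · subst h; rw [add_sub_cancel_right, Pi.single_eq_same, Pi.single_eq_same]
  · rw [Pi.single_eq_of_ne h, Pi.single_eq_of_ne (fun h' => h (by rw [h', sub_add_cancel])),
      map_zero]

lemma actT_F_single (n : ZMod p) (d : D) :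
    actT α s S .F (Pi.single n d) = Pi.single (n + 1) (opX s S (n + 1) d) := by
  funext m
  rw [actT_F]
  by_cases h : m - 1 = n
  · subst h; rw [sub_add_cancel, Pi.single_eq_same, Pi.single_eq_same]
  · rw [Pi.single_eq_of_ne h, Pi.single_eq_of_ne (fun h' => h (by rw [h', add_sub_cancel_right])),
      map_zero]

lemma natCast_pred (hp : 2 ≤ p) : ((p - 1 : ℕ) : ZMod p) = 0 - 1 := by
  rw [Nat.cast_sub (by omega)]; simp

lemma opX_natCast_succ {k : ℕ} (hk : k + 1 < p) (hs : s < p) (h : k + 1 ≠ s) :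
    opX s S ((k : ZMod p) + 1) = 1 := by
  rw [← Nat.cast_succ, opX, if_neg (by rw [junction_natCast hk hs]; omega)]

lemma opX_self (hs1 : 1 ≤ s) : opX s S (((s - 1 : ℕ) : ZMod p) + 1) = S.x := by
  rw [← Nat.cast_succ, Nat.succ_eq_add_one, Nat.sub_add_cancel hs1]
  exact if_pos (Or.inr rfl)

variable {V : Type} [AddCommGroup V] [Module ℂ V] {L : Sl2Data V}

/-- The graded functions with values in the data of the projective module are generated by the
values `1 ⊗ v` at the index `0`. -/
lemma mem_of_generates (hp : 2 ≤ p) (hs1 : 1 ≤ s) (hs : s < p)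
    (Q : Submodule ℂ (ZMod p → (V × V) × (V × V)))
    (hE : ∀ φ ∈ Q, actT α s (dataP L) .E φ ∈ Q) (hF : ∀ φ ∈ Q, actT α s (dataP L) .F φ ∈ Q)
    (h0 : ∀ b : V, (Pi.single 0 ((b, 0), (0, 0)) : ZMod p → (V × V) × (V × V)) ∈ Q) {φ : ZMod p →
        (V × V) × (V × V)}
    (hφ : φ ∈ grd (V × V) (V × V) p s) : φ ∈ Q := by
  have : NeZero p := ⟨by omega⟩
  have up : ∀ (k : ℕ), k + 1 < p → k + 1 ≠ s → ∀ d, (Pi.single (k : ZMod p) d : ZMod p → (V × V) ×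
      (V × V)) ∈ Q →
      (Pi.single ((k + 1 : ℕ) : ZMod p) d : ZMod p → (V × V) × (V × V)) ∈ Q := by
    intro k hk hks d hd
    have := hF _ hd
    rw [actT_F_single, opX_natCast_succ _ hk hs hks] at this
    rwa [Nat.cast_succ]
  have hb : ∀ k < s, ∀ b : V, (Pi.single (k : ZMod p) ((b, 0), (0,
      0)) : ZMod p → (V × V) × (V × V)) ∈ Q := by
    intro k
    induction k with
    | zero => intro _ b; rw [Nat.cast_zero]; exact h0 b
    | succ k ih => exact fun hk b => up k (by omega) (by omega) _ (ih (by omega) b)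
  -- The values are in the basis 1, xy, x, y of the exterior algebra. Crossing the junction s with F
  -- turns 1 into x.
  have hc : ∀ k, s ≤ k → k < p → ∀ c : V, (Pi.single (k : ZMod p) ((0, 0), (c,
      0)) : ZMod p → (V × V) × (V × V)) ∈ Q := by
    intro k hk
    induction k, hk using Nat.le_induction with
    | base =>
      intro _ c
      have := hF _ (hb (s - 1) (by omega) c)
      rw [actT_F_single, opX_self _ hs1, ← Nat.cast_succ, Nat.succ_eq_add_one,
        Nat.sub_add_cancel hs1] at this
      simpa [dataP] using this
    | succ k hk ih => exact fun hk' c => up k hk' (by omega) _ (ih (by omega) c)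
  have hδ : dlt p α s ≠ 0 := div_ne_zero (mul_ne_zero (mul_ne_zero (pow_ne_zero _ (by norm_num))
    (sgn_ne_zero α)) (qNum_natCast_ne_zero hp hs1 hs)) (qFact_ne_zero hp)
  -- Crossing the junction 0 backwards with E turns 1 into a multiple of y. Further applications of
  -- E only multiply by nonzero coefficients, since xy kills the y-component.
  have hd : ∀ j, j < p - s → ∀ d : V,
      (Pi.single ((p - 1 - j : ℕ) : ZMod p) ((0, 0), (0, d)) : ZMod p → (V × V) × (V × V)) ∈ Q := by
    intro j
    induction j with
    | zero =>
      intro _ d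
      have := hE _ (h0 d)
      rw [actT_E_single, opY, opZ, co_junction hp junction_zero, if_pos junction_zero,
        eta_zero hp hs1, zero_smul, zero_add, LinearMap.smul_apply, Pi.single_smul,
        ← natCast_pred hp] at this
      have := (Q.smul_mem_iff hδ).1 this
      simpa [dataP] using this
    | succ j ih =>
      intro hj d
      have := hE _ (ih (by omega) d)
      rw [actT_E_single, opY, opZ, if_neg (by rw [junction_natCast (by omega) hs]; omega)] at this
      have e : ((p - 1 - j : ℕ) : ZMod p) - 1 = ((p - 1 - (j + 1) : ℕ) : ZMod p) := by
        rw [sub_eq_iff_eq_add, ← Nat.cast_succ]; congr 1; omega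
      have hco : co p α s ((p - 1 - j : ℕ) : ZMod p) ≠ 0 :=
        co_natCast_ne_zero α s hp hs (by omega) (by omega) (by omega)
      rw [e] at this
      refine (Q.smul_mem_iff hco).1 ?_
      rw [← Pi.single_smul]
      simpa [dataP] using this
  -- Crossing the junction 0 with F turns y into xy.
  have ha : ∀ k < s, ∀ a : V, (Pi.single (k : ZMod p) ((0, a), (0,
      0)) : ZMod p → (V × V) × (V × V)) ∈ Q := by
    intro k
    induction k with
    | zero =>
      intro _ a
      have := hF _ (hd 0 (by omega) a)
      rw [Nat.sub_zero, actT_F_single, natCast_pred hp, sub_add_cancel, opX,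
          if_pos junction_zero] at this
      simpa [dataP] using this
    | succ k ih => exact fun hk a => up k (by omega) (by omega) _ (ih (by omega) a)
  rw [← Finset.univ_sum_single φ]
  refine Q.sum_mem fun n _ => ?_
  have h := hφ n
  obtain ⟨k, hk, rfl⟩ := exists_natCast n
  rw [ZMod.val_cast_of_lt hk] at h
  generalize φ (k : ZMod p) = v at h ⊢
  obtain ⟨⟨b, a⟩, ⟨c, d⟩⟩ := v
  by_cases hks : k < s
  · rw [decide_eq_true hks, mem_par_true] at h
    have e : (((b, a), (c, d)) : (V × V) × (V × V)) = ((b, 0), (0, 0)) + ((0, a), (0, 0)) := by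
      obtain ⟨rfl, rfl⟩ : c = 0 ∧ d = 0 := Prod.mk_eq_zero.1 h
      simp
    rw [e, Pi.single_add]
    exact Q.add_mem (hb k hks b) (ha k hks a)
  · rw [decide_eq_false hks, mem_par_false] at h
    have e : (((b, a), (c, d)) : (V × V) × (V × V)) = ((0, 0), (c, 0)) + ((0, 0), (0, d)) := by
      obtain ⟨rfl, rfl⟩ : b = 0 ∧ a = 0 := Prod.mk_eq_zero.1 h
      simp
    have h2 := hd (p - 1 - k) (by omega) d
    rw [show p - 1 - (p - 1 - k) = k by omega] at h2
    rw [e, Pi.single_add]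
    exact Q.add_mem (hc k (by omega) hk c) h2

end Generation

/-! ### Identification of the given irreducible modules with graded functions on the cycle. -/

section Coordinates

variable {p : ℕ} {α : ℤˣ} {s r : ℕ}

/-- The coordinates of a vector of the irreducible module, which are zero out of range. -/
def coord (s r n m : ℕ) : (Fin s × Fin r → ℂ) →ₗ[ℂ] ℂ :=
  if h : n < s ∧ m < r then LinearMap.proj (⟨n, h.1⟩, ⟨m, h.2⟩) else 0

lemma coord_of_lt {n m : ℕ} (hn : n < s) (hm : m < r) (a : Fin s × Fin r → ℂ) :
    coord s r n m a = a (⟨n, hn⟩, ⟨m, hm⟩) := by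
  rw [coord, dif_pos ⟨hn, hm⟩]; rfl

lemma coord_of_not {n m : ℕ} (h : ¬ (n < s ∧ m < r)) (a : Fin s × Fin r → ℂ) :
    coord s r n m a = 0 := by
  rw [coord, dif_neg h]; rfl

lemma ext_coord {a b : Fin s × Fin r → ℂ}
    (h : ∀ n m, n < s → m < r → coord s r n m a = coord s r n m b) : a = b :=
  funext fun i => by
    have := h i.1 i.2 i.1.2 i.2.2
    rwa [coord_of_lt i.1.2 i.2.2, coord_of_lt i.1.2 i.2.2] at this

lemma coord_vec (n m n' m' : ℕ) : coord s r n m (vec s r n' m') =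
    if n = n' ∧ m = m' ∧ n < s ∧ m < r then 1 else 0 := by
  by_cases h : n < s ∧ m < r
  · rw [coord_of_lt h.1 h.2, vec]
    split_ifs with h1 h2 h2
    · simp [h2.1, h2.2.1]
    · rw [Pi.single_eq_of_ne]
      simp only [ne_eq, Prod.mk.injEq, Fin.mk.injEq]
      tauto
    · omega
    · rfl
  · rw [coord_of_not h, if_neg (by tauto)]

lemma ext_vec_linear {W : Type} [AddCommGroup W] [Module ℂ W] {f g : (Fin s × Fin r → ℂ) →ₗ[ℂ] W}
    (h : ∀ n m, n < s → m < r → f (vec s r n m) = g (vec s r n m)) : f = g := by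
  refine (Pi.basisFun ℂ (Fin s × Fin r)).ext fun i => ?_
  have := h i.1 i.2 i.1.2 i.2.2
  simpa [vec] using this

lemma coord_act_K (n m : ℕ) (a : Fin s × Fin r → ℂ) : coord s r n m (act p α s r .K a) =
    (sgn α * q p ^ ((s : ℤ) - 1 - 2 * n)) * coord s r n m a := by
  suffices h : coord s r n m ∘ₗ act p α s r .K =
      (sgn α * q p ^ ((s : ℤ) - 1 - 2 * n)) • coord s r n m from LinearMap.congr_fun h a
  refine ext_vec_linear fun n' m' _ _ => ?_
  simp only [LinearMap.comp_apply, act_K, map_smul, coord_vec, LinearMap.smul_apply]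
  split_ifs with h
  · rw [h.1]
  · simp

lemma coord_act_Kinv (n m : ℕ) (a : Fin s × Fin r → ℂ) : coord s r n m (act p α s r .Kinv a) =
    (sgn α * q p ^ (-((s : ℤ) - 1 - 2 * n))) * coord s r n m a := by
  suffices h : coord s r n m ∘ₗ act p α s r .Kinv =
      (sgn α * q p ^ (-((s : ℤ) - 1 - 2 * n))) • coord s r n m from LinearMap.congr_fun h a
  refine ext_vec_linear fun n' m' _ _ => ?_
  simp only [LinearMap.comp_apply, act_Kinv, map_smul, coord_vec, LinearMap.smul_apply]
  split_ifs with h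
  · rw [h.1]
  · simp

lemma coord_act_h (n m : ℕ) (a : Fin s × Fin r → ℂ) : coord s r n m (act p α s r .h a) =
    ((1 / 2 : ℂ) * ((r : ℂ) - 1 - 2 * m)) * coord s r n m a := by
  suffices h : coord s r n m ∘ₗ act p α s r .h =
      ((1 / 2 : ℂ) * ((r : ℂ) - 1 - 2 * m)) • coord s r n m from LinearMap.congr_fun h a
  refine ext_vec_linear fun n' m' _ _ => ?_
  simp only [LinearMap.comp_apply, act_h, map_smul, coord_vec, LinearMap.smul_apply]
  split_ifs with h
  · rw [h.2.1]
  · simp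

lemma coord_act_e (n m : ℕ) (a : Fin s × Fin r → ℂ) : coord s r n m (act p α s r .e a) =
    (((m : ℂ) + 1) * ((r : ℂ) - (m + 1))) * coord s r n (m + 1) a := by
  suffices h : coord s r n m ∘ₗ act p α s r .e =
      (((m : ℂ) + 1) * ((r : ℂ) - (m + 1))) • coord s r n (m + 1) from LinearMap.congr_fun h a
  refine ext_vec_linear fun n' m' _ _ => ?_
  simp only [LinearMap.comp_apply, act_e, map_smul, coord_vec, LinearMap.smul_apply]
  rcases m' with _ | m'
  · rw [if_neg (c := n = n' ∧ m + 1 = 0 ∧ _) (by omega)]; simp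
  · rw [Nat.add_sub_cancel]
    split_ifs with h h' h'
    · rw [h.2.1]; push_cast; ring
    · omega
    · omega
    · simp

lemma coord_act_f (n m : ℕ) (a : Fin s × Fin r → ℂ) : coord s r n m (act p α s r .f a) =
    if m = 0 ∨ r ≤ m then 0 else coord s r n (m - 1) a := by
  suffices h : coord s r n m ∘ₗ act p α s r .f =
      if m = 0 ∨ r ≤ m then 0 else coord s r n (m - 1) by
    have := LinearMap.congr_fun h a
    split_ifs at this ⊢; exacts [this, this]
  refine ext_vec_linear fun n' m' _ _ => ?_
  simp only [LinearMap.comp_apply, act_f, coord_vec]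
  split_ifs with h h' h'
  · omega
  · rw [coord_vec, if_pos (by omega)]
  · rfl
  · rw [coord_vec, if_neg (by omega)]

lemma coord_act_F (n m : ℕ) (a : Fin s × Fin r → ℂ) : coord s r n m (act p α s r .F a) =
    if n = 0 ∨ s ≤ n then 0 else coord s r (n - 1) m a := by
  suffices h : coord s r n m ∘ₗ act p α s r .F =
      if n = 0 ∨ s ≤ n then 0 else coord s r (n - 1) m by
    have := LinearMap.congr_fun h a
    split_ifs at this ⊢; exacts [this, this]
  refine ext_vec_linear fun n' m' _ _ => ?_
  simp only [LinearMap.comp_apply, act_F, coord_vec]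
  split_ifs with h h' h'
  · omega
  · rw [coord_vec, if_pos (by omega)]
  · rfl
  · rw [coord_vec, if_neg (by omega)]

lemma coord_act_E (n m : ℕ) (a : Fin s × Fin r → ℂ) : coord s r n m (act p α s r .E a) =
    (sgn α * qNum p (n + 1 : ℕ) * qNum p ((s : ℤ) - (n + 1 : ℕ))) * coord s r (n + 1) m a := by
  suffices h : coord s r n m ∘ₗ act p α s r .E =
      (sgn α * qNum p (n + 1 : ℕ) * qNum p ((s : ℤ) - (n + 1 : ℕ))) • coord s r (n + 1) m from
    LinearMap.congr_fun h a
  refine ext_vec_linear fun n' m' _ _ => ?_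
  simp only [LinearMap.comp_apply, act_E, map_smul, coord_vec, LinearMap.smul_apply]
  rcases n' with _ | n'
  · rw [if_neg (c := n + 1 = 0 ∧ _) (by omega)]; simp [qNum_zero]
  · rw [Nat.add_sub_cancel]
    split_ifs with h h' h'
    · rw [h.1]
    · omega
    · omega
    · simp

/-- The graded function with the given coordinates. -/
def toGrd (p s r : ℕ) : (Fin s × Fin r → ℂ) →ₗ[ℂ] grd (Fin r → ℂ) PUnit.{1} p s where
  toFun a := ⟨fun n => (fun m => coord s r n.val m a, 0), fun n => by
    by_cases h : n.val < s
    · rw [decide_eq_true h]; rfl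
    · rw [decide_eq_false h, mem_par_false]
      exact funext fun m => coord_of_not (by omega) a⟩
  map_add' a b := by ext; simp
  map_smul' c a := by ext; simp

lemma cf_toGrd (a : Fin s × Fin r → ℂ) (n : ZMod p) (m : ℕ) :
    cf r m ((toGrd p s r a).1 n).1 = coord s r n.val m a := by
  by_cases h : m < r
  · rw [cf_of_lt h]; rfl
  · rw [cf_of_ge (by omega), coord_of_not (by omega)]

/-- With x = y = 0 no arrow crosses a junction, so the arc 0, …, s − 1 carries the chain of basis
vectors of the irreducible module. -/
lemma toGrd_comm (hp : 2 ≤ p) (hs1 : 1 ≤ s) (hs : s < p) (g : Gen) (a : Fin s × Fin r → ℂ)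
    (n : ZMod p) : (toGrd p s r (act p α s r g a)).1 n =
      actT α s (dataX r) g (toGrd p s r a).1 n := by
  have : NeZero p := ⟨by omega⟩
  refine Prod.ext (ext_cf fun m hm => ?_) rfl
  rw [cf_toGrd]
  obtain ⟨k, hk, rfl⟩ := exists_natCast n
  rw [ZMod.val_cast_of_lt hk]
  cases g
  · rw [coord_act_E, actT_E, opY, opZ]
    have h1 : ∀ v, (if Junction s ((k : ZMod p) + 1) then (dataX r).y
      else (dataX r).x * (dataX r).y) v = 0 := fun v => by split_ifs <;> simp [dataX]
    rw [LinearMap.add_apply, LinearMap.smul_apply (eta _ _ _ _), h1, smul_zero, add_zero,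
      LinearMap.smul_apply, Prod.smul_fst, map_smul, Module.End.one_apply, cf_toGrd, smul_eq_mul,
      ← Nat.cast_succ, co_natCast α s hp]
    by_cases h : k + 1 < p
    · rw [ZMod.val_cast_of_lt h]
    -- At the end of the cycle the left side is out of range, and the coefficient on the right
    -- contains [p] = 0.
    · rw [coord_of_not (by omega), show k.succ = p by omega, mul_zero, ← zero_add ((p : ℕ) : ℤ),
        qNum_add_p hp, qNum_zero]
      simp
  · rw [coord_act_F, actT_F, opX]
    split_ifs with h1 h2 h2
    · simp [dataX]
    · rw [junction_natCast hk hs] at h2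
      rw [Module.End.one_apply, show (k : ZMod p) - 1 = ((k - 1 : ℕ) : ZMod p) by
        rw [Nat.cast_sub (by omega), Nat.cast_one], cf_toGrd, ZMod.val_cast_of_lt (by omega),
        coord_of_not (by omega)]
    · rw [junction_natCast hk hs] at h2
      omega
    · rw [Module.End.one_apply, show (k : ZMod p) - 1 = ((k - 1 : ℕ) : ZMod p) by
        rw [Nat.cast_sub (by omega), Nat.cast_one], cf_toGrd, ZMod.val_cast_of_lt (by omega)]
  · rw [coord_act_K, actT_K, Prod.smul_fst, map_smul, cf_toGrd, ZMod.val_cast_of_lt hk,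
      kap_natCast α s hp, smul_eq_mul]
  · rw [coord_act_Kinv, actT_Kinv, Prod.smul_fst, map_smul, cf_toGrd, ZMod.val_cast_of_lt hk,
      kap_inv α s hp, smul_eq_mul]
  · rw [coord_act_e, actT_e]
    change _ = cf r m (eL r ((toGrd p s r a).1 k).1)
    rw [cf_eL, cf_toGrd, ZMod.val_cast_of_lt hk]
  · rw [coord_act_f, actT_f]
    change _ = cf r m (fL r ((toGrd p s r a).1 k).1)
    rcases m with _ | m
    · rw [cf_fL_zero]; simp
    · rw [cf_fL_succ hm, cf_toGrd, ZMod.val_cast_of_lt hk, if_neg (by omega), Nat.add_sub_cancel]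
  · rw [coord_act_h, actT_h]
    change _ = cf r m (hL r ((toGrd p s r a).1 k).1)
    rw [cf_hL, cf_toGrd, ZMod.val_cast_of_lt hk]

lemma toGrd_bijective (hs : s < p) : Function.Bijective (toGrd p s r) := by
  have : NeZero p := ⟨by omega⟩
  constructor
  · rw [injective_iff_map_eq_zero]
    intro a ha
    refine ext_coord fun n m hn hm => ?_
    have := cf_toGrd (p := p) a (n : ZMod p) m
    rw [ha, ZMod.val_cast_of_lt (by omega)] at this
    rw [← this, map_zero]; exact map_zero _
  · intro φ
    refine ⟨fun i => cf r i.2 (φ.1 (i.1 : ℕ)).1, Subtype.ext (funext fun n => Prod.ext ?_ rfl)⟩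
    refine ext_cf fun m hm => ?_
    rw [cf_toGrd]
    by_cases h : n.val < s
    · rw [coord_of_lt h hm, ZMod.natCast_zmod_val]
    · rw [coord_of_not (by omega)]
      have := φ.2 n
      rw [decide_eq_false h, mem_par_false] at this
      rw [this, map_zero]

end Coordinates

/-! ### Homomorphisms from W, X and P to irreducible modules. -/

section Homs

variable {p : ℕ}

section Iso

variable {V V' : Type} [AddCommGroup V] [Module ℂ V] [AddCommGroup V'] [Module ℂ V']
  [Module.Finite ℂ V] [Module.Finite ℂ V']

/-- A bijective linear map that commutes with the generators gives an isomorphism. -/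
lemma nonempty_iso {a : Gen → Module.End ℂ V} (h : IsRep p a) {a' : Gen → Module.End ℂ V'}
    (h' : IsRep p a') (φ : V →ₗ[ℂ] V') (hφ : ∀ g v, φ (a g v) = a' g (φ v))
    (hb : Function.Bijective φ) : Nonempty (modOf h ≅ modOf h') := by
  let e := LinearEquiv.ofBijective φ hb
  have he : ∀ g v, e.symm (a' g v) = a g (e.symm v) := fun g v => by
    rw [LinearEquiv.symm_apply_eq]
    have := hφ g (e.symm v)
    rw [show φ (e.symm v) = v from e.apply_symm_apply v] at this
    exact this.symm
  exact ⟨⟨homOf h h' φ hφ, homOf h' h e.symm he,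
    linOf_injective (LinearMap.ext fun v => e.symm_apply_apply v),
    linOf_injective (LinearMap.ext fun v => e.apply_symm_apply v)⟩⟩

lemma isZero_modOf {a : Gen → Module.End ℂ V} (h : IsRep p a) [Subsingleton V] :
    Limits.IsZero (modOf h) := by
  rw [Limits.IsZero.iff_id_eq_zero]
  exact linOf_injective (h := h) (h' := h) (LinearMap.ext fun v => Subsingleton.elim (α := V) _ _)

lemma eq_zero_of_linOf {a : Gen → Module.End ℂ V} {h : IsRep p a} {a' : Gen → Module.End ℂ V'}
    {h' : IsRep p a'} {φ : modOf h ⟶ modOf h'} (H : ∀ v, v ∈ LinearMap.ker (linOf φ)) : φ = 0 :=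
  linOf_injective (LinearMap.ext fun v => by rw [map_zero]; exact H v)

lemma mem_ker_linOf {a : Gen → Module.End ℂ V} {h : IsRep p a} {a' : Gen → Module.End ℂ V'}
    {h' : IsRep p a'} (φ : modOf h ⟶ modOf h') (g : Gen) (v : V)
    (hv : v ∈ LinearMap.ker (linOf φ)) : a g v ∈ LinearMap.ker (linOf φ) := by
  rw [LinearMap.mem_ker] at hv ⊢
  rw [linOf_comm, hv, map_zero]

end Iso

variable {α' : ℤˣ} {s' r' : ℕ}

lemma coord_eq_zero_of_e {y : Fin s' × Fin r' → ℂ} (he : act p α' s' r' .e y = 0) (n m : ℕ)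
    (hm : m ≠ 0) : coord s' r' n m y = 0 := by
  obtain ⟨m, rfl⟩ := Nat.exists_eq_succ_of_ne_zero hm
  by_cases h : m + 1 < r'
  · have := coord_act_e (p := p) (α := α') n m y
    rw [he, map_zero] at this
    refine (mul_eq_zero.1 this.symm).resolve_left (mul_ne_zero (by exact_mod_cast m.succ_ne_zero)
        ?_)
    rw [sub_ne_zero]
    exact_mod_cast h.ne'
  · exact coord_of_not (by omega) _

/-- Vectors killed by e have h-weight (r' − 1)/2. -/
lemma eq_zero_of_e_of_h {y : Fin s' × Fin r' → ℂ} (he : act p α' s' r' .e y = 0) {r : ℕ}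
    (hh : act p α' s' r' .h y = ((1 / 2 : ℂ) * r) • y) (hr : r' ≠ r + 1) : y = 0 := by
  refine ext_coord fun n m _ _ => ?_
  rw [map_zero]
  by_cases hm : m = 0
  · subst hm
    have := coord_act_h (p := p) (α := α') n 0 y
    rw [hh, map_smul, smul_eq_mul, ← sub_eq_zero, ← sub_mul] at this
    refine (mul_eq_zero.1 this).resolve_left fun h => hr ?_
    have h2 : (r' : ℂ) = r + 1 := by linear_combination (-2) * h
    exact_mod_cast h2
  · exact coord_eq_zero_of_e he n m hm

lemma coord_eq_zero_of_E (hp : 2 ≤ p) (hs' : s' ≤ p) {y : Fin s' × Fin r' → ℂ}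
    (hE : act p α' s' r' .E y = 0) (n m : ℕ) (hn : n ≠ 0) : coord s' r' n m y = 0 := by
  obtain ⟨n, rfl⟩ := Nat.exists_eq_succ_of_ne_zero hn
  by_cases h : n + 1 < s'
  · have := coord_act_E (p := p) (α := α') n m y
    rw [hE, map_zero] at this
    refine (mul_eq_zero.1 this.symm).resolve_left (mul_ne_zero (mul_ne_zero (sgn_ne_zero _)
      (qNum_natCast_ne_zero hp (by omega) (by omega))) ?_)
    rw [← Nat.cast_sub h.le]
    exact qNum_natCast_ne_zero hp (by omega) (by omega)
  · exact coord_of_not (by omega) _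

/-- Writing −1 as q^p turns the highest K-weights into powers of q whose exponents are distinct
modulo 2p. -/
lemma weight_eq (hp : 2 ≤ p) {α : ℤˣ} {s : ℕ} (hs1 : 1 ≤ s) (hs : s < p) (hs1' : 1 ≤ s')
    (hs' : s' ≤ p) (h : sgn α * q p ^ ((s : ℤ) - 1) = sgn α' * q p ^ ((s' : ℤ) - 1)) :
    α' = α ∧ s' = s := by
  have key : ∀ k l : ℤ, q p ^ k = q p ^ l → ((2 * p : ℤ)) ∣ k - l :=
    fun k l h => (q_zpow_inj_iff hp k l).1 h
  by_cases hα : α' = α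
  · subst hα
    refine ⟨rfl, ?_⟩
    obtain ⟨c, hc⟩ := key _ _ (mul_left_cancel₀ (sgn_ne_zero _) h)
    have h1 : (p : ℤ) * (2 * c) < p * 1 := by linarith [hc]
    have h2 : (p : ℤ) * (-1) < p * (2 * c) := by linarith [hc]
    have h3 := lt_of_mul_lt_mul_left h1 (by positivity)
    have h4 := lt_of_mul_lt_mul_left h2 (by positivity)
    obtain rfl : c = 0 := by omega
    omega
  · exfalso
    have : α' = -α := by
      rcases Int.units_eq_one_or α with rfl | rfl <;>
        rcases Int.units_eq_one_or α' with rfl | rfl <;> simp_all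
    rw [this, sgn_neg, neg_mul, ← mul_neg] at h
    have h' := mul_left_cancel₀ (sgn_ne_zero _) h
    have e : -q p ^ ((s' : ℤ) - 1) = q p ^ ((s' : ℤ) - 1 + p) := by
      rw [zpow_add₀ q_ne_zero, q_zpow_p hp]; ring
    rw [e] at h'
    obtain ⟨c, hc⟩ := key _ _ h'
    have h1 : (p : ℤ) * (2 * c) < p * 0 := by linarith [hc]
    have h2 : (p : ℤ) * (-2) < p * (2 * c) := by linarith [hc]
    have h3 := lt_of_mul_lt_mul_left h1 (by positivity)
    have h4 := lt_of_mul_lt_mul_left h2 (by positivity)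
    omega

lemma not_isZero_simpleMod (hp : 2 ≤ p) (hs1' : 1 ≤ s') (hr' : 1 ≤ r') (hs' : s' ≤ p) :
    ¬ Limits.IsZero (simpleMod p hp α' s' r' hs') := by
  rw [Limits.IsZero.iff_id_eq_zero]
  intro h
  rw [simpleMod_eq] at h
  have h1 := congrArg (fun φ => coord s' r' 0 0 (linOf φ (vec s' r' 0 0))) h
  have h2 : coord s' r' 0 0 (vec s' r' 0 0) = 0 := h1.trans (by rw [map_zero]; simp)
  rw [coord_vec, if_pos (by omega)] at h2
  exact one_ne_zero h2

variable (hp : 2 ≤ p) (α : ℤˣ) {s : ℕ} (hs1 : 1 ≤ s) (hs : s < p)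

/-- The highest weight vector of the irreducible representation of `sl₂`. -/
def e₀ (r : ℕ) : Fin r → ℂ := fun k => if (k : ℕ) = 0 then 1 else 0

lemma cf_e₀ {r k : ℕ} (hk : k < r) : cf r k (e₀ r) = if k = 0 then 1 else 0 := cf_of_lt hk _

lemma eL_e₀ (r : ℕ) : eL r (e₀ r) = 0 := by
  refine ext_cf fun k hk => ?_
  rw [cf_eL, map_zero]
  by_cases h : k + 1 < r
  · rw [cf_e₀ h]; simp
  · rw [cf_of_ge (by omega), mul_zero]

lemma hL_e₀ (r : ℕ) : hL r (e₀ r) = ((1 / 2 : ℂ) * (r - 1)) • e₀ r := by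
  refine ext_cf fun k hk => ?_
  rw [cf_hL, map_smul, cf_e₀ hk]
  split_ifs with h
  · simp [h]
  · simp

lemma mem_of_e₀_mem {r : ℕ} (Q : Submodule ℂ (Fin r → ℂ)) (h0 : e₀ r ∈ Q)
    (hf : ∀ v ∈ Q, fL r v ∈ Q) (v : Fin r → ℂ) : v ∈ Q := by
  have hk : ∀ k (hk : k < r), Pi.single (⟨k, hk⟩ : Fin r) (1 : ℂ) ∈ Q := by
    intro k
    induction k with
    | zero =>
      intro hk
      convert h0 using 1
      refine ext_cf fun j hj => ?_
      rw [cf_e₀ hj, cf_of_lt hj, Pi.single_apply]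
      simp
    | succ k ih =>
      intro hk
      convert hf _ (ih (by omega)) using 1
      refine ext_cf fun j hj => ?_
      rw [cf_of_lt hj, Pi.single_apply]
      rcases j with _ | j
      · rw [cf_fL_zero]; simp
      · rw [cf_fL_succ hj, cf_of_lt (by omega), Pi.single_apply]; simp
  rw [← Finset.univ_sum_single v]
  refine Q.sum_mem fun k _ => ?_
  have := Q.smul_mem (v k) (hk k k.2)
  rwa [← Pi.single_smul, smul_eq_mul, mul_one] at this

/-- The generator of the projective module. -/
def genP (r : ℕ) :
    grd ((Fin (r + 1) → ℂ) × (Fin (r + 1) → ℂ)) ((Fin (r + 1) → ℂ) × (Fin (r + 1) → ℂ)) p s :=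
  ⟨Pi.single 0 ((e₀ _, 0), (0, 0)), fun n => by
    by_cases h : n = 0
    · subst h
      rw [Pi.single_eq_same, ZMod.val_zero, decide_eq_true (by omega)]
      rfl
    · rw [Pi.single_eq_of_ne h]; exact Submodule.zero_mem _⟩

variable {hp α hs1 hs}

/-- Lowering with f reaches all of 1 ⊗ L_{r+1} at the index 0; `mem_of_generates` does the rest. -/
lemma mem_of_genP_mem {r : ℕ}
    (Q : Submodule ℂ (grd ((Fin (r + 1) → ℂ) × (Fin (r + 1) → ℂ))
      ((Fin (r + 1) → ℂ) × (Fin (r + 1) → ℂ)) p s)) (h0 : genP (p := p) hs1 r ∈ Q)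
    (hQ : ∀ g, ∀ v ∈ Q, (actT α s (dataP (repL (r + 1))) g).restrict
      (actT_mem (isGraded_dataP _) hp hs1 hs g) v ∈ Q) (v) : v ∈ Q := by
  have h1 : ∀ g, ∀ v ∈ Q.map (Submodule.subtype _), actT α s (dataP (repL (r + 1))) g v ∈
      Q.map (Submodule.subtype _) := by
    rintro g _ ⟨v, hv, rfl⟩
    exact ⟨_, hQ g v hv, rfl⟩
  have := mem_of_generates (α := α) (L := repL (r + 1)) hp hs1 hs (Q.map (Submodule.subtype _))
    (h1 .E) (h1 .F) (fun b => ?_) v.2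
  · obtain ⟨w, hw, h⟩ := this
    rwa [← Subtype.ext h]
  · refine mem_of_e₀_mem (Submodule.comap
      (LinearMap.single ℂ _ (0 : ZMod p) ∘ₗ LinearMap.inl ℂ _ _ ∘ₗ LinearMap.inl ℂ _ _)
      (Q.map (Submodule.subtype _))) ⟨_, h0, rfl⟩ (fun v hv => ?_) b
    have h2 := h1 .f _ hv
    refine Eq.mp (congrArg (· ∈ Q.map (Submodule.subtype _)) ?_) h2
    funext n
    rw [actT_f]
    by_cases h : n = 0
    · subst h; simp [dataP, repL]
    · simp [Pi.single_eq_of_ne h]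

variable (hs1) in
/-- The generator of the module `W`. -/
def genW (r : ℕ) : grd (Fin (r + 1) → ℂ) (Fin r → ℂ) p s :=
  ⟨Pi.single 0 (e₀ _, 0), fun n => by
    by_cases h : n = 0
    · subst h
      rw [Pi.single_eq_same, ZMod.val_zero, decide_eq_true (by omega)]
      rfl
    · rw [Pi.single_eq_of_ne h]; exact Submodule.zero_mem _⟩

lemma mem_of_genW_mem {r : ℕ} (Q : Submodule ℂ (grd (Fin (r + 1) → ℂ) (Fin r → ℂ) p s))
    (h0 : genW (p := p) hs1 r ∈ Q) (hQ : ∀ g, ∀ v ∈ Q, (actT α s (dataW r) g).restrict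
      (actT_mem (isGraded_dataW _) hp hs1 hs g) v ∈ Q) (v) : v ∈ Q := by
  -- W is a quotient of P by a map that sends generator to generator.
  let π := shiftMap (p := p) (s' := s) (s := s) (projPW r) 0 fun n v hv => by
    rw [add_zero] at hv; exact projPW_mem r _ _ hv
  have h1 : ∀ u, u ∈ Q.comap π := by
    refine mem_of_genP_mem (hp := hp) (α := α) (hs1 := hs1) (hs := hs) _ ?_ fun g u hu => ?_
    · rw [Submodule.mem_comap]
      convert h0 using 1
      refine Subtype.ext (funext fun n => ?_)
      rw [shiftMap_apply, add_zero]
      by_cases h : n = 0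
      · subst h; simp [genP, genW, projPW]
      · simp [genP, genW, Pi.single_eq_of_ne h]
    · rw [Submodule.mem_comap] at hu ⊢
      convert hQ g _ hu using 1
      refine Subtype.ext (funext fun n => ?_)
      have := actT_shift (isHom_projPW r) (Matches.refl (p := p) α s) g u.1 n
      exact this
  choose u hu hu' using fun n : ZMod p => projPW_surj r _ _ (v.2 n)
  have h2 := h1 ⟨u, hu⟩
  rw [Submodule.mem_comap] at h2
  convert h2 using 1
  refine Subtype.ext (funext fun n => ?_)
  rw [shiftMap_apply, add_zero, hu']

/-- In W, unlike in P, the generator is also killed by E: there E is a multiple of `dY`, which kills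
the highest weight vector. -/
lemma actT_genW {r : ℕ} : actT α s (dataW r) .E (genW (p := p) hs1 r).1 = 0 ∧
    actT α s (dataW r) .e (genW (p := p) hs1 r).1 = 0 ∧
    actT α s (dataW r) .h (genW (p := p) hs1 r).1 = ((1 / 2 : ℂ) * r) • (genW (p := p) hs1 r).1 ∧
    actT α s (dataW r) .K (genW (p := p) hs1 r).1 = (sgn α * q p ^ ((s : ℤ) - 1)) • (genW (p := p)
        hs1 r).1 := by
  have h0 : (genW (p := p) hs1 r).1 =
      (Pi.single 0 (e₀ (r + 1), 0) : ZMod p → (Fin (r + 1) → ℂ) × (Fin r → ℂ)) := rfl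
  rw [h0]
  refine ⟨?_, ?_, ?_, ?_⟩
  · have : dY r (e₀ (r + 1)) = 0 := ext_cf fun k hk => by
      rw [cf_dY, cf_e₀ (by omega), map_zero]; simp
    rw [actT_E_single, opY, opZ, co_zero, if_pos junction_zero]
    simp [dataW, this]
  · funext n
    rw [actT_e]
    by_cases h : n = 0
    · subst h; simp [dataW, eL_e₀]
    · simp [Pi.single_eq_of_ne h]
  · funext n
    rw [actT_h]
    by_cases h : n = 0
    · subst h; simp [dataW, hL_e₀]
    · simp [Pi.single_eq_of_ne h]
  · funext n
    rw [actT_K]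
    by_cases h : n = 0
    · subst h; simp [kap]
    · simp [Pi.single_eq_of_ne h]

variable [NeZero p] (hp α hs1 hs)

lemma nonempty_iso_xMod (r : ℕ) : Nonempty (simpleMod p hp α s r hs.le ≅ xMod hp α hs1 hs r) :=
  nonempty_iso (isRep_act hp α r hs.le) _ (toGrd p s r)
    (fun g a => Subtype.ext (funext fun n => toGrd_comm hp hs1 hs g a n)) (toGrd_bijective hs)

lemma isZero_xMod : Limits.IsZero (xMod hp α hs1 hs 0) := by
  have : Subsingleton (grd (Fin 0 → ℂ) PUnit.{1} p s) :=
    inferInstance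
  exact isZero_modOf _

/-- The image of the generator is killed by e and has weight r/2; the sl(2)-weight alone excludes
it. -/
lemma subsingleton_pMod_hom (hs' : s' ≤ p) {r : ℕ} (hr : r' ≠ r + 1) :
    Subsingleton (modOf (isRep_graded (α := α) (isGraded_dataP (repL (r + 1))) hp hs1 hs) ⟶
      modOf (isRep_act hp α' r' hs')) := by
  refine subsingleton_of_forall_eq 0 fun φ => eq_zero_of_linOf
    (mem_of_genP_mem (hp := hp) (α := α) (hs1 := hs1) (hs := hs) _ ?_ (mem_ker_linOf φ))
  · have he := linOf_comm φ .e (genP (p := p) hs1 r)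
    have hh := linOf_comm φ .h (genP (p := p) hs1 r)
    refine eq_zero_of_e_of_h (p := p) (α' := α') ?_ (r := r) ?_ hr
    · rw [← he, ← map_zero (linOf φ)]
      congr 1
      refine Subtype.ext (funext fun n => ?_)
      change actT α s (dataP (repL (r + 1))) .e _ n = 0
      rw [actT_e]
      by_cases h : n = 0
      · subst h; simp [genP, dataP, repL, eL_e₀]
      · simp [genP, Pi.single_eq_of_ne h]
    · rw [← hh, ← map_smul]
      congr 1
      refine Subtype.ext (funext fun n => ?_)
      change actT α s (dataP (repL (r + 1))) .h _ n = _
      rw [actT_h]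
      by_cases h : n = 0
      · subst h; simp [genP, dataP, repL, hL_e₀]
      · simp [genP, Pi.single_eq_of_ne h]

variable {hp α hs1 hs}

/-- The image of the generator under a homomorphism to an irreducible module. -/
lemma linOf_genW {r : ℕ} (hs' : s' ≤ p) (φ : modOf (isRep_graded (α := α) (isGraded_dataW r) hp hs1
    hs) ⟶
      modOf (isRep_act hp α' r' hs')) :
    act p α' s' r' .E (linOf φ (genW (p := p) hs1 r)) = 0 ∧
    act p α' s' r' .e (linOf φ (genW (p := p) hs1 r)) = 0 ∧
    act p α' s' r' .h (linOf φ (genW (p := p) hs1 r)) = ((1 / 2 : ℂ) * r) • linOf φ (genW (p := p)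
        hs1 r) ∧
    act p α' s' r' .K (linOf φ (genW (p := p) hs1 r)) =
      (sgn α * q p ^ ((s : ℤ) - 1)) • linOf φ (genW (p := p) hs1 r) := by
  obtain ⟨h1, h2, h3, h4⟩ := actT_genW (p := p) (α := α) (s := s) (r := r) (hs1 := hs1)
  simp only [← linOf_comm, ← map_smul]
  refine ⟨?_, ?_, ?_, ?_⟩
  · rw [← map_zero (linOf φ)]; exact congrArg _ (Subtype.ext h1)
  · rw [← map_zero (linOf φ)]; exact congrArg _ (Subtype.ext h2)
  · exact congrArg _ (Subtype.ext h3)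
  · exact congrArg _ (Subtype.ext h4)

lemma hom_eq_zero_of_genW {r : ℕ} (hs' : s' ≤ p) (φ : modOf (isRep_graded (α := α) (isGraded_dataW
    r) hp hs1 hs) ⟶
      modOf (isRep_act hp α' r' hs'))
    (h : linOf φ (genW (p := p) hs1 r) = 0) : φ = 0 :=
  eq_zero_of_linOf
    (mem_of_genW_mem (hp := hp) (α := α) (hs1 := hs1) (hs := hs) _ h (mem_ker_linOf φ))

lemma isLineIf_of_injective {V : Type*} [AddCommGroup V] [Module ℂ V] {c : Prop} (f : V →ₗ[ℂ] ℂ)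
    (hf : Function.Injective f) (h1 : c → ∃ v : V, v ≠ 0) (h2 : ¬ c → Subsingleton V) :
    IsLineIf V c := by
  refine ⟨fun hc => ?_, h2⟩
  obtain ⟨v, hv⟩ := h1 hc
  refine ⟨LinearEquiv.ofBijective f ⟨hf, fun z => ⟨(z / f v) • v, ?_⟩⟩⟩
  have : f v ≠ 0 := fun h => hv (hf (h.trans (map_zero f).symm))
  rw [map_smul, smul_eq_mul, div_mul_cancel₀ _ this]

variable (hp α hs1 hs)

/-- The leading coordinate of the image of the generator. -/
def evalW (r : ℕ) (hs' : s' ≤ p) :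
    (modOf (isRep_graded (α := α) (isGraded_dataW r) hp hs1 hs) ⟶
      modOf (isRep_act hp α' r' hs')) →ₗ[ℂ] ℂ :=
  coord s' r' 0 0 ∘ₗ LinearMap.applyₗ (genW (p := p) hs1 r) ∘ₗ linOf

/-- The image of the generator is killed by E and e, hence is a multiple of v_{0,0}, and it
determines the homomorphism. -/
lemma evalW_injective (r : ℕ) (hs' : s' ≤ p) :
    Function.Injective (evalW hp α hs1 hs r hs' (α' := α') (r' := r')) := by
  rw [injective_iff_map_eq_zero]
  intro φ h
  obtain ⟨h1, h2, -, -⟩ := linOf_genW (hp := hp) (hs1 := hs1) (hs := hs) hs' φ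
  refine hom_eq_zero_of_genW (hp := hp) (hs1 := hs1) (hs := hs) hs' φ (ext_coord (a := linOf φ
      (genW hs1 r)) fun n m _ _ => ?_)
  rw [map_zero]
  by_cases hn : n = 0
  · by_cases hm : m = 0
    · subst hn; subst hm; exact h
    · exact coord_eq_zero_of_e h2 n m hm
  · exact coord_eq_zero_of_E hp hs' h1 n m hn

lemma evalW_eq_zero (r : ℕ) (hs1' : 1 ≤ s') (hs' : s' ≤ p) (h : ¬ ((α' = α ∧ s' = s) ∧ r' = r + 1))
    (φ : modOf (isRep_graded (α := α) (isGraded_dataW r) hp hs1 hs) ⟶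
      modOf (isRep_act hp α' r' hs')) : evalW hp α hs1 hs r hs' φ = 0 := by
  obtain ⟨-, h2, h3, h4⟩ := linOf_genW (hp := hp) (hs1 := hs1) (hs := hs) hs' φ
  by_cases hr : r' = r + 1
  · have h5 := coord_act_K (p := p) (α := α') 0 0 (linOf φ (genW (p := p) hs1 r))
    rw [h4, map_smul, smul_eq_mul, ← sub_eq_zero, ← sub_mul] at h5
    refine (mul_eq_zero.1 h5).resolve_left fun h6 => h ⟨weight_eq hp hs1 hs hs1' hs' ?_, hr⟩
    rw [sub_eq_zero] at h6
    simpa using h6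
  · change coord s' r' 0 0 (linOf φ (genW hs1 r)) = 0
    rw [eq_zero_of_e_of_h h2 h3 hr, map_zero]

lemma exists_epi (r : ℕ) : ∃ j : wMod hp α hs1 hs r ⟶ xMod hp α hs1 hs (r + 1), Epi j :=
  have ⟨_, j, _, h⟩ := shortExact_XWX hp α hs1 hs r
  ⟨j, h.epi_g⟩

lemma isLineIf_wMod_hom (r : ℕ) (hs1' : 1 ≤ s') (hs' : s' ≤ p) :
    IsLineIf (wMod hp α hs1 hs r ⟶ simpleMod p hp α' s' r' hs')
      ((α' = α ∧ s' = s) ∧ r' = r + 1) := by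
  refine isLineIf_of_injective (evalW hp α hs1 hs r hs') (evalW_injective hp α hs1 hs r hs') ?_ ?_
  · rintro ⟨⟨rfl, rfl⟩, rfl⟩
    obtain ⟨j, hj⟩ := exists_epi hp α' hs1 hs r
    obtain ⟨i⟩ := nonempty_iso_xMod hp α' hs1 hs (r + 1)
    have : Epi (j ≫ i.inv) := epi_comp _ _
    exact ⟨j ≫ i.inv, fun h => not_isZero_simpleMod (α' := α') hp hs1' (by omega) hs'
      (Limits.IsZero.of_epi_eq_zero (j ≫ i.inv) h)⟩
  · exact fun h => ⟨fun φ ψ => evalW_injective hp α hs1 hs r hs'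
      ((evalW_eq_zero hp α hs1 hs r hs1' hs' h φ).trans
        (evalW_eq_zero hp α hs1 hs r hs1' hs' h ψ).symm)⟩

/-- X is a quotient of W, so its homomorphisms embed into those of W. -/
lemma isLineIf_xMod_hom (r : ℕ) (hs1' : 1 ≤ s') (hs' : s' ≤ p) :
    IsLineIf (xMod hp α hs1 hs (r + 1) ⟶ simpleMod p hp α' s' r' hs')
      ((α' = α ∧ s' = s) ∧ r' = r + 1) := by
  obtain ⟨j, hj⟩ := exists_epi hp α hs1 hs r
  have hinj : Function.Injective (Linear.leftComp ℂ (simpleMod p hp α' s' r' hs') j) :=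
    fun φ ψ h => (cancel_epi j).1 h
  refine isLineIf_of_injective (evalW hp α hs1 hs r hs' ∘ₗ Linear.leftComp ℂ _ j)
    ((evalW_injective hp α hs1 hs r hs').comp hinj) ?_ ?_
  · rintro ⟨⟨rfl, rfl⟩, rfl⟩
    obtain ⟨i⟩ := nonempty_iso_xMod hp α' hs1 hs (r + 1)
    exact ⟨i.inv, fun h => not_isZero_simpleMod (α' := α') hp hs1' (by omega) hs'
      (Limits.IsZero.of_epi_eq_zero i.inv h)⟩
  · intro h
    have := (isLineIf_wMod_hom hp α hs1 hs r hs1' hs').2 h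
    exact hinj.subsingleton

end Homs

/-! ### Lifting generalized eigenvectors along surjections by polynomials in the operator. -/

section Lifting

variable {M N : Type} [AddCommGroup M] [Module ℂ M] [AddCommGroup N] [Module ℂ N]

/-- The vector `v` is a generalized eigenvector of `T` with eigenvalue `μ`, or zero. -/
def IsGenEig (T : Module.End ℂ M) (μ : ℂ) (v : M) : Prop := ∃ k : ℕ, aeval T ((X - C μ) ^ k) v = 0

lemma isGenEig_of_eq {T : Module.End ℂ M} {μ : ℂ} {v : M} (h : T v = μ • v) : IsGenEig T μ v :=
  ⟨1, by simp [h]⟩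

lemma isCoprime_X_sub_C_pow {P : ℂ[X]} {μ : ℂ} (h : P.eval μ ≠ 0) (k : ℕ) :
    IsCoprime P ((X - C μ) ^ k) :=
  (((irreducible_X_sub_C μ).coprime_iff_not_dvd).2 fun h' => h (dvd_iff_isRoot.1 h')).symm.pow_right

/-- A polynomial that does not vanish at the eigenvalue acts injectively. -/
lemma IsGenEig.eq_zero {T : Module.End ℂ M} {μ : ℂ} {v : M} (h : IsGenEig T μ v) {P : ℂ[X]}
    (hP : P.eval μ ≠ 0) (h0 : aeval T P v = 0) : v = 0 := by
  obtain ⟨k, hk⟩ := h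
  obtain ⟨a, b, hab⟩ := isCoprime_X_sub_C_pow hP k
  have := congrArg (fun Q => aeval T Q v) hab
  simpa [h0, hk, -map_pow] using this.symm

lemma commute_aeval {T U : Module.End ℂ M} (h : Commute T U) (P Q : ℂ[X]) :
    Commute (aeval T P) (aeval U Q) := by
  have key : ∀ {T U : Module.End ℂ M} (_ : Commute T U) (P : ℂ[X]), Commute (aeval T P) U := by
    intro T U h P
    induction P using Polynomial.induction_on' with
    | add P Q hP hQ => rw [map_add]; exact hP.add_left hQ
    | monomial n a =>
      rw [aeval_monomial]
      exact (Algebra.commute_algebraMap_left a U).mul_left (h.pow_left n)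
  exact (key (key h P).symm Q).symm

lemma map_aeval {T : Module.End ℂ M} {T' : Module.End ℂ N} {ψ : M →ₗ[ℂ] N}
    (hψ : ∀ v, ψ (T v) = T' (ψ v)) (P : ℂ[X]) (v : M) : ψ (aeval T P v) = aeval T' P (ψ v) := by
  have hk : ∀ (n : ℕ) (v : M), ψ ((T ^ n) v) = (T' ^ n) (ψ v) := by
    intro n
    induction n with
    | zero => simp
    | succ n ih => intro v; rw [pow_succ, Module.End.mul_apply, ih, hψ, pow_succ,
        Module.End.mul_apply]
  induction P using Polynomial.induction_on' with
  | add P Q hP hQ => simp [hP, hQ]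
  | monomial n a => simp [aeval_monomial, hk]

lemma IsGenEig.map {T : Module.End ℂ M} {T' : Module.End ℂ N} {ψ : M →ₗ[ℂ] N}
    (hψ : ∀ v, ψ (T v) = T' (ψ v)) {μ : ℂ} {v : M} (h : IsGenEig T μ v) :
    IsGenEig T' μ (ψ v) :=
  let ⟨k, hk⟩ := h
  ⟨k, by rw [← map_aeval hψ, hk, map_zero]⟩

lemma IsGenEig.apply_of_commute {T U : Module.End ℂ M} (h : Commute T U) {μ : ℂ} {v : M}
    (hv : IsGenEig T μ v) : IsGenEig T μ (U v) :=
  hv.map fun v => (LinearMap.congr_fun h v).symm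

/-- If a polynomial multiple of `(X - μ) ^ k` annihilates `T`, generalized eigenvectors lift. -/
lemma exists_lift {T : Module.End ℂ M} {T' : Module.End ℂ N} {ψ : M →ₗ[ℂ] N}
    (hψ : ∀ v, ψ (T v) = T' (ψ v)) {μ : ℂ} {k : ℕ} {R : ℂ[X]} (hR : R.eval μ ≠ 0)
    (hT : aeval T ((X - C μ) ^ k * R) = 0) {m : M} (hm : IsGenEig T' μ (ψ m)) :
    ∃ P : ℂ[X], aeval T ((X - C μ) ^ k) (aeval T P m) = 0 ∧ ψ (aeval T P m) = ψ m := by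
  obtain ⟨j, hj⟩ := hm
  obtain ⟨a, b, hab⟩ := isCoprime_X_sub_C_pow hR j
  -- By the Bézout identity a R + b (X − μ)^j = 1, the polynomial a R acts as the identity on ψ m.
  refine ⟨a * R, ?_, ?_⟩
  · rw [← Module.End.mul_apply, ← map_mul, show (X - C μ) ^ k * (a * R) =
      a * ((X - C μ) ^ k * R) by ring, map_mul, hT, mul_zero, LinearMap.zero_apply]
  · have : (aeval T' (a * R) + aeval T' b * aeval T' ((X - C μ) ^ j)) (ψ m) = ψ m := by
      rw [← map_mul, ← map_add, hab, map_one, Module.End.one_apply]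
    rw [LinearMap.add_apply, Module.End.mul_apply, hj, map_zero, add_zero] at this
    rw [map_aeval hψ, this]

lemma exists_lift_of_finite [Module.Finite ℂ M] {T : Module.End ℂ M} {T' : Module.End ℂ N}
    {ψ : M →ₗ[ℂ] N} (hψ : ∀ v, ψ (T v) = T' (ψ v)) {μ : ℂ} {m : M} (hm : IsGenEig T' μ (ψ m)) :
    ∃ P : ℂ[X], IsGenEig T μ (aeval T P m) ∧ ψ (aeval T P m) = ψ m := by
  have h0 : minpoly ℂ T ≠ 0 := minpoly.ne_zero (Algebra.IsIntegral.isIntegral T)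
  obtain ⟨R, h1, h2⟩ := exists_eq_pow_rootMultiplicity_mul_and_not_dvd (minpoly ℂ T) h0 μ
  obtain ⟨P, h3, h4⟩ := exists_lift hψ (k := (minpoly ℂ T).rootMultiplicity μ) (R := R)
    (fun h => h2 (dvd_iff_isRoot.2 h)) (by rw [← h1, minpoly.aeval]) hm
  exact ⟨P, ⟨_, h3⟩, h4⟩

end Lifting

/-! ### Highest weight vectors in finite-dimensional sl(2)-modules. -/

section Sl2

variable {M : Type} [AddCommGroup M] [Module ℂ M] (S : Sl2Data M)

namespace Sl2Data

lemma he' (v : M) : S.h (S.e v) = S.e (S.h v) + S.e v := by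
  have := LinearMap.congr_fun S.he v
  simp only [LinearMap.sub_apply, Module.End.mul_apply] at this
  rw [← sub_eq_iff_eq_add', this]

lemma hf' (v : M) : S.h (S.f v) = S.f (S.h v) - S.f v := by
  have := LinearMap.congr_fun S.hf v
  simp only [LinearMap.sub_apply, Module.End.mul_apply, LinearMap.neg_apply] at this
  rw [eq_sub_iff_add_eq, ← sub_eq_zero, add_sub_right_comm, this, neg_add_cancel]

lemma ef' (v : M) : S.e (S.f v) = S.f (S.e v) + (2 : ℂ) • S.h v := by
  have := LinearMap.congr_fun S.ef v
  simp only [LinearMap.sub_apply, Module.End.mul_apply, LinearMap.smul_apply] at this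
  rw [← sub_eq_iff_eq_add', this]

/-- The Casimir operator `h² + h + f e`. -/
def Ω : Module.End ℂ M := S.h * S.h + S.h + S.f * S.e

lemma Ω_apply (v : M) : S.Ω v = S.h (S.h v) + S.h v + S.f (S.e v) := rfl

lemma Ω_e (v : M) : S.Ω (S.e v) = S.e (S.Ω v) := by
  simp only [Ω_apply, he', map_add, ef', smul_add, two_smul]
  abel

lemma Ω_h (v : M) : S.Ω (S.h v) = S.h (S.Ω v) := by
  simp only [Ω_apply, he', hf', map_add]
  abel

lemma isGenEig_e {μ : ℂ} {v : M} (hv : IsGenEig S.h μ v) : IsGenEig S.h (μ + 1) (S.e v) := by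
  obtain ⟨k, hk⟩ := hv
  refine ⟨k, ?_⟩
  have h1 : ∀ v, (aeval S.h (X - C (μ + 1))) (S.e v) = S.e (aeval S.h (X - C μ) v) := by
    intro v
    simp only [map_sub, aeval_X, aeval_C, LinearMap.sub_apply, Module.algebraMap_end_apply, he',
      add_smul, one_smul, map_smul]
    abel
  have h2 : ∀ (j : ℕ) v, (aeval S.h ((X - C (μ + 1)) ^ j)) (S.e v) =
      S.e (aeval S.h ((X - C μ) ^ j) v) := by
    intro j
    induction j with
    | zero => simp
    | succ j ih => intro v; rw [pow_succ, pow_succ, map_mul, map_mul, Module.End.mul_apply, h1, ih,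
        Module.End.mul_apply]
  rw [h2, hk, map_zero]

lemma isGenEig_f {μ : ℂ} {v : M} (hv : IsGenEig S.h μ v) : IsGenEig S.h (μ - 1) (S.f v) := by
  obtain ⟨k, hk⟩ := hv
  refine ⟨k, ?_⟩
  have h1 : ∀ v, (aeval S.h (X - C (μ - 1))) (S.f v) = S.f (aeval S.h (X - C μ) v) := by
    intro v
    simp only [map_sub, aeval_X, aeval_C, LinearMap.sub_apply, Module.algebraMap_end_apply, hf',
      one_smul, map_smul]
    abel
  have h2 : ∀ (j : ℕ) v, (aeval S.h ((X - C (μ - 1)) ^ j)) (S.f v) =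
      S.f (aeval S.h ((X - C μ) ^ j) v) := by
    intro j
    induction j with
    | zero => simp
    | succ j ih => intro v; rw [pow_succ, pow_succ, map_mul, map_mul, Module.End.mul_apply, h1, ih,
        Module.End.mul_apply]
  rw [h2, hk, map_zero]

/-- Finitely many eigenvalues are possible. -/
lemma exists_pow_eq_zero [Module.Finite ℂ M] {T : Module.End ℂ M} {c : ℂ} (hc : c ≠ 0) {μ : ℂ}
    {v : M} (h : ∀ k : ℕ, IsGenEig S.h (μ + k * c) ((T ^ k) v)) : ∃ k : ℕ, (T ^ k) v = 0 := by
  have h0 : minpoly ℂ S.h ≠ 0 := minpoly.ne_zero (Algebra.IsIntegral.isIntegral S.h)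
  by_contra! H
  -- If no power killed v, the minimal polynomial of h would vanish at all the distinct numbers μ +
  -- k c.
  refine h0 (eq_zero_of_infinite_isRoot _ (Set.infinite_of_injective_forall_mem
    (f := fun k : ℕ => μ + k * c) (fun a b hab => ?_) fun k => ?_))
  · simpa [hc] using hab
  · by_contra h1
    exact H k ((h k).eq_zero h1 (by rw [minpoly.aeval, LinearMap.zero_apply]))

lemma exists_e_pow_eq_zero [Module.Finite ℂ M] {μ : ℂ} {v : M} (hv : IsGenEig S.h μ v) :
    ∃ k : ℕ, (S.e ^ k) v = 0 :=
  S.exists_pow_eq_zero one_ne_zero (μ := μ) fun k => by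
    induction k with
    | zero => simpa using hv
    | succ k ih =>
      rw [pow_succ', Module.End.mul_apply]
      convert S.isGenEig_e ih using 1
      push_cast; ring

lemma exists_f_pow_eq_zero [Module.Finite ℂ M] {μ : ℂ} {v : M} (hv : IsGenEig S.h μ v) :
    ∃ k : ℕ, (S.f ^ k) v = 0 :=
  S.exists_pow_eq_zero (neg_ne_zero.2 one_ne_zero) (μ := μ) fun k => by
    induction k with
    | zero => simpa using hv
    | succ k ih =>
      rw [pow_succ', Module.End.mul_apply]
      convert S.isGenEig_f ih using 1
      push_cast; ring

lemma h_f_pow (k : ℕ) (v : M) : S.h ((S.f ^ k) v) = (S.f ^ k) (S.h v - (k : ℂ) • v) := by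
  induction k with
  | zero => simp
  | succ k ih =>
    rw [pow_succ', Module.End.mul_apply, hf', ih, Module.End.mul_apply, ← map_sub, ← map_sub]
    congr 2
    push_cast
    rw [add_smul, one_smul]
    abel

lemma e_f_pow (k : ℕ) {v : M} (hv : S.e v = 0) : S.e ((S.f ^ (k + 1)) v) =
    (S.f ^ k) (((k : ℂ) + 1) • ((2 : ℂ) • S.h v - (k : ℂ) • v)) := by
  induction k with
  | zero => simp [ef', hv]
  | succ k ih =>
    rw [pow_succ', Module.End.mul_apply, ef', ih, ← Module.End.mul_apply, ← pow_succ', h_f_pow,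
      ← map_smul (S.f ^ (k + 1)), ← map_add]
    congr 1
    push_cast
    module

/-- The polynomial in `h` by which `e ^ k f ^ k` acts on vectors annihilated by `e`. -/
def polyEF (k : ℕ) : ℂ[X] := ∏ j ∈ Finset.range k, (C ((j : ℂ) + 1) * (C 2 * X - C (j : ℂ)))

lemma e_pow_f_pow (k : ℕ) {v : M} (hv : S.e v = 0) :
    (S.e ^ k) ((S.f ^ k) v) = aeval S.h (polyEF k) v := by
  induction k generalizing v with
  | zero => simp [polyEF]
  | succ k ih =>
    rw [pow_succ S.e, Module.End.mul_apply, S.e_f_pow k hv, ih, polyEF, polyEF,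
      Finset.prod_range_succ, map_mul, Module.End.mul_apply]
    · congr 1
      simp only [map_mul, map_sub, aeval_C, aeval_X, Module.End.mul_apply, LinearMap.sub_apply,
        Module.algebraMap_end_apply, smul_sub]
    · have : S.e (S.h v) = 0 := by
        have := S.he' v
        rw [hv, map_zero, add_zero] at this
        exact this.symm
      simp [hv, this]

/-- The zeros of `polyEF` are half-integers j/2 with j ≥ 0; away from them f-nilpotency forces v =
0. -/
lemma eq_zero_of_f_pow {k : ℕ} {v : M} (hv : S.e v = 0) {μ : ℂ} (h : S.h v = μ • v)
    (hμ : ∀ j : ℕ, 2 * μ ≠ j) (hk : (S.f ^ k) v = 0) : v = 0 := by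
  have h1 := S.e_pow_f_pow k hv
  rw [hk, map_zero] at h1
  refine (isGenEig_of_eq h).eq_zero (P := polyEF k) ?_ h1.symm
  rw [polyEF, eval_prod, Finset.prod_ne_zero_iff]
  intro j _
  simpa [sub_eq_zero, hμ j] using (by exact_mod_cast j.succ_ne_zero : (j : ℂ) + 1 ≠ 0)

variable [Module.Finite ℂ M] {r : ℕ} {m : M}

/-- On the last nonzero vector e^k m the Casimir equals h² + h, and h has the generalized eigenvalue
r/2 + k. Comparison with the prescribed eigenvalue gives k (r + k + 1) = 0, hence k = 0. -/
lemma e_eq_zero (h1 : IsGenEig S.h (r / 2) m) (h2 : IsGenEig S.Ω ((r / 2) ^ 2 + r / 2) m) :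
    S.e m = 0 := by
  classical
  have hex := S.exists_e_pow_eq_zero h1
  obtain ⟨k, hk⟩ : ∃ k, Nat.find hex = k := ⟨_, rfl⟩
  have hk0 := Nat.find_spec hex
  rw [hk] at hk0
  rcases k with _ | k
  · rw [pow_zero, Module.End.one_apply] at hk0
    rw [hk0, map_zero]
  have hk1 : (S.e ^ k) m ≠ 0 := Nat.find_min hex (by omega)
  have h3 : ∀ k : ℕ, IsGenEig S.h (r / 2 + k) ((S.e ^ k) m) := fun k => by
    induction k with
    | zero => simpa using h1
    | succ k ih =>
      rw [pow_succ', Module.End.mul_apply]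
      convert S.isGenEig_e ih using 1
      push_cast; ring
  have h4 : ∀ k : ℕ, IsGenEig S.Ω ((r / 2) ^ 2 + r / 2) ((S.e ^ k) m) := fun k =>
    h2.apply_of_commute (Commute.pow_right (LinearMap.ext fun v => S.Ω_e v) k)
  have key : ∀ (j : ℕ) (w : M), S.e w = 0 →
      aeval S.Ω ((X - C (((r : ℂ) / 2) ^ 2 + r / 2)) ^ j) w =
        aeval S.h (((X - C ((r : ℂ) / 2)) * (X + C ((r : ℂ) / 2 + 1))) ^ j) w := by
    intro j
    induction j with
    | zero => simp
    | succ j ih =>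
      intro w hw
      have hw' : S.e (S.h w) = 0 := by
        have := S.he' w
        rw [hw, map_zero, add_zero] at this
        exact this.symm
      have hw'' : S.e (S.h (S.h w)) = 0 := by
        have := S.he' (S.h w)
        rw [hw', map_zero, add_zero] at this
        exact this.symm
      have e1 : aeval S.h ((X - C ((r : ℂ) / 2)) * (X + C ((r : ℂ) / 2 + 1))) w =
          S.h (S.h w) + S.h w - (((r : ℂ) / 2) ^ 2 + r / 2) • w := by
        simp only [map_mul, map_sub, map_add, aeval_X, aeval_C, Module.End.mul_apply,
          LinearMap.sub_apply, LinearMap.add_apply, Module.algebraMap_end_apply, map_smul]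
        module
      have e2 : aeval S.Ω (X - C (((r : ℂ) / 2) ^ 2 + r / 2)) w =
          S.h (S.h w) + S.h w - (((r : ℂ) / 2) ^ 2 + r / 2) • w := by
        simp only [map_sub, aeval_X, aeval_C, LinearMap.sub_apply, Module.algebraMap_end_apply,
          Ω_apply, hw, map_zero, add_zero]
      rw [pow_succ (X - C _), pow_succ (_ * _), map_mul, map_mul, Module.End.mul_apply,
        Module.End.mul_apply, e1, e2,
        ih]
      simp [hw, hw', hw'']
  obtain ⟨j, hj⟩ := h4 k
  rw [key j _ (by rw [← Module.End.mul_apply, ← pow_succ', hk0])] at hj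
  by_cases hk2 : k = 0
  · subst hk2; simpa using hk0
  · refine absurd ((h3 k).eq_zero ?_ hj) hk1
    simp only [eval_pow, eval_mul, eval_sub, eval_X, eval_C, eval_add, add_sub_cancel_left]
    refine pow_ne_zero _ (mul_ne_zero (by exact_mod_cast hk2) ?_)
    have : (r : ℂ) / 2 + k + (r / 2 + 1) = ((r + k + 1 : ℕ) : ℂ) := by push_cast; ring
    rw [this]
    exact Nat.cast_ne_zero.2 (by omega)

/-- For large N one has 0 = e^N f^N m, which is `polyEF` N evaluated at h and applied to m. The
factor j = r gives a simple zero at r/2, and the remaining factors act injectively on the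
generalized eigenspace. So h has no Jordan block at m. -/
lemma h_eq (h1 : IsGenEig S.h (r / 2) m) (he : S.e m = 0) : S.h m = ((r : ℂ) / 2) • m := by
  obtain ⟨k, hk⟩ := S.exists_f_pow_eq_zero h1
  have hk' : (S.f ^ (k + r + 1)) m = 0 := by
    rw [show k + r + 1 = r + 1 + k by ring, pow_add, Module.End.mul_apply, hk, map_zero]
  have h2 := S.e_pow_f_pow (k + r + 1) he
  rw [hk', map_zero, polyEF, ← Finset.prod_erase_mul _ _ (Finset.mem_range.2 (by omega : r < k + r
      + 1)),
    show C ((r : ℂ) + 1) * (C 2 * X - C (r : ℂ)) = C (2 * ((r : ℂ) + 1)) * (X - C ((r : ℂ) / 2)) by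
      rw [show C (r : ℂ) = C 2 * C ((r : ℂ) / 2) by rw [← C_mul]; congr 1; ring, C_mul]; ring,
    ← mul_assoc, map_mul, Module.End.mul_apply] at h2
  have h3 : aeval S.h (X - C ((r : ℂ) / 2)) m = S.h m - ((r : ℂ) / 2) • m := by simp
  rw [← sub_eq_zero, ← h3]
  have h4 : IsGenEig S.h (r / 2) (aeval S.h (X - C ((r : ℂ) / 2)) m) := by
    have := commute_aeval (Commute.refl S.h) X (X - C ((r : ℂ) / 2))
    rw [aeval_X] at this
    exact h1.apply_of_commute this
  refine h4.eq_zero ?_ h2.symm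
  rw [eval_mul, eval_prod, eval_C]
  have hr : (r : ℂ) + 1 ≠ 0 := by exact_mod_cast r.succ_ne_zero
  refine mul_ne_zero (Finset.prod_ne_zero_iff.2 fun j hj => ?_) (mul_ne_zero two_ne_zero hr)
  have hj' : (j : ℂ) + 1 ≠ 0 := by exact_mod_cast j.succ_ne_zero
  have hjr : (r : ℂ) ≠ j := by exact_mod_cast (Finset.ne_of_mem_erase hj).symm
  simp only [eval_mul, eval_C, eval_sub, eval_X]
  refine mul_ne_zero hj' ?_
  rw [mul_div_cancel₀ _ two_ne_zero]
  exact sub_ne_zero.2 hjr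

/-- The vector f^{r+1} m is again killed by e and has the negative weight −r/2 − 1, so it vanishes
by `eq_zero_of_f_pow`. -/
lemma f_pow_eq_zero (he : S.e m = 0) (hh : S.h m = ((r : ℂ) / 2) • m) : (S.f ^ (r + 1)) m = 0 := by
  obtain ⟨k, hk⟩ := S.exists_f_pow_eq_zero (isGenEig_of_eq hh)
  refine S.eq_zero_of_f_pow (k := k) (μ := (r : ℂ) / 2 - (r + 1)) ?_ ?_ ?_ ?_
  · rw [S.e_f_pow r he, hh, smul_smul, mul_div_cancel₀ _ two_ne_zero, sub_self, smul_zero, map_zero]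
  · rw [h_f_pow, hh, ← sub_smul, map_smul]; push_cast; rfl
  · intro j h
    have : ((r + 2 + j : ℕ) : ℂ) = 0 := by push_cast; linear_combination -h
    norm_cast at this
    omega
  · rw [← Module.End.mul_apply, ← pow_add, add_comm, pow_add, Module.End.mul_apply, hk, map_zero]

end Sl2Data

end Sl2

/-! ### Centrality of the quantum Casimir element and weight vectors in arbitrary modules. -/

section WeightVectors

variable {p : ℕ} {M : Type} [AddCommGroup M] [Module ℂ M] {a : Gen → Module.End ℂ M}

namespace IsRep

variable (ha : IsRep p a)

include ha

lemma K_mul_E : a .K * a .E = (q p ^ 2) • (a .E * a .K) := by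
  have h := congrArg (· * a .K) (ha .KE)
  simp only [mul_assoc, ha .Kinv_mul_K, mul_one, smul_mul_assoc] at h
  exact h

lemma K_mul_F : a .K * a .F = ((q p)⁻¹ ^ 2) • (a .F * a .K) := by
  have h := congrArg (· * a .K) (ha .KF)
  simp only [mul_assoc, ha .Kinv_mul_K, mul_one, smul_mul_assoc] at h
  exact h

/-- Commutation with `K` up to a scalar gives commutation with `K⁻¹`. -/
lemma Kinv_mul {T : Module.End ℂ M} {c : ℂ} (hc : c ≠ 0) (h : a .K * T = c • (T * a .K)) :
    a .Kinv * T = c⁻¹ • (T * a .Kinv) := by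
  have h1 := congrArg (fun U => a .Kinv * U * a .Kinv) h
  simp only [mul_smul_comm, smul_mul_assoc, mul_assoc, ha .K_mul_Kinv, mul_one] at h1
  rw [← mul_assoc, ha .Kinv_mul_K, one_mul] at h1
  rw [h1, smul_smul, inv_mul_cancel₀ hc, one_smul]

lemma E_mul_F : a .E * a .F = a .F * a .E + (1 / (q p - (q p)⁻¹)) • (a .K - a .Kinv) := by
  rw [← ha .EF, add_sub_cancel]

lemma casimir_eq (hp : 2 ≤ p) : casimir p a =
    ((q p - (q p)⁻¹) ^ 2) • (a .F * a .E) + q p • a .K + (q p)⁻¹ • a .Kinv := by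
  rw [casimir, ha.E_mul_F, smul_add, smul_smul, show (q p - (q p)⁻¹) ^ 2 * (1 / (q p - (q p)⁻¹)) =
    q p - (q p)⁻¹ by have := q_sub_ne_zero hp; field_simp]
  module

lemma casimir_commute_K (hp : 2 ≤ p) : Commute (casimir p a) (a .K) := by
  have h0 : q p ≠ 0 := q_ne_zero
  have h1 : a .K * (a .F * a .E) = a .F * a .E * a .K := by
    rw [← mul_assoc, ha.K_mul_F, smul_mul_assoc, mul_assoc, ha.K_mul_E, mul_smul_comm, smul_smul,
      ← mul_assoc, ← mul_pow, inv_mul_cancel₀ h0, one_pow, one_smul]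
  rw [Commute, SemiconjBy, ha.casimir_eq hp]
  simp only [add_mul, mul_add, smul_mul_assoc, mul_smul_comm, h1, ha .K_mul_Kinv, ha .Kinv_mul_K]

lemma casimir_commute_E (hp : 2 ≤ p) : Commute (casimir p a) (a .E) := by
  have h0 : q p ≠ 0 := q_ne_zero
  have h1 := ha.K_mul_E
  have h2 := ha.Kinv_mul (pow_ne_zero 2 h0) h1
  have h3 : casimir p a * a .E = ((q p - (q p)⁻¹) ^ 2) • (a .E * (a .F * a .E)) +
      q p • (a .E * a .K) + (q p)⁻¹ • (a .E * a .Kinv) := by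
    have e1 : (q p)⁻¹ * q p ^ 2 = q p := by field_simp
    have e2 : q p * (q p ^ 2)⁻¹ = (q p)⁻¹ := by field_simp
    rw [casimir, add_mul, add_mul, smul_mul_assoc, smul_mul_assoc, smul_mul_assoc, h1, h2,
        smul_smul,
      smul_smul, mul_assoc, e1, e2]
  rw [Commute, SemiconjBy, h3, ha.casimir_eq hp, mul_add, mul_add, mul_smul_comm, mul_smul_comm,
    mul_smul_comm]

lemma casimir_commute_F (hp : 2 ≤ p) : Commute (casimir p a) (a .F) := by
  have h0 : q p ≠ 0 := q_ne_zero
  have h1 := ha.K_mul_F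
  have h2 := ha.Kinv_mul (pow_ne_zero 2 (inv_ne_zero h0)) h1
  have h3 : casimir p a * a .F = ((q p - (q p)⁻¹) ^ 2) • (a .F * (a .E * a .F)) +
      (q p)⁻¹ • (a .F * a .K) + q p • (a .F * a .Kinv) := by
    have e1 : q p * (q p)⁻¹ ^ 2 = (q p)⁻¹ := by field_simp
    have e2 : (q p)⁻¹ * ((q p)⁻¹ ^ 2)⁻¹ = q p := by field_simp
    rw [ha.casimir_eq hp, add_mul, add_mul, smul_mul_assoc, smul_mul_assoc, smul_mul_assoc, h1, h2,
      smul_smul, smul_smul, mul_assoc, e1, e2]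
  rw [Commute, SemiconjBy, h3, casimir, mul_add, mul_add, mul_smul_comm, mul_smul_comm,
    mul_smul_comm]

lemma Kinv_commute {T : Module.End ℂ M} (h : a .K * T = T * a .K) : a .Kinv * T = T * a .Kinv := by
  have := ha.Kinv_mul one_ne_zero (c := 1) (by rw [h, one_smul])
  simpa using this

lemma e_commute_K : Commute (a .K) (a .e) := sub_eq_zero.1 (ha .Ke)

lemma f_commute_K : Commute (a .K) (a .f) := sub_eq_zero.1 (ha .Kf)

/-- The only obstruction is E [F, e], and it vanishes because [F, e] ends in E^{p−1} and E passes
the powers of K up to scalars. For f the obstruction is [E, f] F, which contains F^p. -/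
lemma casimir_commute_e (hp : 2 ≤ p) : Commute (casimir p a) (a .e) := by
  have h1 : a .K * a .e = a .e * a .K := ha.e_commute_K
  have h2 := ha.Kinv_commute h1
  have h3 : a .E * a .e = a .e * a .E := sub_eq_zero.1 (ha .Ee)
  have h0 : q p ≠ 0 := q_ne_zero
  have hKE := ha.K_mul_E
  have hKE' := ha.Kinv_mul (pow_ne_zero 2 h0) hKE
  have h5 : ∀ k : ℕ, ∃ c : ℂ, a .E * a .K ^ k = c • (a .K ^ k * a .E) := by
    intro k
    induction k with
    | zero => exact ⟨1, by simp⟩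
    | succ k ih =>
      obtain ⟨c, hc⟩ := ih
      refine ⟨c * (q p ^ 2)⁻¹, ?_⟩
      rw [pow_succ, ← mul_assoc, hc, smul_mul_assoc, mul_assoc, mul_assoc, hKE, mul_smul_comm,
        smul_smul, mul_assoc, inv_mul_cancel₀ (pow_ne_zero 2 h0), mul_one]
  have h4 : a .E * (a .F * a .e - a .e * a .F) = 0 := by
    obtain ⟨c, hc⟩ := h5 p
    have h6 : a .E * elemT p a * a .E ^ (p - 1) = 0 := by
      have h7 : a .E * a .K = (q p ^ 2)⁻¹ • (a .K * a .E) := by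
        rw [hKE, smul_smul, inv_mul_cancel₀ (pow_ne_zero 2 h0), one_smul]
      have h8 : a .E * a .Kinv = (q p ^ 2) • (a .Kinv * a .E) := by
        rw [hKE', smul_smul, mul_inv_cancel₀ (pow_ne_zero 2 h0), one_smul]
      have h9 : a .E * a .E ^ (p - 1) = 0 := by
        rw [← pow_succ', show p - 1 + 1 = p by omega, ha .E_pow]
      rw [elemT, mul_smul_comm, mul_sub, mul_smul_comm, mul_smul_comm, h7, h8, smul_mul_assoc,
        sub_mul, smul_mul_assoc, smul_mul_assoc, smul_mul_assoc, smul_mul_assoc, mul_assoc,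
        mul_assoc, h9]
      simp
    rw [ha .Fe, mul_smul_comm, ← mul_assoc, ← mul_assoc, hc, smul_mul_assoc, smul_mul_assoc,
      mul_assoc (a .K ^ p), mul_assoc, h6, mul_zero, smul_zero, smul_zero]
  have h6 : a .E * a .F * a .e = a .e * (a .E * a .F) := by
    rw [mul_sub, sub_eq_zero] at h4
    rw [mul_assoc, h4, ← mul_assoc, h3, mul_assoc]
  rw [Commute, SemiconjBy, casimir]
  simp only [add_mul, mul_add, smul_mul_assoc, mul_smul_comm, h1, h2, h6]

lemma casimir_commute_f (hp : 2 ≤ p) : Commute (casimir p a) (a .f) := by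
  have h1 : a .K * a .f = a .f * a .K := ha.f_commute_K
  have h2 := ha.Kinv_commute h1
  have h3 : a .F * a .f = a .f * a .F := sub_eq_zero.1 (ha .Ff)
  have h0 : q p ≠ 0 := q_ne_zero
  have hKF := ha.K_mul_F
  have hKF' := ha.Kinv_mul (pow_ne_zero 2 (inv_ne_zero h0)) hKF
  have h4 : (a .E * a .f - a .f * a .E) * a .F = 0 := by
    have h9 : a .F ^ (p - 1) * a .F = 0 := by
      rw [← pow_succ, show p - 1 + 1 = p by omega, ha .F_pow]
    have h10 : a .F ^ (p - 1) * (elemT p a * a .F) = 0 := by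
      rw [elemT, smul_mul_assoc, sub_mul, smul_mul_assoc, smul_mul_assoc, hKF, hKF', mul_smul_comm,
        mul_sub, mul_smul_comm, mul_smul_comm, mul_smul_comm, mul_smul_comm, ← mul_assoc,
        ← mul_assoc, h9]
      simp
    rw [ha .Ef, smul_mul_assoc, mul_assoc, h10, smul_zero]
  have h6 : a .E * a .F * a .f = a .f * (a .E * a .F) := by
    rw [sub_mul, sub_eq_zero] at h4
    rw [mul_assoc, h3, ← mul_assoc, h4, mul_assoc]
  rw [Commute, SemiconjBy, casimir]
  simp only [add_mul, mul_add, smul_mul_assoc, mul_smul_comm, h1, h2, h6]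

/-- The `sl₂`-representation underlying a module. -/
def sl2 : Sl2Data M := ⟨a .e, a .f, a .h, ha .he, ha .hf, ha .ef⟩

lemma h_commute_of {T : Module.End ℂ M} (he : Commute T (a .e)) (hf : Commute T (a .f)) :
    Commute T (a .h) := by
  have h1 : a .h = (1 / 2 : ℂ) • (a .e * a .f - a .f * a .e) := by
    rw [ha .ef, smul_smul]; norm_num
  rw [h1]
  exact ((he.mul_right hf).sub_right (hf.mul_right he)).smul_right _

lemma commute_Ω {T : Module.End ℂ M} (he : Commute T (a .e)) (hf : Commute T (a .f)) :
    Commute T ha.sl2.Ω := by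
  have hh := ha.h_commute_of he hf
  exact ((hh.mul_right hh).add_right hh).add_right (hf.mul_right he)

end IsRep

/-- The vector `v` has weight index `n` and generalized Casimir eigenvalue `cas p α s`. -/
structure IsWt (p : ℕ) (a : Gen → Module.End ℂ M) (α : ℤˣ) (s : ℕ) (n : ZMod p) (v : M) : Prop where
  K : a .K v = kap p α s n • v
  gen : IsGenEig (casimir p a) (cas p α s) v

/-- The normalized nilpotent part of the Casimir operator. -/
def nil (p : ℕ) (a : Gen → Module.End ℂ M) (α : ℤˣ) (s : ℕ) : Module.End ℂ M :=
  ((q p - (q p)⁻¹) ^ 2)⁻¹ • (casimir p a - cas p α s • 1)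

namespace IsWt

variable {α : ℤˣ} {s : ℕ} {n : ZMod p} {v : M} (hv : IsWt p a α s n v)

lemma map {U : Module.End ℂ M} (hU : Commute (casimir p a) U) (hK : Commute (a .K) U)
    (hv : IsWt p a α s n v) : IsWt p a α s n (U v) :=
  ⟨by rw [← Module.End.mul_apply, hK.eq, Module.End.mul_apply, hv.K, map_smul],
    hv.gen.apply_of_commute hU⟩

variable (ha : IsRep p a) (hp : 2 ≤ p)

include ha hp

lemma E (hv : IsWt p a α s n v) : IsWt p a α s (n - 1) (a .E v) := by
  have : NeZero p := ⟨by omega⟩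
  refine ⟨?_, hv.gen.apply_of_commute (ha.casimir_commute_E hp)⟩
  rw [← Module.End.mul_apply, ha.K_mul_E, LinearMap.smul_apply, Module.End.mul_apply, hv.K,
    map_smul, smul_smul, kap_succ α s hp (n - 1), sub_add_cancel]

lemma F (hv : IsWt p a α s n v) : IsWt p a α s (n + 1) (a .F v) := by
  have : NeZero p := ⟨by omega⟩
  refine ⟨?_, hv.gen.apply_of_commute (ha.casimir_commute_F hp)⟩
  rw [← Module.End.mul_apply, ha.K_mul_F, LinearMap.smul_apply, Module.End.mul_apply, hv.K,
    map_smul, smul_smul, kap_succ α s hp n, ← mul_assoc, ← mul_pow, inv_mul_cancel₀ q_ne_zero,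
    one_pow, one_mul]

lemma E_pow (hv : IsWt p a α s n v) (k : ℕ) : IsWt p a α s (n - k) ((a .E ^ k) v) := by
  induction k with
  | zero => simpa using hv
  | succ k ih =>
    rw [pow_succ', Module.End.mul_apply]
    convert ih.E ha hp using 1
    push_cast; ring

lemma F_pow (hv : IsWt p a α s n v) (k : ℕ) : IsWt p a α s (n + k) ((a .F ^ k) v) := by
  induction k with
  | zero => simpa using hv
  | succ k ih =>
    rw [pow_succ', Module.End.mul_apply]
    convert ih.F ha hp using 1
    push_cast; ring

omit hp in
lemma Kinv (hv : IsWt p a α s n v) : a .Kinv v = (kap p α s n)⁻¹ • v := by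
  have h := congrArg (a .Kinv) hv.K
  rw [← Module.End.mul_apply, ha .Kinv_mul_K, Module.End.one_apply, map_smul] at h
  rw [eq_inv_smul_iff₀ (kap_ne_zero α s n), ← h]

lemma F_E (hv : IsWt p a α s n v) : a .F (a .E v) = co p α s n • v + nil p a α s v := by
  have : NeZero p := ⟨by omega⟩
  have h := LinearMap.congr_fun (ha.casimir_eq hp) v
  have hc : (q p - (q p)⁻¹) ^ 2 ≠ 0 := pow_ne_zero 2 (q_sub_ne_zero hp)
  simp only [LinearMap.add_apply, LinearMap.smul_apply, Module.End.mul_apply, hv.K,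
    hv.Kinv ha, smul_smul] at h
  rw [← smul_right_inj hc, nil, LinearMap.smul_apply, smul_add, smul_smul, smul_smul,
      mul_inv_cancel₀ hc,
    one_smul, co_eq α s hp n, LinearMap.sub_apply, h, LinearMap.smul_apply, Module.End.one_apply]
  module

lemma E_F (hv : IsWt p a α s n v) : a .E (a .F v) = co p α s (n + 1) • v + nil p a α s v := by
  have : NeZero p := ⟨by omega⟩
  have h : casimir p a v = _ := rfl
  have hc : (q p - (q p)⁻¹) ^ 2 ≠ 0 := pow_ne_zero 2 (q_sub_ne_zero hp)
  rw (occs := .pos [2]) [casimir] at h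
  simp only [LinearMap.add_apply, LinearMap.smul_apply, Module.End.mul_apply, hv.K,
    hv.Kinv ha, smul_smul] at h
  rw [← smul_right_inj hc, nil, LinearMap.smul_apply, smul_add, smul_smul, smul_smul,
      mul_inv_cancel₀ hc,
    one_smul, LinearMap.sub_apply, h, LinearMap.smul_apply, Module.End.one_apply, ← cas_eq α s hp n]
  module

-- On a generalized eigenvector of the Casimir, `nil` acts nilpotently, so a nonzero scalar plus
-- `nil` is injective. Hence E and F are injective on the weight spaces at the arrows that are not
-- junctions.
omit ha in
lemma eq_zero_of_co (hv : IsWt p a α s n v) {c : ℂ} (hc : c ≠ 0) (h : c • v + nil p a α s v = 0) :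
    v = 0 := by
  have hc' : (q p - (q p)⁻¹) ^ 2 ≠ 0 := pow_ne_zero 2 (q_sub_ne_zero hp)
  refine hv.gen.eq_zero (P := X - C (cas p α s - (q p - (q p)⁻¹) ^ 2 * c)) ?_ ?_
  · simp only [eval_sub, eval_X, eval_C, sub_sub_cancel]
    exact mul_ne_zero hc' hc
  · rw [nil, ← smul_right_inj hc', smul_zero, LinearMap.smul_apply, smul_add, smul_smul, smul_smul,
      mul_inv_cancel₀ hc', one_smul, LinearMap.sub_apply, LinearMap.smul_apply,
      Module.End.one_apply] at h
    rw [map_sub, aeval_X, aeval_C, LinearMap.sub_apply, Module.algebraMap_end_apply, ← h]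
    module

lemma eq_zero_of_E_pow (hv : IsWt p a α s n v) {k : ℕ} (hk : ∀ i < k, co p α s (n - (i : ℕ)) ≠ 0)
    (h : (a .E ^ k) v = 0) : v = 0 := by
  induction k generalizing n v with
  | zero => simpa using h
  | succ k ih =>
    have h1 : a .E v = 0 := by
      refine ih (hv.E ha hp) (fun i hi => ?_) ?_
      · have := hk (i + 1) (by omega)
        push_cast at this
        rwa [sub_sub, add_comm 1]
      · rwa [← Module.End.mul_apply, ← pow_succ]
    refine hv.eq_zero_of_co hp (c := co p α s n) ?_ ?_
    · simpa using hk 0 (by omega)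
    · rw [← hv.F_E ha hp, h1, map_zero]

lemma eq_zero_of_F_pow (hv : IsWt p a α s n v) {k : ℕ}
    (hk : ∀ i < k, co p α s (n + 1 + (i : ℕ)) ≠ 0) (h : (a .F ^ k) v = 0) : v = 0 := by
  induction k generalizing n v with
  | zero => simpa using h
  | succ k ih =>
    have h1 : a .F v = 0 := by
      refine ih (hv.F ha hp) (fun i hi => ?_) ?_
      · have := hk (i + 1) (by omega)
        push_cast at this
        rwa [add_assoc (n + 1), add_comm 1]
      · rwa [← Module.End.mul_apply, ← pow_succ]
    refine hv.eq_zero_of_co hp (c := co p α s (n + 1)) ?_ ?_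
    · simpa using hk 0 (by omega)
    · rw [← hv.E_F ha hp, h1, map_zero]

end IsWt

lemma IsRep.nil_commute_E (ha : IsRep p a) (hp : 2 ≤ p) (α : ℤˣ) (s : ℕ) :
    Commute (nil p a α s) (a .E) :=
  (((ha.casimir_commute_E hp)).sub_left ((Commute.one_left _).smul_left _)).smul_left _

lemma IsRep.nil_commute_F (ha : IsRep p a) (hp : 2 ≤ p) (α : ℤˣ) (s : ℕ) :
    Commute (nil p a α s) (a .F) :=
  (((ha.casimir_commute_F hp)).sub_left ((Commute.one_left _).smul_left _)).smul_left _

lemma IsRep.casimir_commute_nil (p : ℕ) (a : Gen → Module.End ℂ M) (α : ℤˣ) (s : ℕ) :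
    Commute (casimir p a) (nil p a α s) :=
  (((Commute.refl _)).sub_right ((Commute.one_right _).smul_right _)).smul_right _

lemma IsWt.nil {α : ℤˣ} {s : ℕ} {n : ZMod p} {v : M} (ha : IsRep p a) (hp : 2 ≤ p)
    (hv : IsWt p a α s n v) : IsWt p a α s n (nil p a α s v) :=
  hv.map (IsRep.casimir_commute_nil p a α s)
    ((((ha.casimir_commute_K hp).symm).sub_right ((Commute.one_right _).smul_right _)).smul_right _)

end WeightVectors

/-! ### Consequences of the relations for a vector of weight index 0. -/

section WeightZero

variable {p : ℕ}

lemma neg_natCast_of_add {i j : ℕ} (h : i + j = p) : -(i : ZMod p) = j := by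
  rw [neg_eq_iff_add_eq_zero, ← Nat.cast_add, h, ZMod.natCast_self]

/-- The coefficient in the commutator of `e` and `F ^ s`. -/
def comm (p : ℕ) (α : ℤˣ) (s : ℕ) : ℂ :=
  1 / qFact p (p - 1) * (kap p α s (s : ZMod p) ^ p * (1 / (q p - (q p)⁻¹) *
    (q p * kap p α s (s : ZMod p) - (q p)⁻¹ * (kap p α s (s : ZMod p))⁻¹))) *
    ∏ i ∈ Finset.range (s - 1), co p α s ((i + 1 : ℕ) : ZMod p)

/-- `comm` contains the product of the coefficients below s, and the product above s is supplied
here, so `prod_co` applies. The identity expresses that the constants met in going around the cycle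
are consistent. -/
lemma comm_mul (hp : 2 ≤ p) (α : ℤˣ) {s : ℕ} (hs1 : 1 ≤ s) (hs : s < p) : comm p α s * dlt p α s *
    ∏ i ∈ Finset.range (p - s - 1), co p α s ((s + 1 + i : ℕ) : ZMod p) = 1 := by
  have h1 := prod_co (p := p) α s hp hs1 hs
  have hU : (Finset.Icc 1 (p - 1)).erase s = Finset.Ico 1 s ∪ Finset.Ico (s + 1) p := by
    ext k; simp; omega
  have hD : Disjoint (Finset.Ico 1 s) (Finset.Ico (s + 1) p) := by
    rw [Finset.disjoint_left]; intro k; simp; omega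
  rw [hU, Finset.prod_union hD, Finset.prod_Ico_eq_prod_range, Finset.prod_Ico_eq_prod_range,
    ← Nat.sub_sub] at h1
  have hQ := qFact_ne_zero (p := p) hp
  rw [comm, elemT_coef_self hp, kap_pow hp, dlt]
  simp only [add_comm _ 1, add_assoc] at h1 ⊢
  set A := ∏ i ∈ Finset.range (s - 1), co p α s ((1 + i : ℕ) : ZMod p)
  set B := ∏ i ∈ Finset.range (p - s - 1), co p α s ((1 + (s + i) : ℕ) : ZMod p)
  have hB : ∏ i ∈ Finset.range (p - s - 1), co p α s ((s + (1 + i) : ℕ) : ZMod p) = B :=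
    Finset.prod_congr rfl fun i _ => by rw [show s + (1 + i) = 1 + (s + i) by ring]
  have hσ : sgn α * sgn α = 1 := sgn_mul_self
  have hm : ((-1 : ℂ)) ^ (1 + s) * (-1) ^ (1 + p) * (-1) ^ (p - 1 - s) = -1 := by
    rw [← pow_add, ← pow_add]
    exact Odd.neg_one_pow ⟨p, by omega⟩
  have hσp : sgn α ^ p * sgn α ^ p = 1 := by rw [← mul_pow, hσ, one_pow]
  simp only [hB] at *
  have hQ' := mul_inv_cancel₀ hQ
  rw [one_div, div_eq_mul_inv]
  generalize sgn α ^ p = σ at *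
  generalize ((-1 : ℂ)) ^ (1 + s) = m₁ at *
  generalize ((-1 : ℂ)) ^ (1 + p) = m₂ at *
  generalize ((-1 : ℂ)) ^ (p - 1 - s) = m₃ at *
  generalize (qFact p (p - 1))⁻¹ = R at *
  generalize qFact p (p - 1) = Q at *
  linear_combination -(R ^ 2 * σ * m₁ * m₂ * sgn α ^ 2) * h1 -
    (R ^ 2 * σ ^ 2 * m₁ * m₂ * m₃ * Q ^ 2) * hσ - (R ^ 2 * m₁ * m₂ * m₃ * Q ^ 2) * hσp -
    (R ^ 2 * Q ^ 2) * hm + (Q * R + 1) * hQ'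

variable {M : Type} [AddCommGroup M] [Module ℂ M] {a : Gen → Module.End ℂ M}

lemma IsWt.elemT {α : ℤˣ} {s : ℕ} {n : ZMod p} {v : M} (ha : IsRep p a) (hv : IsWt p a α s n v) :
    elemT p a v = (1 / (q p - (q p)⁻¹) * (q p * kap p α s n - (q p)⁻¹ * (kap p α s n)⁻¹)) • v := by
  simp only [LUq.elemT, LinearMap.smul_apply, LinearMap.sub_apply, hv.K, hv.Kinv ha, smul_smul,
    ← sub_smul]

lemma IsWt.K_pow {α : ℤˣ} {s : ℕ} {n : ZMod p} {v : M} (hv : IsWt p a α s n v) (k : ℕ) :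
    (a .K ^ k) v = kap p α s n ^ k • v := by
  induction k with
  | zero => simp
  | succ k ih => rw [pow_succ, Module.End.mul_apply, hv.K, map_smul, ih, smul_smul, pow_succ']

namespace IsWt

variable {α : ℤˣ} {s : ℕ} {v : M} (ha : IsRep p a) (hp : 2 ≤ p) (hs1 : 1 ≤ s) (hs : s < p)
  (hv : IsWt p a α s 0 v)

include ha hp hs1 hs hv

/-- From index s − 1 the remaining s − 1 applications of E meet only nonzero coefficients, so E^p =
0 already forces E^{p−s+1} v = 0. -/
lemma E_pow_eq_zero {j : ℕ} (hj : p - s + 1 ≤ j) : (a .E ^ j) v = 0 := by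
  have h1 : (a .E ^ (p - s + 1)) v = 0 := by
    refine (hv.E_pow ha hp (p - s + 1)).eq_zero_of_E_pow ha hp (k := s - 1) (fun i hi => ?_) ?_
    · have e : (0 : ZMod p) - ((p - s + 1 : ℕ) : ZMod p) - (i : ℕ) = ((s - 1 - i : ℕ) : ZMod p) :=
        by
        rw [← neg_natCast_of_add (i := p - s + 1 + i) (j := s - 1 - i) (by omega)]; push_cast; ring
      rw [e]
      exact co_natCast_ne_zero α s hp hs (by omega) (by omega) (by omega)
    · rw [← Module.End.mul_apply, ← pow_add, show s - 1 + (p - s + 1) = p by omega, ha .E_pow,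
        LinearMap.zero_apply]
  rw [← Nat.sub_add_cancel hj, pow_add, Module.End.mul_apply, h1, map_zero]

/-- At the index s the coefficient vanishes and FE is `nil`, which kills E^{p−s} v because E^{p−s+1}
v = 0. Injectivity of E between p − 1 and s carries this back to E v. -/
lemma nil_E : LUq.nil p a α s (a .E v) = 0 := by
  refine ((hv.E ha hp).nil ha hp).eq_zero_of_E_pow ha hp (k := p - s - 1) (fun i hi => ?_) ?_
  · have e : (0 : ZMod p) - 1 - (i : ℕ) = ((p - 1 - i : ℕ) : ZMod p) := by
      rw [← neg_natCast_of_add (i := 1 + i) (j := p - 1 - i) (by omega)]; push_cast; ring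
    rw [e]
    exact co_natCast_ne_zero α s hp hs (by omega) (by omega) (by omega)
  · have h1 := (hv.E_pow ha hp (p - s)).F_E ha hp
    rw [← Module.End.mul_apply (a .E), ← pow_succ', hv.E_pow_eq_zero ha hp hs1 hs le_rfl, map_zero,
      zero_sub, neg_natCast_of_add (show p - s + s = p by omega), co_self α s hp, zero_smul,
      zero_add] at h1
    rw [← Module.End.mul_apply, ← ((ha.nil_commute_E hp α s).pow_right _).eq, Module.End.mul_apply,
      ← Module.End.mul_apply (a .E ^ _), ← pow_succ, show p - s - 1 + 1 = p - s by omega, ← h1]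

/-- The same argument with F: at the index p − 1 the operator EF is `nil`, F^p = 0, and F is
injective between s and p − 1. -/
lemma nil_F_pow : LUq.nil p a α s ((a .F ^ s) v) = 0 := by
  refine ((hv.F_pow ha hp s).nil ha hp).eq_zero_of_F_pow ha hp (k := p - s - 1) (fun i hi => ?_) ?_
  · have e : (0 : ZMod p) + (s : ℕ) + 1 + (i : ℕ) = ((s + 1 + i : ℕ) : ZMod p) := by
      push_cast; ring
    rw [e]
    exact co_natCast_ne_zero α s hp hs (by omega) (by omega) (by omega)
  · have h1 := (hv.F_pow ha hp (p - 1)).E_F ha hp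
    rw [← Module.End.mul_apply (a .F), ← pow_succ', show p - 1 + 1 = p by omega, ha .F_pow,
      LinearMap.zero_apply, map_zero, natCast_pred hp, zero_add, sub_add_cancel, co_zero, zero_smul,
      zero_add] at h1
    rw [← Module.End.mul_apply, ← ((ha.nil_commute_F hp α s).pow_right _).eq, Module.End.mul_apply,
      ← Module.End.mul_apply (a .F ^ _), ← pow_add, show p - s - 1 + s = p - 1 by omega, ← h1]

omit hs1 hs in
lemma nil_eq : LUq.nil p a α s v = a .F (a .E v) := by
  rw [hv.F_E ha hp, co_zero, zero_smul, zero_add]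

lemma F_pow_E {n : ℕ} (hn : s + 1 ≤ n) : (a .F ^ n) (a .E v) = 0 := by
  have h1 : (a .F ^ (s + 1)) (a .E v) = 0 := by
    rw [pow_succ, Module.End.mul_apply, ← hv.nil_eq ha hp, ← Module.End.mul_apply,
      ← ((ha.nil_commute_F hp α s).pow_right _).eq, Module.End.mul_apply, hv.nil_F_pow ha hp hs1 hs]
  rw [← Nat.sub_add_cancel hn, pow_add, Module.End.mul_apply, h1, map_zero]

omit hs1 hs in
lemma E_F_pow (k : ℕ) : a .E ((a .F ^ (k + 1)) v) =
    co p α s ((k + 1 : ℕ) : ZMod p) • (a .F ^ k) v + (a .F ^ (k + 1)) (a .E v) := by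
  rw [pow_succ', Module.End.mul_apply, (hv.F_pow ha hp k).E_F ha hp, zero_add, ← Nat.cast_succ,
    ← Module.End.mul_apply (LUq.nil p a α s), ((ha.nil_commute_F hp α s).pow_right _).eq,
    Module.End.mul_apply, hv.nil_eq ha hp, ← Module.End.mul_apply (a .F ^ k), ← pow_succ, pow_succ']

lemma E_F_pow_E (k : ℕ) : a .E ((a .F ^ (k + 1)) (a .E v)) =
    co p α s (k : ZMod p) • (a .F ^ k) (a .E v) := by
  rw [pow_succ', Module.End.mul_apply, ((hv.E ha hp).F_pow ha hp k).E_F ha hp,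
    show (0 : ZMod p) - 1 + k + 1 = k by ring,
    ← Module.End.mul_apply (LUq.nil p a α s), ((ha.nil_commute_F hp α s).pow_right _).eq,
    Module.End.mul_apply, hv.nil_E ha hp hs1 hs, map_zero, add_zero]

lemma F_E_pow (j : ℕ) : a .F ((a .E ^ (j + 2)) v) =
    co p α s (-((j + 1 : ℕ) : ZMod p)) • (a .E ^ (j + 1)) v := by
  rw [pow_succ', Module.End.mul_apply, (hv.E_pow ha hp (j + 1)).F_E ha hp, zero_sub,
    pow_succ (a .E) j, Module.End.mul_apply,
    ← Module.End.mul_apply (LUq.nil p a α s), ((ha.nil_commute_E hp α s).pow_right _).eq,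
    Module.End.mul_apply, hv.nil_E ha hp hs1 hs, map_zero, add_zero]

lemma E_pow_F_pow_E (j : ℕ) : (a .E ^ j) ((a .F ^ j) (a .E v)) =
    (∏ i ∈ Finset.range j, co p α s (i : ZMod p)) • a .E v := by
  induction j with
  | zero => simp
  | succ j ih =>
    rw [pow_succ (a .E), Module.End.mul_apply, hv.E_F_pow_E ha hp hs1 hs, map_smul, ih, smul_smul,
      Finset.prod_range_succ, mul_comm]

lemma E_pow_F_pow (j : ℕ) : (a .E ^ (j + 1)) ((a .F ^ j) v) =
    (∏ i ∈ Finset.range j, co p α s ((i + 1 : ℕ) : ZMod p)) • a .E v := by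
  induction j with
  | zero => simp
  | succ j ih =>
    rw [pow_succ (a .E), Module.End.mul_apply, hv.E_F_pow ha hp, map_add, map_smul, ih,
      hv.E_pow_F_pow_E ha hp hs1 hs, Finset.prod_range_succ', Nat.cast_zero, co_zero, mul_zero,
      zero_smul, add_zero, smul_smul, Finset.prod_range_succ, mul_comm]

lemma E_pow_pred_F_pow {j : ℕ} (hj : j + 2 ≤ p) : (a .E ^ (p - 1)) ((a .F ^ j) v) =
    (∏ i ∈ Finset.range j, co p α s ((i + 1 : ℕ) : ZMod p)) • (a .E ^ (p - 1 - j)) v := by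
  rw [show p - 1 = p - 2 - j + (j + 1) by omega, pow_add, Module.End.mul_apply,
    hv.E_pow_F_pow ha hp hs1 hs, map_smul, ← Module.End.mul_apply, ← pow_succ]
  congr 3
  omega

lemma E_pow_pred_F_pow_E {j : ℕ} (hj : j + 1 ≤ p) : (a .E ^ (p - 1)) ((a .F ^ j) (a .E v)) = 0 := by
  rw [show p - 1 = p - 1 - j + j by omega, pow_add, Module.End.mul_apply,
    hv.E_pow_F_pow_E ha hp hs1 hs, map_smul, ← Module.End.mul_apply, ← pow_succ]
  rcases j with _ | j
  · rw [show p - 1 - 0 + 1 = p by omega, ha .E_pow, LinearMap.zero_apply, smul_zero]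
  · rw [Finset.prod_range_succ', Nat.cast_zero, co_zero, mul_zero, zero_smul]

omit hp hs1 hs hv in
lemma e_F (w : M) : a .e (a .F w) = a .F (a .e w) - (1 / qFact p (p - 1)) •
    (a .K ^ p) (LUq.elemT p a ((a .E ^ (p - 1)) w)) := by
  have := LinearMap.congr_fun (ha .Fe) w
  simp only [LinearMap.sub_apply, Module.End.mul_apply, LinearMap.smul_apply] at this
  rw [← this, sub_sub_cancel]

omit hp hs1 hs hv in
lemma f_E (w : M) : a .f (a .E w) = a .E (a .f w) - ((-1) ^ (p + 1) / qFact p (p - 1)) •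
    (a .F ^ (p - 1)) (LUq.elemT p a w) := by
  have := LinearMap.congr_fun (ha .Ef) w
  simp only [LinearMap.sub_apply, Module.End.mul_apply, LinearMap.smul_apply] at this
  rw [← this, sub_sub_cancel]

lemma e_F_pow_of_lt {k : ℕ} (hk : k < s) : a .e ((a .F ^ k) v) = (a .F ^ k) (a .e v) := by
  induction k with
  | zero => rfl
  | succ k ih =>
    rw [pow_succ', Module.End.mul_apply, e_F ha, ih (by omega),
      hv.E_pow_pred_F_pow ha hp hs1 hs (by omega), hv.E_pow_eq_zero ha hp hs1 hs (by omega)]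
    simp

/-- Only the crossing of the junction s produces a commutator term, since E^{p−1} F^{s−1} v is a
multiple of E^{p−s} v. Later steps contain the coefficient at s, which is zero. -/
lemma e_F_pow {j : ℕ} (hj : s + j < p) : a .e ((a .F ^ (s + j)) v) = (a .F ^ (s + j)) (a .e v) -
    comm p α s • (a .F ^ j) ((a .E ^ (p - s)) v) := by
  induction j with
  | zero =>
    have hw := hv.E_pow ha hp (p - s)
    rw [zero_sub, neg_natCast_of_add (show p - s + s = p by omega)] at hw
    have e : p - 1 - (s - 1) = p - s := by omega
    rw [add_zero, ← Nat.sub_add_cancel hs1, pow_succ', Module.End.mul_apply, e_F ha,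
      Nat.sub_add_cancel hs1,
      hv.e_F_pow_of_lt ha hp hs1 hs (by omega), hv.E_pow_pred_F_pow ha hp hs1 hs (by omega), e,
      map_smul, map_smul, hw.elemT ha, map_smul, hw.K_pow]
    simp only [smul_smul, pow_zero, Module.End.one_apply, Module.End.mul_apply, comm]
    congr 2
    ring
  | succ j ih =>
    have h1 : ∏ i ∈ Finset.range (s + j), co p α s ((i + 1 : ℕ) : ZMod p) = 0 :=
      Finset.prod_eq_zero (Finset.mem_range.2 (by omega : s - 1 < s + j + 0 + 0))
        (by rw [Nat.sub_add_cancel hs1, co_self α s hp])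
    rw [← add_assoc, pow_succ', Module.End.mul_apply, e_F ha, ih (by omega),
      hv.E_pow_pred_F_pow ha hp hs1 hs (by omega), h1, zero_smul, map_zero, map_zero, smul_zero,
      sub_zero, map_sub, map_smul, ← Module.End.mul_apply, ← Module.End.mul_apply (a .F) (a .F ^ j),
      ← pow_succ', ← pow_succ']

lemma e_F_pow_E {k : ℕ} (hk : k ≤ p) : a .e ((a .F ^ k) (a .E v)) = (a .F ^ k) (a .E (a .e v)) := by
  induction k with
  | zero =>
    have := LinearMap.congr_fun (ha .Ee) v
    simp only [LinearMap.sub_apply, Module.End.mul_apply, LinearMap.zero_apply, sub_eq_zero] at this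
    simp [this]
  | succ k ih =>
    rw [pow_succ', Module.End.mul_apply, e_F ha, ih (by omega),
      hv.E_pow_pred_F_pow_E ha hp hs1 hs (by omega)]
    simp

omit hp hs1 hs hv in
lemma f_F_pow (k : ℕ) (w : M) : a .f ((a .F ^ k) w) = (a .F ^ k) (a .f w) := by
  have h : Commute (a .f) (a .F) := (sub_eq_zero.1 (ha .Ff)).symm
  exact LinearMap.congr_fun (h.pow_right k).eq w

omit hp hs1 hs hv in
lemma e_E_pow (k : ℕ) (w : M) : a .e ((a .E ^ k) w) = (a .E ^ k) (a .e w) := by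
  have h : Commute (a .e) (a .E) := (sub_eq_zero.1 (ha .Ee)).symm
  exact LinearMap.congr_fun (h.pow_right k).eq w

omit hs1 hs in
lemma f_E_v : a .f (a .E v) = a .E (a .f v) - dlt p α s • (a .F ^ (p - 1)) v := by
  rw [f_E ha, hv.elemT ha, map_smul, smul_smul]
  congr 2
  rw [elemT_coef_zero hp, dlt]
  ring

omit hs1 hs in
lemma f_F_pow_E {k : ℕ} (hk : 1 ≤ k) : a .f ((a .F ^ k) (a .E v)) = (a .F ^ k) (a .E (a .f v)) := by
  rw [f_F_pow ha, hv.f_E_v ha hp, map_sub, map_smul,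
    ← Module.End.mul_apply (a .F ^ k) (a .F ^ (p - 1)), ← pow_add,
        show k + (p - 1) = k - 1 + p by omega, pow_add, ha .F_pow, mul_zero,
    LinearMap.zero_apply, smul_zero, sub_zero]

lemma F_pow_E_pow {n j : ℕ} (hn : s + 1 ≤ n) : (a .F ^ (n + j)) ((a .E ^ (j + 1)) v) = 0 := by
  induction j with
  | zero => simpa using hv.F_pow_E ha hp hs1 hs hn
  | succ j ih =>
    rw [← add_assoc, pow_succ, Module.End.mul_apply, hv.F_E_pow ha hp hs1 hs, map_smul, ih,
      smul_zero]

/-- The commutator term arises at the first E; at the later ones F^{p−1} E^{j+1} v vanishes. -/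
lemma f_E_pow {j : ℕ} (hj : j + 1 ≤ p - s) : a .f ((a .E ^ (j + 1)) v) =
    (a .E ^ (j + 1)) (a .f v) - dlt p α s • (a .E ^ j) ((a .F ^ (p - 1)) v) := by
  induction j with
  | zero => simpa using hv.f_E_v ha hp
  | succ j ih =>
    have h1 : (a .F ^ (p - 1)) ((a .E ^ (j + 1)) v) = 0 := by
      have := hv.F_pow_E_pow ha hp hs1 hs (n := p - 1 - j) (j := j) (by omega)
      rwa [show p - 1 - j + j = p - 1 by omega] at this
    rw [pow_succ', Module.End.mul_apply, f_E ha, ih (by omega),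
      (hv.E_pow ha hp (j + 1)).elemT ha, map_smul, h1, smul_zero, smul_zero, sub_zero, map_sub,
      map_smul, ← Module.End.mul_apply, ← Module.End.mul_apply (a .E) (a .E ^ j), ← pow_succ',
      ← pow_succ']

lemma E_F_pow_of_le {k : ℕ} (hk : s ≤ k) : a .E ((a .F ^ (k + 1)) v) =
    co p α s ((k + 1 : ℕ) : ZMod p) • (a .F ^ k) v := by
  rw [hv.E_F_pow ha hp, hv.F_pow_E ha hp hs1 hs (by omega), add_zero]

lemma E_pow_F_pow_add (j : ℕ) : (a .E ^ j) ((a .F ^ (s + j)) v) =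
    (∏ i ∈ Finset.range j, co p α s ((s + 1 + i : ℕ) : ZMod p)) • (a .F ^ s) v := by
  induction j with
  | zero => simp
  | succ j ih =>
    rw [← add_assoc, pow_succ (a .E), Module.End.mul_apply, hv.E_F_pow_of_le ha hp hs1 hs (by
        omega), map_smul,
      ih, smul_smul, Finset.prod_range_succ, mul_comm, show s + 1 + j = s + j + 1 by ring]

lemma F_pow_E_pow_succ (j : ℕ) : (a .F ^ j) ((a .E ^ (j + 1)) v) =
    (∏ i ∈ Finset.range j, co p α s (-((i + 1 : ℕ) : ZMod p))) • a .E v := by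
  induction j with
  | zero => simp
  | succ j ih =>
    rw [pow_succ (a .F), Module.End.mul_apply, hv.F_E_pow ha hp hs1 hs, map_smul, ih, smul_smul,
      Finset.prod_range_succ, mul_comm]

lemma F_pow_E_pow_sub : (a .F ^ (p - s - 1)) ((a .E ^ (p - s)) v) =
    (∏ i ∈ Finset.range (p - s - 1), co p α s ((s + 1 + i : ℕ) : ZMod p)) • a .E v := by
  have h := hv.F_pow_E_pow_succ ha hp hs1 hs (p - s - 1)
  rw [show p - s - 1 + 1 = p - s by omega] at h
  rw [h, ← Finset.prod_range_reflect]
  congr 1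
  refine Finset.prod_congr rfl fun i hi => ?_
  rw [Finset.mem_range] at hi
  rw [neg_natCast_of_add (j := s + 1 + i) (by omega)]

end IsWt

end WeightZero

/-! ### Extension of a map from an sl(2)-module to a homomorphism from P. -/

section UniversalMap

variable {p : ℕ} {M : Type} [AddCommGroup M] [Module ℂ M] {a : Gen → Module.End ℂ M}

namespace IsWt

variable {α : ℤˣ} {s : ℕ} {v : M} (ha : IsRep p a) (hp : 2 ≤ p) (hs1 : 1 ≤ s) (hs : s < p)
  (hv : IsWt p a α s 0 v)

include ha hp hs1 hs hv

lemma E_F_pow_E_pow (j : ℕ) : a .E ((a .F ^ (j + 1)) ((a .E ^ (p - s)) v)) =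
    co p α s ((s + j + 1 : ℕ) : ZMod p) • (a .F ^ j) ((a .E ^ (p - s)) v) := by
  have h0 : LUq.nil p a α s ((a .E ^ (p - s)) v) = 0 := by
    rw [show p - s = p - s - 1 + 1 by omega, pow_succ, Module.End.mul_apply,
      ← Module.End.mul_apply (LUq.nil p a α s), ((ha.nil_commute_E hp α s).pow_right _).eq,
      Module.End.mul_apply, hv.nil_E ha hp hs1 hs, map_zero]
  rw [pow_succ', Module.End.mul_apply, ((hv.E_pow ha hp (p - s)).F_pow ha hp j).E_F ha hp, zero_sub,
    neg_natCast_of_add (show p - s + s = p by omega),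
    ← Module.End.mul_apply (LUq.nil p a α s), ((ha.nil_commute_F hp α s).pow_right _).eq,
    Module.End.mul_apply, h0, map_zero, add_zero]
  push_cast; rfl

lemma E_pow_F_pow_E_pow (j : ℕ) : (a .E ^ (j + 1)) ((a .F ^ j) ((a .E ^ (p - s)) v)) = 0 := by
  induction j with
  | zero =>
    rw [pow_zero, Module.End.one_apply, ← Module.End.mul_apply, ← pow_add,
      hv.E_pow_eq_zero ha hp hs1 hs (by omega)]
  | succ j ih =>
    rw [pow_succ, Module.End.mul_apply, hv.E_F_pow_E_pow ha hp hs1 hs, map_smul, ih, smul_zero]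

lemma e_F_pow_E_pow {j : ℕ} (hj : j < p) : a .e ((a .F ^ j) ((a .E ^ (p - s)) v)) =
    (a .F ^ j) ((a .E ^ (p - s)) (a .e v)) := by
  induction j with
  | zero => exact e_E_pow ha _ _
  | succ j ih =>
    rw [pow_succ', Module.End.mul_apply, e_F ha, ih (by omega),
        show p - 1 = p - 2 - j + (j + 1) by omega,
      pow_add (a .E) (p - 2 - j), Module.End.mul_apply, hv.E_pow_F_pow_E_pow ha hp hs1 hs]
    simp

/-- The constants cancel by `comm_mul`, and the term −F^{s+j} v matches the x-component of f on y in
`dataP`. -/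
lemma f_F_pow_E_pow (j : ℕ) : comm p α s • a .f ((a .F ^ j) ((a .E ^ (p - s)) v)) =
    comm p α s • (a .F ^ j) ((a .E ^ (p - s)) (a .f v)) - (a .F ^ (s + j)) v := by
  have h1 := hv.E_pow_F_pow_add ha hp hs1 hs (p - s - 1)
  have h2 := hv.f_E_pow ha hp hs1 hs (j := p - s - 1) (by omega)
  rw [show s + (p - s - 1) = p - 1 by omega] at h1
  rw [show p - s - 1 + 1 = p - s by omega] at h2
  rw [f_F_pow ha, h2, h1, map_sub, smul_sub, map_smul, map_smul, smul_smul, smul_smul,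
    mul_assoc, ← mul_assoc, comm_mul hp α hs1 hs, one_smul, ← Module.End.mul_apply (a .F ^ j) (a .F
        ^ s),
    ← pow_add, add_comm s]

end IsWt

variable {V : Type} [AddCommGroup V] [Module ℂ V]

/-- The component with index `k` of the homomorphism that extends `u`. -/
def extComp (p : ℕ) (α : ℤˣ) (s : ℕ) (a : Gen → Module.End ℂ M) (u : V →ₗ[ℂ] M) (k : ℕ) :
    ((V × V) × (V × V)) →ₗ[ℂ] M :=
  -- The constants are forced: `comm` comes from commuting e past F^s, and E · 1 = `dlt` · y at the
  -- junction 0 followed by F · y = xy gives the inverse of `dlt`.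
  if k < s then
    (a .F ^ k) ∘ₗ u ∘ₗ LinearMap.fst ℂ V V ∘ₗ LinearMap.fst ℂ _ _ +
      (dlt p α s)⁻¹ • ((a .F ^ (k + 1) * a .E) ∘ₗ u ∘ₗ LinearMap.snd ℂ V V ∘ₗ LinearMap.fst ℂ _ _)
  else
    (a .F ^ k) ∘ₗ u ∘ₗ LinearMap.fst ℂ V V ∘ₗ LinearMap.snd ℂ _ _ +
      comm p α s • ((a .F ^ (k - s) * a .E ^ (p - s)) ∘ₗ u ∘ₗ LinearMap.snd ℂ V V ∘ₗ
        LinearMap.snd ℂ _ _)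

/-- The homomorphism that extends `u`. -/
def extMap (p : ℕ) [NeZero p] (α : ℤˣ) (s : ℕ) (a : Gen → Module.End ℂ M) (u : V →ₗ[ℂ] M) :
    (ZMod p → (V × V) × (V × V)) →ₗ[ℂ] M :=
  ∑ n : ZMod p, extComp p α s a u n.val ∘ₗ LinearMap.proj n

variable {α : ℤˣ} {s : ℕ} {u : V →ₗ[ℂ] M}

lemma extComp_of_lt {k : ℕ} (hk : k < s) (d : (V × V) × (V × V)) : extComp p α s a u k d =
    (a .F ^ k) (u d.1.1) + (dlt p α s)⁻¹ • (a .F ^ (k + 1)) (a .E (u d.1.2)) := by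
  rw [extComp, if_pos hk]; rfl

lemma extComp_add (j : ℕ) (d : (V × V) × (V × V)) : extComp p α s a u (s + j) d =
    (a .F ^ (s + j)) (u d.2.1) + comm p α s • (a .F ^ j) ((a .E ^ (p - s)) (u d.2.2)) := by
  rw [extComp, if_neg (by omega), Nat.add_sub_cancel_left]; rfl

lemma extComp_self (d : (V × V) × (V × V)) : extComp p α s a u s d =
    (a .F ^ s) (u d.2.1) + comm p α s • (a .E ^ (p - s)) (u d.2.2) := by
  simpa using extComp_add (u := u) (s := s) (a := a) (α := α) 0 d

lemma extMap_apply [NeZero p] (φ : ZMod p → (V × V) × (V × V)) :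
    extMap p α s a u φ = ∑ n : ZMod p, extComp p α s a u n.val (φ n) := by
  simp [extMap]

variable {L : Sl2Data V}

section

variable (ha : IsRep p a) (hp : 2 ≤ p) (hs1 : 1 ≤ s) (hs : s < p)
  (hu : ∀ v, IsWt p a α s 0 (u v))

include ha hp hs1 hs hu

lemma extComp_F (n : ZMod p) (d : (V × V) × (V × V)) :
    extComp p α s a u (n + 1).val (opX s (dataP L) (n + 1) d) =
      a .F (extComp p α s a u n.val d) := by
  have : NeZero p := ⟨by omega⟩
  have hF : ∀ k w, a .F ((a .F ^ k) w) = (a .F ^ (k + 1)) w := fun k w => by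
    rw [pow_succ', Module.End.mul_apply]
  obtain ⟨k, hk, rfl⟩ := exists_natCast n
  rw [ZMod.val_cast_of_lt hk, opX]
  by_cases h : k + 1 < p
  · have e : ((k : ZMod p) + 1) = ((k + 1 : ℕ) : ZMod p) := by push_cast; rfl
    rw [e, ZMod.val_cast_of_lt h,
      if_congr ((junction_natCast h hs).trans (by omega : _ ↔ k + 1 = s)) rfl rfl]
    rcases lt_or_ge k s with hks | hks
    · rw [extComp_of_lt hks, map_add, map_smul, hF, hF]
      by_cases hks' : k + 1 = s
      -- The xy-component is killed by x, in accordance with F^{s+1} E = 0 on weight 0.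
      · rw [if_pos hks', (hu _).F_pow_E ha hp hs1 hs (by omega), hks', extComp_self]
        simp [dataP]
      · rw [if_neg hks', extComp_of_lt (by omega)]; rfl
    · obtain ⟨j, rfl⟩ := Nat.exists_eq_add_of_le hks
      rw [if_neg (by omega), extComp_add, add_assoc, extComp_add, map_add, map_smul, hF, hF]; rfl
  · have hk' : k + 1 = p := by omega
    have e : ((k : ZMod p) + 1) = 0 := by
      rw [← Nat.cast_succ, Nat.succ_eq_add_one, hk', ZMod.natCast_self]
    obtain ⟨j, rfl⟩ := Nat.exists_eq_add_of_le (show s ≤ k by omega)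
    have hj : j = p - s - 1 := by omega
    rw [e, ZMod.val_zero, extComp_of_lt (by omega), if_pos junction_zero, extComp_add, map_add,
      map_smul, hF, hk', ha .F_pow, hj, (hu _).F_pow_E_pow_sub ha hp hs1 hs, map_smul, smul_smul]
    -- Around the cycle F carries y into xy; the two normalizations agree by `comm_mul`.
    have hd : dlt p α s * (comm p α s *
        ∏ i ∈ Finset.range (p - s - 1), co p α s ((s + 1 + i : ℕ) : ZMod p)) = 1 := by
      rw [← comm_mul hp α hs1 hs]; ring
    rw [← eq_inv_of_mul_eq_one_right hd]
    simp [dataP]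

lemma extComp_E (n : ZMod p) (d : (V × V) × (V × V)) :
    extComp p α s a u n.val (opY α s (dataP L) (n + 1) d) =
      a .E (extComp p α s a u (n + 1).val d) := by
  have : NeZero p := ⟨by omega⟩
  have hδ : dlt p α s ≠ 0 := fun h => by
    have := comm_mul hp α hs1 hs
    rw [h, mul_zero, zero_mul] at this
    exact zero_ne_one this
  obtain ⟨k, hk, rfl⟩ := exists_natCast n
  rw [ZMod.val_cast_of_lt hk, opY, opZ]
  by_cases h : k + 1 < p
  · have e : ((k : ZMod p) + 1) = ((k + 1 : ℕ) : ZMod p) := by push_cast; rfl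
    rw [e, ZMod.val_cast_of_lt h, eta, ZMod.val_cast_of_lt h,
      if_congr ((junction_natCast h hs).trans (by omega : _ ↔ k + 1 = s)) rfl rfl]
    rcases lt_trichotomy (k + 1) s with hks | hks | hks
    · rw [if_pos hks, if_neg (by omega), extComp_of_lt hks, extComp_of_lt (by omega), map_add,
        map_smul, (hu _).E_F_pow ha hp, (hu _).E_F_pow_E ha hp hs1 hs]
      simp only [dataP, LinearMap.add_apply, LinearMap.smul_apply, Module.End.one_apply,
        Module.End.mul_apply, LinearMap.coe_mk, AddHom.coe_mk, Prod.fst_add, Prod.snd_add,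
        Prod.smul_fst, Prod.smul_snd, smul_zero, add_zero, map_add, map_smul, smul_add, smul_smul,
        inv_mul_cancel₀ hδ, one_smul]
      module
    · rw [if_neg (by omega), if_pos hks, hks, co_self α s hp, zero_smul, zero_add,
        extComp_of_lt (by omega), hks, extComp_self, map_add, map_smul,
        ← Module.End.mul_apply (a .E) (a .E ^ (p - s)), ← pow_succ',
        (hu _).E_pow_eq_zero ha hp hs1 hs le_rfl, ← hks, (hu _).E_F_pow ha hp, hks, co_self α s hp]
      simp [dataP, hδ]
    · obtain ⟨j, rfl⟩ := Nat.exists_eq_add_of_le (show s ≤ k by omega)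
      rw [if_neg (by omega), if_neg (by omega), add_assoc s, extComp_add, extComp_add, map_add,
        map_smul, ← add_assoc, (hu _).E_F_pow_of_le ha hp hs1 hs (by omega),
        (hu _).E_F_pow_E_pow ha hp hs1 hs]
      simp only [dataP, LinearMap.add_apply, LinearMap.smul_apply, Module.End.one_apply,
        Module.End.mul_apply, LinearMap.coe_mk, AddHom.coe_mk, Prod.snd_add,
        Prod.smul_fst, Prod.smul_snd, smul_zero, add_zero, map_smul, Prod.fst_add]
  · have hk' : k + 1 = p := by omega
    have e : ((k : ZMod p) + 1) = 0 := by
      rw [← Nat.cast_succ, Nat.succ_eq_add_one, hk', ZMod.natCast_self]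
    obtain ⟨j, rfl⟩ := Nat.exists_eq_add_of_le (show s ≤ k by omega)
    have hj : j = p - s - 1 := by omega
    have h0 : a .E (a .F (a .E (u d.1.2))) = 0 := by
      have := (hu d.1.2).E_F_pow_E ha hp hs1 hs 0
      rwa [Nat.cast_zero, co_zero, zero_smul, zero_add, pow_one] at this
    rw [e, ZMod.val_zero, extComp_of_lt (k := 0) (by omega), if_pos junction_zero, extComp_add,
        eta_zero hp hs1,
      co_zero, zero_smul, zero_add, zero_add, pow_one, map_add, map_smul, h0]
    simp only [dataP, LinearMap.smul_apply, LinearMap.coe_mk, AddHom.coe_mk, Prod.smul_fst,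
      Prod.smul_snd, smul_zero, map_zero, map_smul, zero_add, add_zero, pow_zero,
          Module.End.one_apply]
    rw [hj, (hu _).F_pow_E_pow_sub ha hp hs1 hs, smul_smul, smul_smul,
      comm_mul hp α hs1 hs, one_smul]

lemma extComp_e (he : ∀ v, a .e (u v) = u (L.e v)) {k : ℕ} (hk : k < p)
    (d : (V × V) × (V × V)) :
    extComp p α s a u k ((dataP L).e d) = a .e (extComp p α s a u k d) := by
  rcases lt_or_ge k s with hks | hks
  · rw [extComp_of_lt hks, extComp_of_lt hks, map_add, map_smul,
      (hu _).e_F_pow_of_lt ha hp hs1 hs hks,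
      (hu _).e_F_pow_E ha hp hs1 hs (by omega), he, he]
    rfl
  · obtain ⟨j, rfl⟩ := Nat.exists_eq_add_of_le hks
    rw [extComp_add, extComp_add, map_add, map_smul, (hu _).e_F_pow ha hp hs1 hs hk,
      (hu _).e_F_pow_E_pow ha hp hs1 hs (by omega), he, he]
    simp only [dataP, LinearMap.coe_mk, AddHom.coe_mk, map_sub]
    module

lemma extComp_f (hf : ∀ v, a .f (u v) = u (L.f v)) {k : ℕ} (d : (V × V) × (V × V)) :
    extComp p α s a u k ((dataP L).f d) = a .f (extComp p α s a u k d) := by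
  rcases lt_or_ge k s with hks | hks
  · rw [extComp_of_lt hks, extComp_of_lt hks, map_add, map_smul, IsWt.f_F_pow ha,
      (hu _).f_F_pow_E ha hp (by omega), hf, hf]
    rfl
  · obtain ⟨j, rfl⟩ := Nat.exists_eq_add_of_le hks
    rw [extComp_add, extComp_add, map_add, map_smul, IsWt.f_F_pow ha,
      (hu _).f_F_pow_E_pow ha hp hs1 hs, hf, hf]
    simp only [dataP, LinearMap.coe_mk, AddHom.coe_mk, map_sub]
    module

omit hs1 in
lemma K_extComp {k : ℕ} (d : (V × V) × (V × V)) :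
    a .K (extComp p α s a u k d) = kap p α s (k : ZMod p) • extComp p α s a u k d := by
  rcases lt_or_ge k s with hks | hks
  · have h1 := ((hu d.1.1).F_pow ha hp k).K
    have h2 := (((hu d.1.2).E ha hp).F_pow ha hp (k + 1)).K
    rw [zero_add] at h1
    rw [Nat.cast_succ, add_comm (k : ZMod p) 1, ← add_assoc, sub_add_cancel, zero_add] at h2
    rw [extComp_of_lt hks, map_add, map_smul, h1, h2, smul_add, smul_comm]
  · obtain ⟨j, rfl⟩ := Nat.exists_eq_add_of_le hks
    have h1 := ((hu d.2.1).F_pow ha hp (s + j)).K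
    have h2 := (((hu d.2.2).E_pow ha hp (p - s)).F_pow ha hp j).K
    rw [zero_add] at h1
    rw [zero_sub, neg_natCast_of_add (show p - s + s = p by omega), ← Nat.cast_add] at h2
    rw [extComp_add, map_add, map_smul, h1, h2, smul_add, smul_comm]

/-- A map `u` of `sl₂`-representations into the weight space of index `0` extends to a
homomorphism. -/
lemma extMap_actT [NeZero p] (he : ∀ v, a .e (u v) = u (L.e v)) (hf : ∀ v, a .f (u v) = u (L.f v))
    (g : Gen) (φ : ZMod p → (V × V) × (V × V)) :
    extMap p α s a u (actT α s (dataP L) g φ) = a g (extMap p α s a u φ) := by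
  have hEe : ∀ n : ZMod p, ∀ d, extComp p α s a u n.val ((dataP L).e d) =
      a .e (extComp p α s a u n.val d) := fun n d => extComp_e ha hp hs1 hs hu he n.val_lt d
  have hFf : ∀ n : ZMod p, ∀ d, extComp p α s a u n.val ((dataP L).f d) =
      a .f (extComp p α s a u n.val d) := fun n d => extComp_f ha hp hs1 hs hu hf d
  have hK : ∀ n : ZMod p, ∀ d, a .K (extComp p α s a u n.val d) =
      kap p α s n • extComp p α s a u n.val d := fun n d => by
    rw [K_extComp ha hp hs hu, ZMod.natCast_zmod_val]
  rw [extMap_apply, extMap_apply, map_sum]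
  cases g
  · rw [← Equiv.sum_comp (Equiv.addRight (1 : ZMod p)) (fun n => a .E _)]
    refine Finset.sum_congr rfl fun n _ => ?_
    rw [actT_E, extComp_E ha hp hs1 hs hu]; rfl
  · rw [← Equiv.sum_comp (Equiv.addRight (1 : ZMod p))]
    refine Finset.sum_congr rfl fun n _ => ?_
    rw [actT_F, Equiv.coe_addRight, add_sub_cancel_right, extComp_F ha hp hs1 hs hu]
  · refine Finset.sum_congr rfl fun n _ => ?_
    rw [actT_K, map_smul, hK]
  · refine Finset.sum_congr rfl fun n _ => ?_
    have h := congrArg (a .Kinv) (hK n (φ n))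
    rw [← Module.End.mul_apply, ha .Kinv_mul_K, Module.End.one_apply, map_smul] at h
    rw [actT_Kinv, map_smul, inv_smul_eq_iff₀ (kap_ne_zero α s n), ← h]
  · refine Finset.sum_congr rfl fun n _ => ?_
    rw [actT_e, hEe]
  · refine Finset.sum_congr rfl fun n _ => ?_
    rw [actT_f, hFf]
  · refine Finset.sum_congr rfl fun n _ => ?_
    -- Compatibility with h follows from that with e and f.
    have h1 := LinearMap.congr_fun (ha .ef) (extComp p α s a u n.val (φ n))
    have h2 := congrArg (extComp p α s a u n.val) (LinearMap.congr_fun (dataP L).ef (φ n))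
    rw [LinearMap.sub_apply, Module.End.mul_apply, Module.End.mul_apply,
        LinearMap.smul_apply] at h1 h2
    rw [map_sub, map_smul, hEe, hFf, hFf, hEe, h1] at h2
    rw [actT_h, (smul_right_injective M (two_ne_zero' ℂ)) h2]

omit ha hp hs hu in
lemma extMap_single [NeZero p] (b : V) :
    extMap p α s a u (Pi.single 0 ((b, 0), (0, 0))) = u b := by
  rw [extMap_apply, Finset.sum_eq_single 0]
  · rw [Pi.single_eq_same, ZMod.val_zero, extComp_of_lt (by omega)]
    simp
  · intro n _ hn
    rw [Pi.single_eq_of_ne hn, map_zero]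
  · simp

end

end UniversalMap

/-! ### Projectivity of P. -/

section Projectivity

open scoped ModuleCat

variable {p : ℕ}

section Lift

variable {M N : Type} [AddCommGroup M] [Module ℂ M] [AddCommGroup N] [Module ℂ N]
  {a : Gen → Module.End ℂ M} {b : Gen → Module.End ℂ N} {ψ : M →ₗ[ℂ] N}

lemma map_casimir_apply (hψ : ∀ g v, ψ (a g v) = b g (ψ v)) (v : M) :
    ψ (casimir p a v) = casimir p b (ψ v) := by
  simp [casimir, hψ]

lemma commute_aeval_right {T U : Module.End ℂ M} (h : Commute T U) (P : ℂ[X]) :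
    Commute T (aeval U P) := by
  have := commute_aeval h X P
  rwa [aeval_X] at this

/-- K satisfies the separable polynomial X^{2p} − 1, so honest eigenvectors lift. -/
lemma exists_lift_K (ha : IsRep p a) (hp : 2 ≤ p) (hψ : ∀ g v, ψ (a g v) = b g (ψ v)) (α : ℤˣ)
    (s : ℕ) {m : M} (hm : b .K (ψ m) = kap p α s 0 • ψ m) :
    ∃ m', a .K m' = kap p α s 0 • m' ∧ ψ m' = ψ m := by
  have hκ : kap p α s 0 ^ (2 * p) = 1 := by
    rw [mul_comm, pow_mul, kap_pow hp, mul_pow, ← pow_mul, ← pow_mul, mul_comm p, pow_mul,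
      pow_two, sgn_mul_self, one_pow, mul_comm (s + 1), pow_mul]
    simp
  obtain ⟨R, hR⟩ : X - C (kap p α s 0) ∣ (X ^ (2 * p) - 1 : ℂ[X]) := by
    rw [dvd_iff_isRoot, IsRoot, eval_sub, eval_pow, eval_X, eval_one, hκ, sub_self]
  have hR' : R.eval (kap p α s 0) ≠ 0 := by
    have h1 := congrArg (fun P => (derivative P).eval (kap p α s 0)) hR
    simp only [derivative_sub, derivative_mul, derivative_X_pow, derivative_one, derivative_X,
      derivative_C, sub_zero, one_mul, eval_add, eval_mul, eval_sub, eval_X, eval_C, sub_self,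
      zero_mul, add_zero, eval_pow] at h1
    rw [← h1]
    refine mul_ne_zero ?_ (pow_ne_zero _ (kap_ne_zero α s 0))
    simp
    omega
  obtain ⟨P, h1, h2⟩ := exists_lift (hψ .K) (k := 1) hR'
    (by rw [pow_one, ← hR, map_sub, map_pow, aeval_X, map_one, ha .K_pow, sub_self])
    (isGenEig_of_eq hm)
  refine ⟨_, ?_, h2⟩
  rwa [pow_one, map_sub, aeval_X, aeval_C, LinearMap.sub_apply, Module.algebraMap_end_apply,
    sub_eq_zero] at h1

/-- Highest weight vectors with prescribed generalized Casimir eigenvalue lift along surjections. -/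
lemma exists_lift_highest [Module.Finite ℂ M] (ha : IsRep p a) (hb : IsRep p b) (hp : 2 ≤ p)
    (hψ : ∀ g v, ψ (a g v) = b g (ψ v)) {α : ℤˣ} {s r : ℕ} {m : M}
    (hm : IsWt p b α s 0 (ψ m)) (he : b .e (ψ m) = 0) (hh : b .h (ψ m) = ((r : ℂ) / 2) • ψ m) :
    ∃ m', ψ m' = ψ m ∧ IsWt p a α s 0 m' ∧ a .e m' = 0 ∧ a .h m' = ((r : ℂ) / 2) • m' := by
  -- The conditions for K, the quantum Casimir, h and the sl(2) Casimir are imposed in turn. The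
  -- operators commute, so each correction, a polynomial in one of them, preserves the conditions
  -- already obtained.
  obtain ⟨m₁, hK₁, h₁⟩ := exists_lift_K ha hp hψ α s hm.K
  rw [← h₁] at hm he hh ⊢
  obtain ⟨P₂, hC₂, h₂⟩ := exists_lift_of_finite (map_casimir_apply hψ) hm.gen
  have hw₂ : IsWt p a α s 0 (aeval (casimir p a) P₂ m₁) := by
    refine ⟨?_, hC₂⟩
    have := commute_aeval_right (ha.casimir_commute_K hp).symm P₂
    rw [← Module.End.mul_apply, this.eq, Module.End.mul_apply, hK₁, map_smul]
  generalize aeval (casimir p a) P₂ m₁ = m₂ at *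
  rw [← h₂] at hm he hh ⊢
  have hKh := ha.h_commute_of ha.e_commute_K ha.f_commute_K
  have hCh := ha.h_commute_of (ha.casimir_commute_e hp) (ha.casimir_commute_f hp)
  obtain ⟨P₃, hh₃, h₃⟩ := exists_lift_of_finite (hψ .h) (isGenEig_of_eq hh)
  have hw₃ := hw₂.map (commute_aeval_right hCh P₃) (commute_aeval_right hKh P₃)
  generalize aeval (a .h) P₃ m₂ = m₃ at *
  rw [← h₃] at hm he hh ⊢
  have hψΩ : ∀ v, ψ (ha.sl2.Ω v) = hb.sl2.Ω (ψ v) := fun v => by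
    simp [Sl2Data.Ω_apply, IsRep.sl2, hψ]
  have hΩ : hb.sl2.Ω (ψ m₃) = (((r : ℂ) / 2) ^ 2 + r / 2) • ψ m₃ := by
    simp only [Sl2Data.Ω_apply, IsRep.sl2, he, hh, map_zero, map_smul, smul_smul, add_zero,
      ← add_smul, pow_two]
  obtain ⟨P₄, hΩ₄, h₄⟩ := exists_lift_of_finite hψΩ (isGenEig_of_eq hΩ)
  have hhΩ : Commute (a .h) ha.sl2.Ω := LinearMap.ext fun v => (ha.sl2.Ω_h v).symm
  have hw₄ := hw₃.map
    (commute_aeval_right (ha.commute_Ω (ha.casimir_commute_e hp) (ha.casimir_commute_f hp)) P₄)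
    (commute_aeval_right (ha.commute_Ω ha.e_commute_K ha.f_commute_K) P₄)
  have hh₄ := hh₃.apply_of_commute (commute_aeval_right hhΩ P₄).symm.symm
  generalize aeval ha.sl2.Ω P₄ m₃ = m₄ at *
  -- The two generalized eigenvalue conditions make the vector highest, and then h acts on it by a
  -- scalar.
  have he₄ := ha.sl2.e_eq_zero hh₄ hΩ₄
  exact ⟨m₄, h₄, hw₄, he₄, ha.sl2.h_eq hh₄ he₄⟩

/-- The map from the irreducible representation of `sl₂` given by a highest weight vector. -/
def hwMap (a : Gen → Module.End ℂ M) (r : ℕ) (m : M) : (Fin (r + 1) → ℂ) →ₗ[ℂ] M :=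
  Fintype.linearCombination ℂ fun j : Fin (r + 1) => (a .f ^ (j : ℕ)) m

lemma hwMap_apply {r : ℕ} {m : M} (v : Fin (r + 1) → ℂ) :
    hwMap a r m v = ∑ j : Fin (r + 1), v j • (a .f ^ (j : ℕ)) m := rfl

lemma hwMap_e₀ {r : ℕ} {m : M} : hwMap a r m (e₀ (r + 1)) = m := by
  rw [hwMap_apply, Fin.sum_univ_succ, Finset.sum_eq_zero]
  · simp [e₀]
  · intro j _
    simp [e₀]

lemma hwMap_f {r : ℕ} {m : M} (hm : (a .f ^ (r + 1)) m = 0) (v : Fin (r + 1) → ℂ) :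
    a .f (hwMap a r m v) = hwMap a r m (fL (r + 1) v) := by
  rw [hwMap_apply, hwMap_apply, map_sum, Fin.sum_univ_castSucc, Fin.sum_univ_succ]
  have h0 : fL (r + 1) v 0 = 0 := cf_fL_zero (r + 1) v
  have h1 : ∀ j : Fin r, fL (r + 1) v j.succ = v j.castSucc := fun j => by
    have := cf_fL_succ (Nat.succ_lt_succ j.2) v
    rwa [cf_of_lt (Nat.succ_lt_succ j.2), cf_of_lt (by omega)] at this
  rw [h0, zero_smul, zero_add, Fin.val_last, map_smul, ← Module.End.mul_apply, ← pow_succ', hm,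
    smul_zero, add_zero]
  refine Finset.sum_congr rfl fun j _ => ?_
  rw [h1, map_smul, ← Module.End.mul_apply, ← pow_succ', Fin.val_castSucc, Fin.val_succ]

lemma hwMap_e (ha : IsRep p a) {r : ℕ} {m : M} (he : a .e m = 0) (hh : a .h m = ((r : ℂ) / 2) • m)
    (v : Fin (r + 1) → ℂ) : a .e (hwMap a r m v) = hwMap a r m (eL (r + 1) v) := by
  rw [hwMap_apply, hwMap_apply, map_sum, Fin.sum_univ_succ, Fin.sum_univ_castSucc]
  have h0 : eL (r + 1) v (Fin.last r) = 0 := by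
    have := cf_eL (r + 1) r v
    rw [cf_of_lt (Nat.lt_succ_self r)] at this
    refine this.trans ?_
    push_cast
    rw [sub_self, mul_zero, zero_mul]
  have h1 : ∀ j : Fin r, eL (r + 1) v j.castSucc = ((j : ℂ) + 1) * ((r : ℂ) - j) * v j.succ :=
    fun j => by
      have := cf_eL (r + 1) j v
      rw [cf_of_lt (Nat.succ_lt_succ j.2), cf_of_lt (by omega)] at this
      refine this.trans ?_
      push_cast
      rw [add_sub_add_right_eq_sub]
      rfl
  rw [h0, zero_smul, add_zero, Fin.val_zero, map_smul, pow_zero, Module.End.one_apply, he,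
      smul_zero,
    zero_add]
  refine Finset.sum_congr rfl fun j _ => ?_
  have h2 := ha.sl2.e_f_pow (j : ℕ) he
  simp only [IsRep.sl2] at h2
  rw [h1, map_smul, Fin.val_castSucc, Fin.val_succ, h2, hh]
  simp only [map_smul, smul_smul, ← sub_smul]
  congr 1
  ring

lemma isWt_hwMap (ha : IsRep p a) (hp : 2 ≤ p) {α : ℤˣ} {s r : ℕ} {m : M} (hm : IsWt p a α s 0 m)
    (v : Fin (r + 1) → ℂ) : IsWt p a α s 0 (hwMap a r m v) := by
  rw [hwMap_apply]
  have : ∑ j : Fin (r + 1), v j • (a .f ^ (j : ℕ)) m =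
      (∑ j : Fin (r + 1), v j • a .f ^ (j : ℕ) : Module.End ℂ M) m := by
    simp [LinearMap.sum_apply]
  rw [this]
  exact hm.map (Commute.sum_right _ _ _ fun j _ =>
      ((ha.casimir_commute_f hp).pow_right _).smul_right _)
    (Commute.sum_right _ _ _ fun j _ => (ha.f_commute_K.pow_right _).smul_right _)

end Lift

/-- The Casimir minus its eigenvalue has square zero, so exponent 2 suffices. -/
lemma isWt_graded [NeZero p] {A B : Type} [AddCommGroup A] [Module ℂ A] [AddCommGroup B]
    [Module ℂ B] {S : SlData (A × B)} (hS : S.IsGraded) (hp : 2 ≤ p) (α : ℤˣ) {s : ℕ} (hs1 : 1 ≤ s)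
    (hs : s < p) (v : grd A B p s) (hv : ∀ n ≠ 0, v.1 n = 0) :
    IsWt p (fun g => (actT α s S g).restrict (actT_mem (p := p) (α := α) hS hp hs1 hs g)) α s 0 v
        := by
  refine ⟨Subtype.ext (funext fun n => ?_), 2, ?_⟩
  · change actT α s S .K _ n = kap p α s 0 • v.1 n
    rw [actT_K]
    by_cases h : n = 0
    · subst h; rfl
    · rw [Submodule.subtype_apply, hv n h, smul_zero, smul_zero]
  · have h1 : ∀ w, (aeval (casimir p fun g => (actT α s S g).restrict
        (actT_mem (p := p) (α := α) hS hp hs1 hs g)) (X - C (cas p α s)) w).1 =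
        casN p α s S w.1 := fun w => by
      have h2 := LinearMap.congr_fun (casimir_actT (α := α) S hp hs1 hs) w.1
      rw [LinearMap.add_apply, Module.algebraMap_end_apply, ← sub_eq_iff_eq_add'] at h2
      rw [← h2, map_sub, aeval_X, aeval_C]
      rfl
    rw [pow_two, map_mul, Module.End.mul_apply]
    refine Subtype.ext ?_
    rw [h1, h1, ← Module.End.mul_apply, casN_mul_self]
    rfl

lemma projective_pMod [NeZero p] (hp : 2 ≤ p) (α : ℤˣ) {s : ℕ} (hs1 : 1 ≤ s) (hs : s < p) (r : ℕ) :
    Projective (pMod hp α hs1 hs r) := by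
  refine projective_modOf _ fun M N ψ φ hsurj hψ hφ => ?_
  have : Module.Finite ℂ M.obj := M.property
  obtain ⟨m₀, hm₀⟩ := hsurj (φ (genP hs1 r))
  have ha := isRep_actOf M
  have hw := isWt_graded (α := α) (isGraded_dataP (repL (r + 1))) hp hs1 hs (genP hs1 r)
    fun n hn => Pi.single_eq_of_ne hn _
  have hw₀ : IsWt p (actOf N) α s 0 (ψ m₀) := by
    rw [hm₀]
    exact ⟨by rw [← hφ, hw.K, map_smul], hw.gen.map (map_casimir_apply hφ)⟩
  have he₀ : actOf N .e (ψ m₀) = 0 := by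
    rw [hm₀, ← hφ, ← map_zero φ]
    congr 1
    refine Subtype.ext (funext fun n => ?_)
    change actT α s (dataP (repL (r + 1))) .e _ n = 0
    rw [actT_e]
    by_cases h : n = 0
    · subst h; simp [genP, dataP, repL, eL_e₀]
    · simp [genP, Pi.single_eq_of_ne h]
  have hh₀ : actOf N .h (ψ m₀) = ((r : ℂ) / 2) • ψ m₀ := by
    rw [hm₀, ← hφ, ← map_smul]
    congr 1
    refine Subtype.ext (funext fun n => ?_)
    change actT α s (dataP (repL (r + 1))) .h _ n = _
    rw [actT_h]
    by_cases h : n = 0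
    · subst h; simp [genP, dataP, repL, hL_e₀, div_eq_inv_mul]
    · simp [genP, Pi.single_eq_of_ne h]
  obtain ⟨m, hm, hwm, he, hh⟩ := exists_lift_highest ha (isRep_actOf N) hp hψ hw₀ he₀ hh₀
  have hf := ha.sl2.f_pow_eq_zero he hh
  have hχ := extMap_actT ha hp hs1 hs (u := hwMap (actOf M) r m) (L := repL (r + 1))
    (isWt_hwMap ha hp hwm) (hwMap_e ha he hh) (hwMap_f hf)
  refine ⟨extMap p α s (actOf M) (hwMap (actOf M) r m) ∘ₗ Submodule.subtype _,
    fun g v => hχ g v.1, fun v => ?_⟩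
  -- Both homomorphisms to N agree on the generator, hence everywhere.
  refine mem_of_genP_mem (hp := hp) (α := α) (hs1 := hs1) (hs := hs)
    (LinearMap.eqLocus (ψ ∘ₗ extMap p α s (actOf M) (hwMap (actOf M) r m) ∘ₗ Submodule.subtype _)
      φ) ?_ (fun g v hv => ?_) v
  · change ψ (extMap p α s (actOf M) (hwMap (actOf M) r m) (Pi.single 0 ((e₀ (r + 1), 0), (0,
      0)))) =
      φ (genP hs1 r)
    rw [extMap_single hs1, hwMap_e₀, hm, hm₀]
  · change ψ (extMap p α s (actOf M) (hwMap (actOf M) r m) v.1) = φ v at hv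
    change ψ (extMap p α s (actOf M) (hwMap (actOf M) r m) (actT α s _ g v.1)) = φ _
    rw [hχ, hψ, hv, hφ]

end Projectivity

/-! ### Assembly, and comparison with the parameters of the theorem. -/

section Main

/-- Precomposition with an isomorphism on extension groups. -/
def extCongr {𝒞 : Type*} [Category 𝒞] [Abelian 𝒞] [Linear ℂ 𝒞] [HasExt 𝒞] {X X' : 𝒞} (i : X ≅ X')
    (Y : 𝒞) (n : ℕ) : Abelian.Ext X' Y n ≃ₗ[ℂ] Abelian.Ext X Y n :=
  LinearEquiv.ofBijective ((Abelian.Ext.mk₀ i.hom).precompOfLinear ℂ Y (zero_add n))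
    (Function.bijective_iff_has_inverse.2
      ⟨fun y => (Abelian.Ext.mk₀ i.inv).comp y (zero_add n), fun x => by simp, fun x => by simp⟩)

variable {p : ℕ}

/-- The types of the irreducible modules in the blocks that are not semisimple. -/
abbrev BlockType (p : ℕ) : Type := {t : ℤˣ × ℕ // 1 ≤ t.2 ∧ t.2 < p}

/-- The type of the other irreducible modules in the block. -/
def BlockType.flip (t : BlockType p) : BlockType p :=
  ⟨(-t.1.1, p - t.1.2), by have := t.2; dsimp only; omega⟩

lemma BlockType.flip_involutive : Function.Involutive (flip (p := p)) := fun t => by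
  refine Subtype.ext (Prod.ext (neg_neg _) ?_)
  have := t.2
  simp only [flip]
  omega

lemma isLineIf_ext_simpleMod (hp : 2 ≤ p) (t : BlockType p) (r : ℕ) {α' : ℤˣ} {s' r' : ℕ}
    (hs1' : 1 ≤ s') (hs' : s' ≤ p) (n : ℕ) :
    IsLineIf (Abelian.Ext (simpleMod p hp t.1.1 t.1.2 r t.2.2.le) (simpleMod p hp α' s' r' hs') n)
      ((α' = (BlockType.flip^[n] t).1.1 ∧ s' = (BlockType.flip^[n] t).1.2) ∧
        ∃ x, x < r ∧ x ≤ n ∧ r' + 2 * x = r + n) := by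
  have : NeZero p := ⟨by omega⟩
  obtain ⟨i⟩ := nonempty_iso_xMod hp t.1.1 t.2.1 t.2.2 r
  have : ∀ (t : BlockType p) (r : ℕ), Projective (pMod hp t.1.1 t.2.1 t.2.2 r) := fun t r =>
    projective_pMod hp _ _ _ r
  refine (isLineIf_ext_of_system BlockType.flip (fun t r => xMod hp t.1.1 t.2.1 t.2.2 r)
    (fun t r => wMod hp t.1.1 t.2.1 t.2.2 r) (fun t r => pMod hp t.1.1 t.2.1 t.2.2 r)
    (simpleMod p hp α' s' r' hs') (fun t => isZero_xMod hp t.1.1 t.2.1 t.2.2)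
    (fun t r => shortExact_WPW hp t.1.1 t.2.1 t.2.2 r)
    (fun t r => shortExact_XWX hp t.1.1 t.2.1 t.2.2 r)
    (fun t => α' = t.1.1 ∧ s' = t.1.2) r' ?_ (fun t r => isLineIf_xMod_hom hp t.1.1 t.2.1 t.2.2 r
        hs1' hs')
    (fun t r => isLineIf_wMod_hom hp t.1.1 t.2.1 t.2.2 r hs1' hs')
    (fun t r hr => subsingleton_pMod_hom hp t.1.1 t.2.1 t.2.2 hs' hr) n t r).congr (extCongr i _ n)
        Iff.rfl
  -- The sign α separates the two types of a block, even when s = p − s.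
  rintro t ⟨h1, -⟩ ⟨h2, -⟩
  exact units_ne_neg_self t.1.1 (h1.symm.trans h2)

lemma exists_steps_iff {a b : ℚ} {C : ℚ → Prop} :
    (∃ k ∈ steps a b, C k) ↔ ∃ j : ℕ, a + j ≤ b ∧ C (a + j) := by
  constructor
  · rintro ⟨_, ⟨⟨j, rfl⟩, h⟩, hC⟩; exact ⟨j, h, hC⟩
  · rintro ⟨j, h, hC⟩; exact ⟨_, ⟨⟨j, rfl⟩, h⟩, hC⟩

/-- All rows of the table describe r' = r + n − 2x with 0 ≤ x ≤ min(n, r − 1); the case distinction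
n < r or n ≥ r only decides which bound is active. -/
lemma extIsLine_iff {n : ℕ} {α : ℤˣ} {s r : ℕ} (hr : 1 ≤ r) {α' : ℤˣ} {s' r' : ℕ} :
    ExtIsLine p n α s r α' s' r' ↔
      (Even n ∧ α' = α ∧ s' = s ∨ Odd n ∧ α' = -α ∧ s' = p - s) ∧
        ∃ x, x < r ∧ x ≤ n ∧ r' + 2 * x = r + n := by
  have key₁ : ∀ a b : ℚ, n < r → ∀ c : ℚ, a + n = b → r + 2 * a + c = r - n →
      ((∃ j : ℕ, a + j ≤ b ∧ (r' : ℚ) = r + 2 * (a + j) + c) ↔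
        ∃ x, x < r ∧ x ≤ n ∧ r' + 2 * x = r + n) := by
    intro a b hnr c hab hc
    constructor
    · rintro ⟨j, hj, h⟩
      have h1 : (j : ℚ) ≤ n := by linarith
      have h2 : (r' : ℚ) + n = r + 2 * j := by linarith
      norm_cast at h1 h2
      -- The parameter j counts the steps of k from below, whereas x counts down from the largest
      -- r'.
      exact ⟨n - j, by omega⟩
    · rintro ⟨x, -, hx, h⟩
      obtain ⟨j, rfl⟩ := Nat.exists_eq_add_of_le hx
      have h' : (r' : ℚ) + 2 * x = r + (x + j) := by exact_mod_cast h
      push_cast at hab hc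
      exact ⟨j, by have : (0 : ℚ) ≤ x := Nat.cast_nonneg x
                   linarith, by linarith⟩
  have key₂ : ∀ a b : ℚ, r ≤ n → ∀ c : ℚ, a + r = b + 1 → 2 * a + c = n - r + 2 →
      ((∃ j : ℕ, a + j ≤ b ∧ (r' : ℚ) = 2 * (a + j) + c) ↔
        ∃ x, x < r ∧ x ≤ n ∧ r' + 2 * x = r + n) := by
    intro a b hnr c hab hc
    constructor
    · rintro ⟨j, hj, h⟩
      have h1 : (j : ℚ) + 1 ≤ r := by linarith
      have h2 : (r' : ℚ) + r = n + 2 + 2 * j := by linarith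
      norm_cast at h1 h2
      -- Here x is bounded by r − 1, the value that belongs to the smallest k.
      exact ⟨r - 1 - j, by omega⟩
    · rintro ⟨x, hx, -, h⟩
      obtain ⟨j, rfl⟩ := Nat.exists_eq_add_of_le (show x + 1 ≤ r from hx)
      have h' : (r' : ℚ) + 2 * x = (x + 1 + j) + n := by exact_mod_cast h
      push_cast at hab hc
      exact ⟨j, by have : (0 : ℚ) ≤ x := Nat.cast_nonneg x
                   linarith, by linarith⟩
  rw [ExtIsLine]
  by_cases hr1 : r = 1
  · subst hr1
    have h : (∃ x, x < 1 ∧ x ≤ n ∧ r' + 2 * x = 1 + n) ↔ r' = n + 1 :=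
      ⟨fun ⟨x, h1, h2, h3⟩ => by omega, fun h => ⟨0, by omega⟩⟩
    rw [if_pos rfl, h]
    tauto
  · have e₁ := fun h => key₁ (-(n / 2)) (n / 2) h 0 (by ring) (by ring)
    have e₂ := fun h => key₂ ((n - r + 2) / 2) ((n + r) / 2) h 0 (by ring) (by ring)
    have e₃ := fun h => key₁ (-((n + 1) / 2)) ((n - 1) / 2) h 1 (by ring) (by ring)
    have e₄ := fun h => key₂ ((n - r + 1) / 2) ((n + r - 1) / 2) h 1 (by ring) (by ring)
    simp only [add_zero] at e₁ e₂
    rw [if_neg hr1]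
    simp only [exists_steps_iff]
    rcases lt_or_ge n r with h | h
    · rw [e₁ h, e₃ h]
      simp only [h, h.not_ge, true_and, false_and, and_false, false_or, or_false, or_and_right,
          and_assoc]
    · rw [e₂ h, e₄ h]
      simp only [h, h.not_gt, true_and, false_and, and_false, false_or, or_and_right, and_assoc]

lemma flip_iterate (n : ℕ) (t : BlockType p) (α' : ℤˣ) (s' : ℕ) :
    (α' = (BlockType.flip^[n] t).1.1 ∧ s' = (BlockType.flip^[n] t).1.2) ↔
      (Even n ∧ α' = t.1.1 ∧ s' = t.1.2 ∨ Odd n ∧ α' = -t.1.1 ∧ s' = p - t.1.2) := by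
  rcases Nat.even_or_odd n with h | h
  · rw [BlockType.flip_involutive.iterate_even h]
    have := Nat.not_odd_iff_even.2 h
    simp only [id]
    tauto
  · rw [BlockType.flip_involutive.iterate_odd h]
    have := Nat.not_even_iff_odd.2 h
    simp only [BlockType.flip]
    tauto

lemma isLineIf_ext (hp : 2 ≤ p) (α : ℤˣ) {s : ℕ} (hs1 : 1 ≤ s) (hs : s < p) {r : ℕ} (hr : 1 ≤ r)
    {α' : ℤˣ} {s' r' : ℕ} (hs1' : 1 ≤ s') (hs' : s' ≤ p) (n : ℕ) :
    IsLineIf (Abelian.Ext (simpleMod p hp α s r hs.le) (simpleMod p hp α' s' r' hs') n)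
      (ExtIsLine p n α s r α' s' r') :=
  (isLineIf_ext_simpleMod hp ⟨(α, s), hs1, hs⟩ r hs1' hs' n).congr (LinearEquiv.refl ℂ _) (by
    rw [flip_iterate, extIsLine_iff hr])

lemma extIsLine_one_iff {α : ℤˣ} {s r : ℕ} (hr : 1 ≤ r) {α' : ℤˣ} {s' r' : ℕ} (hr' : 1 ≤ r') :
    ExtIsLine p 1 α s r α' s' r' ↔ α' = -α ∧ s' = p - s ∧ (r' = r + 1 ∨ r = r' + 1) := by
  have h : (∃ x, x < r ∧ x ≤ 1 ∧ r' + 2 * x = r + 1) ↔ (r' = r + 1 ∨ r = r' + 1) := by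
    constructor
    · rintro ⟨x, h1, h2, h3⟩; omega
    · rintro (h | h)
      · exact ⟨0, by omega⟩
      · exact ⟨1, by omega⟩
  rw [extIsLine_iff hr, h]
  simp [and_assoc]

end Main

end

end LUq

open CategoryTheory LUq in
theorem mainTheorem2 (p : ℕ) (hp : 2 ≤ p) (α α' : ℤˣ) (s r s' r' : ℕ)
    (hs1 : 1 ≤ s) (hs : s < p) (hr : 1 ≤ r)
    (hs1' : 1 ≤ s') (hs' : s' ≤ p) (hr' : 1 ≤ r') :
    (∀ n : ℕ, 1 ≤ n →
      (ExtIsLine p n α s r α' s' r' →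
        Nonempty (Abelian.Ext (simpleMod p hp α s r hs.le) (simpleMod p hp α' s' r' hs') n
          ≃ₗ[ℂ] ℂ)) ∧
      (¬ ExtIsLine p n α s r α' s' r' →
        Subsingleton
          (Abelian.Ext (simpleMod p hp α s r hs.le) (simpleMod p hp α' s' r' hs') n))) ∧
    (α' = -α ∧ s' = p - s ∧ (r' = r + 1 ∨ r = r' + 1) →
      Nonempty (Abelian.Ext (simpleMod p hp α s r hs.le) (simpleMod p hp α' s' r' hs') 1
        ≃ₗ[ℂ] ℂ)) ∧
    (¬ (α' = -α ∧ s' = p - s ∧ (r' = r + 1 ∨ r = r' + 1)) →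
      Subsingleton
        (Abelian.Ext (simpleMod p hp α s r hs.le) (simpleMod p hp α' s' r' hs') 1)) :=
  have h := fun n => isLineIf_ext hp α hs1 hs hr (α' := α') (r' := r') hs1' hs' n
  ⟨fun n _ => h n, (h 1).1.comp (extIsLine_one_iff hr hr').2,
    fun h' => (h 1).2 (mt (extIsLine_one_iff hr hr').1 h')⟩
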